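/- **Functions.** Let $\mathbf R$ be the ring of holomorphic functions $f:U\to\mathbb C$ in variables $(Q,p,s)$, where $U$ is an open dense subset of $(\mathbb C^\times)^3$ depending on $f$, two such functions being identified when they agree on an open dense subset. It is an algebra over $\mathbf k=\mathbb C(Q)$. For $\gamma=\begin{pmatrix}\alpha&\beta\\ \gamma'&\delta\end{pmatrix}\in SL(2,\mathbb Z)$ let $\widehat\delta_{(p,s)\mapsto(p^{\alpha}s^{\beta},p^{\gamma'}s^{\delta})}$ be the ring automorphism $f(Q,p,s)\mapsto f(Q,p^{\alpha}s^{\beta},p^{\gamma'}s^{\delta})$ of $\mathbf R$, acting on $\mathbf R^3$ coordinatewise. For $0<|p_j|<1$ put $(z;p_1,\dots,p_n)=\prod_{i_1,\dots,i_n\ge0}(1-zp_1^{i_1}\cdots p_n^{i_n})$, and extend it to $|p_j|\ne0,1$ by $(z;\dots,p_j^{-1},\dots)=1/(p_jz;\dots,p_j,\dots)$. For integer vectors $(a_j,b_j)\neq(0,0)$ and a Laurent polynomial $\mu=\sum_m\mu_mQ^{m_1}p^{m_2}s^{m_3}$ with integer coefficients and no terms of degree $0$ in $Q$, put $$\mathrm{pexp}\left(\frac{\mu}{\prod_{j=1}^n(1-p^{a_j}s^{b_j})}\right)=\prod_m\left(Q^{m_1}p^{m_2}s^{m_3};p^{a_1}s^{b_1},\dots,p^{a_n}s^{b_n}\right)^{\mu_m}\in\mathbf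 R^\times ,$$ which depends only on the fraction; a factor $1/(1+x)$ with $x=p^as^b$ is read as $(1-x)/(1-x^2)$. **Operators.** Put $q=Q^8-Q^{-8}$, $\Delta=(1-s^2)(1-p^2/s^2)$, and $$e_1=\mathrm{pexp}\left(\tfrac{-q\,ps^{-1}(s^2+2ps+p)}{\Delta}\right),\quad e_2=\mathrm{pexp}\left(\tfrac{-q\,ps^{-1}(s+2ps+p)}{\Delta}\right),\quad e_3=\mathrm{pexp}\left(\tfrac{-q\,p(s+2p+1)}{\Delta}\right),$$ $$D_A=\mathrm{diag}(1,-\mathrm iQ,-1),\qquad D_B=\begin{pmatrix}e_1&\frac{2Q}{1-Q^4}e_2&\frac{2Q^4}{(1-Q^4)^2}e_1\\ -\frac{1-Q^4}{Q^3}e_3&0&\frac{2Q}{1-Q^4}e_3\\ \frac{(1-Q^4)^2}{2Q^4}e_1&-\frac{1-Q^4}{Q^3}e_2&e_1\end{pmatrix},$$ $$\widehat D_A=D_A\circ\widehat\delta_{(p,s)\mapsto(ps,s)},\qquad\widehat D_B=D_B\circ\widehat\delta_{(p,s)\mapsto(p,s/p)},\qquad\widehat S=\widehat D_A\widehat D_B\widehat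 D_A$$ as operators on $\mathbf R^3$. **Algebra.** Let $F=\langle a,b\rangle$ be the free group on two generators, $\sigma$ the automorphism of $F$ exchanging $a$ and $b$, and $h=Q^2-Q^{-2}$. Let $\mathcal A$ be the associative unital $\mathbf k$-algebra with generators $\mathcal O_A^{(g)},\mathcal O_B^{(g)}$, $g\in F$, and relations, for all $g,g_1,g_2,g_3\in F$ and $X\in\{A,B\}$: * $\mathcal O_A^{(ag)}=\mathcal O_A^{(g)}$, $\mathcal O_B^{(bg)}=\mathcal O_B^{(g)}$, $\mathcal O_X^{(g)}\mathcal O_X^{(g)}=\mathcal O_X^{(1)}\mathcal O_X^{(1)}$; * $\mathcal O_B^{(g_1)}\mathcal O_A^{(g_2)}\mathcal O_B^{(g_3)}=0=\mathcal O_A^{(g_1)}\mathcal O_B^{(g_2)}\mathcal O_A^{(g_3)}$; * $\mathcal O_X^{(1)}\mathcal O_X^{(1)}\mathcal O_X^{(g)}=-h^2\mathcal O_X^{(g)}=\mathcal O_X^{(g)}\mathcal O_X^{(1)}\mathcal O_X^{(1)}$; * $\mathcal O_A^{(1)}\mathcal O_A^{(1)}\mathcal O_B^{(g)}+h^2\mathcal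 O_B^{(g)}+\mathcal O_B^{(g)}\mathcal O_A^{(1)}\mathcal O_A^{(1)}=0$, and the same with $A$ and $B$ exchanged; * $\mathcal O_A^{(g_2)}\mathcal O_A^{(g_1a^{\epsilon}b^{\epsilon}a^{\epsilon}g_2)}\mathcal O_B^{(a^{\epsilon}g_2)}+\mathcal O_B^{(a^{\epsilon}g_2)}\mathcal O_A^{(g_1a^{\epsilon}b^{\epsilon}a^{\epsilon}g_2)}\mathcal O_A^{(g_2)}=\mathcal O_B^{(g_2)}\mathcal O_B^{(\sigma(g_1)g_2)}\mathcal O_B^{(g_2)}$ for $\epsilon=\pm1$, and the same with $A,a$ and $B,b$ exchanged. **Matrices.** Put $\lambda=\mathrm{pexp}\left(\frac{q\,ps(1-p)}{(1-s^2)(1-p^2)}\right)$ and $$O_A^{(1)}=\mathrm{diag}(-\mathrm ih,0,\mathrm ih),\qquad O_B^{(1)}=\begin{pmatrix}0&\lambda&0\\-\frac{h^2}2\lambda^{-1}&0&\lambda^{-1}\\0&-\frac{h^2}2\lambda&0\end{pmatrix}.$$ Let $\varphi:F\to SL(2,\mathbb Z)$ be the homomorphism with $\varphi(a)=\begin{pmatrix}1&-1\\0&1\end{pmatrix}$,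 $\varphi(b)=\begin{pmatrix}1&0\\1&1\end{pmatrix}$, and for $u,g\in F$ put $$c_{\pm}^{(u,g)}=\mathrm{pexp}\left(\frac{\pm q}{(1+s^{-\varphi(g)_{22}}p^{\varphi(g)_{21}})(1+s^{\mp\varphi(ug)_{12}}p^{\pm\varphi(ug)_{11}})(1+s^{\varphi(ug)_{22}}p^{-\varphi(ug)_{21}})}\right).$$ Consider families of matrices $O_A^{(g)},O_B^{(g)}\in\mathrm{Mat}_{3\times3}(\mathbf R)$, $g\in F$, which take the above values at $g=1$, satisfy $$O_A^{(b^{\pm1}a^kg)}=c\,O_A^{(g)}+\frac{c-c^{-1}}{h^2}O_B^{(1)}O_B^{(1)}O_A^{(g)},\qquad c=c_\pm^{(b^{\pm1}a^k,g)},$$ for all $k\in\mathbb Z$ and all $g$ whose reduced word is empty or starts with $b^{\pm1}$, and satisfy $O_B^{(g)}=\widehat S^{-1}O_A^{(\sigma(g))}\widehat S$ for all $g\in F$. **Theorem.** The operators $\widehat D_A,\widehat D_B$ are invertible, and the following hold. 1. There are $\mathbf k$-algebra automorphisms $\mathbf a,\mathbf s$ of $\mathcal A$ with $$\mathbf a(\mathcal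 O_A^{(g)})=-\frac{\mathcal O_A^{(1)}\mathcal O_A^{(ga^{-1})}\mathcal O_A^{(1)}}{h^2},\quad\mathbf a(\mathcal O_B^{(g)})=\frac{Q\,\mathcal O_A^{(1)}\mathcal O_B^{(ga^{-1})}-Q^{-1}\mathcal O_B^{(ga^{-1})}\mathcal O_A^{(1)}}{h},\quad\mathbf s(\mathcal O_A^{(g)})=\mathcal O_B^{(\sigma(g))},\quad\mathbf s(\mathcal O_B^{(g)})=\mathcal O_A^{(\sigma(g))}$$ for all $g\in F$; they satisfy the defining relations $(\mathbf a\mathbf s)^3=\mathrm{Id}=\mathbf s^2$ of $PSL(2,\mathbb Z)$. 2. The families $O_A^{(g)},O_B^{(g)}$ described above exist and are unique. 3. There is a homomorphism of $\mathbf k$-algebras $\Psi:\mathcal A\to\mathrm{Mat}_{3\times3}(\mathbf R)$ with $\Psi(\mathcal O_A^{(g)})=O_A^{(g)}$ and $\Psi(\mathcal O_B^{(g)})=O_B^{(g)}$ for all $g\in F$. 4. $\Psi$ is $PSL(2,\mathbb Z)$-equivariant: for all $x\in\mathcal A$, as operators on $\mathbf R^3$, $$\Psi(\mathbf a(x))=\widehat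 D_A^{-1}\,\Psi(x)\,\widehat D_A,\qquad\Psi(\mathbf s(x))=\widehat S^{-1}\,\Psi(x)\,\widehat S .$$ -/

import Mathlib

open Filter Topology
open scoped Polynomial

namespace EllipticDAHA

noncomputable section

/-! ## The ring of holomorphic functions on open dense subsets of the torus -/

/-- Points `(Q, p, s)` of `ℂ³`. -/
abbrev Pt : Type := ℂ × ℂ × ℂ

/-- The torus `(ℂˣ)³` inside `ℂ³`. -/
def torus : Set Pt := {x | x.1 ≠ 0 ∧ x.2.1 ≠ 0 ∧ x.2.2 ≠ 0}

/-- `U` is an open dense subset of the torus. (The torus is open in `ℂ³`.) -/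
structure IsOpenDense (U : Set Pt) : Prop where
  isOpen : IsOpen U
  subset : U ⊆ torus
  dense : torus ⊆ closure U

theorem isOpen_torus : IsOpen torus :=
  (isOpen_ne_fun continuous_fst continuous_const).inter
    ((isOpen_ne_fun (continuous_fst.comp continuous_snd) continuous_const).inter
      (isOpen_ne_fun (continuous_snd.comp continuous_snd) continuous_const))

theorem isOpenDense_torus : IsOpenDense torus := ⟨isOpen_torus, subset_rfl, subset_closure⟩

theorem IsOpenDense.inter {U V : Set Pt} (hU : IsOpenDense U) (hV : IsOpenDense V) :
    IsOpenDense (U ∩ V) := by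
  refine ⟨hU.isOpen.inter hV.isOpen, fun x hx => hU.subset hx.1, fun x hx => ?_⟩
  rw [mem_closure_iff]
  intro O hO hxO
  obtain ⟨y, hyO, hyU⟩ := mem_closure_iff.1 (hU.dense hx) O hO hxO
  obtain ⟨z, ⟨hzO, hzU⟩, hzV⟩ :=
    mem_closure_iff.1 (hV.dense (hU.subset hyU)) (O ∩ U) (hO.inter hU.isOpen) ⟨hyO, hyU⟩
  exact ⟨z, hzO, hzU, hzV⟩

/-- The filter generated by the open dense subsets of the torus. Two functions are eventually
equal along it iff they agree on some open dense subset of the torus. -/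
def openDense : Filter Pt where
  sets := {A | ∃ U, IsOpenDense U ∧ U ⊆ A}
  univ_sets := ⟨torus, isOpenDense_torus, Set.subset_univ _⟩
  sets_of_superset := fun ⟨U, hU, h⟩ hAB => ⟨U, hU, h.trans hAB⟩
  inter_sets := fun ⟨U, hU, h⟩ ⟨V, hV, h'⟩ => ⟨U ∩ V, hU.inter hV, Set.inter_subset_inter h h'⟩

theorem mem_openDense {A : Set Pt} : A ∈ openDense ↔ ∃ U, IsOpenDense U ∧ U ⊆ A := Iff.rfl

/-- `f` restricts to a holomorphic function on some open dense subset of the torus. -/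
def HolOnOpenDense (f : Pt → ℂ) : Prop := ∃ U, IsOpenDense U ∧ DifferentiableOn ℂ f U

/-- Classes, modulo equality on an open dense subset of the torus, of functions that are
holomorphic on an open dense subset of the torus. -/
def holGerms : Subring (Germ openDense ℂ) where
  carrier := {γ | ∃ f : Pt → ℂ, HolOnOpenDense f ∧ (f : Germ openDense ℂ) = γ}
  one_mem' := ⟨1, ⟨torus, isOpenDense_torus, differentiableOn_const 1⟩, rfl⟩
  zero_mem' := ⟨0, ⟨torus, isOpenDense_torus, differentiableOn_const 0⟩, rfl⟩
  add_mem' := by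
    rintro _ _ ⟨f, ⟨U, hU, hf⟩, rfl⟩ ⟨g, ⟨V, hV, hg⟩, rfl⟩
    exact ⟨f + g, ⟨U ∩ V, hU.inter hV,
      (hf.mono Set.inter_subset_left).add (hg.mono Set.inter_subset_right)⟩, rfl⟩
  mul_mem' := by
    rintro _ _ ⟨f, ⟨U, hU, hf⟩, rfl⟩ ⟨g, ⟨V, hV, hg⟩, rfl⟩
    exact ⟨f * g, ⟨U ∩ V, hU.inter hV,
      (hf.mono Set.inter_subset_left).mul (hg.mono Set.inter_subset_right)⟩, rfl⟩
  neg_mem' := by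
    rintro _ ⟨f, ⟨U, hU, hf⟩, rfl⟩
    exact ⟨-f, ⟨U, hU, hf.neg⟩, rfl⟩

/-- The ring `𝐑` of equivalence classes of functions holomorphic on open dense subsets of the
torus `(ℂˣ)³`. -/
def FunRing : Type := holGerms

instance : CommRing FunRing := inferInstanceAs (CommRing holGerms)

open Classical in
/-- The class in `𝐑` of a function that is holomorphic on an open dense subset of the torus (its
values elsewhere are irrelevant); by convention `0` for all other functions. -/
def toFunRing (f : Pt → ℂ) : FunRing :=
  if h : HolOnOpenDense f then (⟨(f : Germ openDense ℂ), f, h, rfl⟩ : holGerms) else 0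

/-! ## `𝐑` as an algebra over `𝐤 = ℂ(Q)` -/

/-- The field `𝐤 = ℂ(Q)` of rational functions in one variable. -/
abbrev K : Type := RatFunc ℂ

/-- The variable `Q ∈ 𝐤`. -/
def Q : K := RatFunc.X

/-- The imaginary unit as an element of `𝐤`. -/
def iK : K := RatFunc.C Complex.I

/-- A polynomial `P ∈ ℂ[Q]`, viewed as the function `(Q, p, s) ↦ P(Q)`. -/
def polyHom : ℂ[X] →+* FunRing :=
  ((Germ.coeRingHom openDense).comp
      (RingHom.pi fun x : Pt => Polynomial.evalRingHom x.1)).codRestrict holGerms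
    (fun P => ⟨fun x => P.eval x.1, ⟨torus, isOpenDense_torus,
      (P.differentiable.comp differentiable_fst).differentiableOn⟩, rfl⟩)

theorem isOpenDense_eval_ne_zero {P : ℂ[X]} (hP : P ≠ 0) :
    IsOpenDense {x | x ∈ torus ∧ P.eval x.1 ≠ 0} := by
  refine ⟨isOpen_torus.inter
    (isOpen_ne_fun (P.continuous.comp continuous_fst) continuous_const), fun x hx => hx.1, ?_⟩
  intro x hx
  have hfin : {z : ℂ | P.eval z = 0}.Finite := by
    simpa [Polynomial.IsRoot] using Polynomial.finite_setOfPred_isRoot hP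
  have hd : Dense {z : ℂ | P.eval z = 0}ᶜ := hfin.countable.dense_compl ℂ
  rw [mem_closure_iff]
  intro O hO hxO
  have hcont : Continuous fun z : ℂ => ((z, x.2) : Pt) := by fun_prop
  obtain ⟨z, hz, hz'⟩ := hd.inter_open_nonempty _ ((hO.inter isOpen_torus).preimage hcont)
    ⟨x.1, hxO, hx⟩
  exact ⟨(z, x.2), hz.1, hz.2, hz'⟩

theorem isUnit_polyHom {P : ℂ[X]} (hP : P ≠ 0) : IsUnit (polyHom P) := by
  have hU := isOpenDense_eval_ne_zero hP
  have hmem : HolOnOpenDense fun x => (P.eval x.1)⁻¹ :=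
    ⟨_, hU, ((P.differentiable.comp differentiable_fst).differentiableOn).inv fun x hx => hx.2⟩
  refine IsUnit.of_mul_eq_one
    (⟨((fun x => (P.eval x.1)⁻¹ : Pt → ℂ) : Germ openDense ℂ), _, hmem, rfl⟩ : holGerms) ?_
  refine Subtype.ext (Germ.coe_eq.2 ?_)
  exact mem_openDense.2 ⟨_, hU, fun x hx => mul_inv_cancel₀ hx.2⟩

/-- A rational function `r ∈ ℂ(Q)`, viewed as the function `(Q, p, s) ↦ r(Q)`. -/
def ratHom : K →+* FunRing :=
  IsLocalization.lift (M := nonZeroDivisors ℂ[X]) (g := polyHom)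
    fun P => isUnit_polyHom (nonZeroDivisors.ne_zero P.2)

instance : Algebra K FunRing := ratHom.toAlgebra

/-! ## Iterated `q`-Pochhammer symbols and the plethystic exponential -/

/-- The infinite product `(z; p₁, …, pₙ)`, for `0 < |pⱼ| < 1`. -/
def pochhammer {n : ℕ} (z : ℂ) (y : Fin n → ℂ) : ℂ :=
  ∏' i : Fin n → ℕ, (1 - z * ∏ j, y j ^ i j)

/-- The iterated `q`-Pochhammer symbol `(z; p₁, …, pₙ)` for `|pⱼ| ≠ 0, 1`. With `εⱼ = 1` if
`|pⱼ| < 1` and `εⱼ = -1` if `|pⱼ| > 1` it is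
`(z ∏ pⱼ ^ ((εⱼ - 1) / 2); p₁ ^ ε₁, …, pₙ ^ εₙ) ^ (ε₁ ⋯ εₙ)`. -/
def extPochhammer {n : ℕ} (z : ℂ) (y : Fin n → ℂ) : ℂ :=
  pochhammer (z * ∏ j, if ‖y j‖ < 1 then 1 else (y j)⁻¹)
      (fun j => if ‖y j‖ < 1 then y j else (y j)⁻¹) ^
    (∏ j, if ‖y j‖ < 1 then (1 : ℤ) else -1)

/-- Laurent polynomials in `Q, p, s` with integer coefficients; the exponent `(m₁, m₂, m₃)`
belongs to the monomial `Q ^ m₁ p ^ m₂ s ^ m₃`. -/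
abbrev Laurent : Type := AddMonoidAlgebra ℤ (ℤ × ℤ × ℤ)

/-- The monomial `Q ^ m₁ p ^ m₂ s ^ m₃`. -/
def mono (m₁ m₂ m₃ : ℤ) : Laurent := AddMonoidAlgebra.single (m₁, m₂, m₃) 1

/-- The value of the monomial with exponent `m` at a point. -/
def evalMono (m : ℤ × ℤ × ℤ) (x : Pt) : ℂ := x.1 ^ m.1 * x.2.1 ^ m.2.1 * x.2.2 ^ m.2.2

/-- The plethystic exponential
`pexp (μ / ((1 - p ^ a₁ s ^ b₁) ⋯ (1 - p ^ aₙ s ^ bₙ)))`, as an element of `𝐑`, where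
`d j = (aⱼ, bⱼ) ≠ (0, 0)` and no monomial of `μ` has degree zero in `Q`: it takes
`Q ^ m₁ p ^ m₂ s ^ m₃` to `(Q ^ m₁ p ^ m₂ s ^ m₃; p ^ a₁ s ^ b₁, …, p ^ aₙ s ^ bₙ)`, and sums of
numerators to products. -/
def pexp {n : ℕ} (μ : Laurent) (d : Fin n → ℤ × ℤ) : FunRing :=
  toFunRing fun x => ∏ m ∈ μ.coeff.support,
    extPochhammer (evalMono m x) (fun j => evalMono (0, d j) x) ^ μ.coeff m

/-- `Q ^ 8 - Q ^ (-8)`. -/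
def q8 : Laurent := mono 8 0 0 - mono (-8) 0 0

/-! ## The difference operators -/

/-- The map `(Q, p, s) ↦ (Q, p ^ a s ^ b, p ^ c s ^ d)` for `γ = (a, b; c, d)`. -/
def deltaPt (γ : Matrix.SpecialLinearGroup (Fin 2) ℤ) (x : Pt) : Pt :=
  (x.1, x.2.1 ^ γ 0 0 * x.2.2 ^ γ 0 1, x.2.1 ^ γ 1 0 * x.2.2 ^ γ 1 1)

theorem deltaPt_mem (γ : Matrix.SpecialLinearGroup (Fin 2) ℤ) {x : Pt} (hx : x ∈ torus) :
    deltaPt γ x ∈ torus :=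
  ⟨hx.1, mul_ne_zero (zpow_ne_zero _ hx.2.1) (zpow_ne_zero _ hx.2.2),
    mul_ne_zero (zpow_ne_zero _ hx.2.1) (zpow_ne_zero _ hx.2.2)⟩

theorem deltaPt_mul (γ γ' : Matrix.SpecialLinearGroup (Fin 2) ℤ) {x : Pt} (hx : x ∈ torus) :
    deltaPt γ (deltaPt γ' x) = deltaPt (γ * γ') x := by
  obtain ⟨-, hp, hs⟩ := hx
  simp only [deltaPt, Matrix.SpecialLinearGroup.coe_mul, Matrix.mul_apply, Fin.sum_univ_two,
    mul_zpow, ← zpow_mul, zpow_add₀ hp, zpow_add₀ hs]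
  refine Prod.ext rfl (Prod.ext ?_ ?_) <;>
  · simp only [mul_comm (γ' _ _) (γ _ _)]
    ring

theorem deltaPt_one (x : Pt) : deltaPt 1 x = x := by
  simp [deltaPt]

theorem differentiableOn_deltaPt (γ : Matrix.SpecialLinearGroup (Fin 2) ℤ) :
    DifferentiableOn ℂ (deltaPt γ) torus := by
  have hp : DifferentiableOn ℂ (fun x : Pt => x.2.1) torus := by fun_prop
  have hs : DifferentiableOn ℂ (fun x : Pt => x.2.2) torus := by fun_prop
  have h : ∀ m n : ℤ, DifferentiableOn ℂ (fun x : Pt => x.2.1 ^ m * x.2.2 ^ n) torus :=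
    fun m n => (hp.zpow (Or.inl fun x hx => hx.2.1)).mul (hs.zpow (Or.inl fun x hx => hx.2.2))
  exact differentiableOn_fst.prodMk ((h _ _).prodMk (h _ _))

theorem IsOpenDense.preimage_deltaPt (γ : Matrix.SpecialLinearGroup (Fin 2) ℤ) {U : Set Pt}
    (hU : IsOpenDense U) : IsOpenDense (torus ∩ deltaPt γ ⁻¹' U) := by
  refine ⟨(differentiableOn_deltaPt γ).continuousOn.isOpen_inter_preimage isOpen_torus hU.isOpen,
    Set.inter_subset_left, fun x hx => ?_⟩
  have hy := deltaPt_mem γ hx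
  have hc : ContinuousWithinAt (deltaPt γ⁻¹) U (deltaPt γ x) :=
    ((differentiableOn_deltaPt γ⁻¹).continuousOn _ hy).mono hU.subset
  have := hc.mem_closure_image (hU.dense hy)
  rw [deltaPt_mul _ _ hx, inv_mul_cancel, deltaPt_one] at this
  refine closure_mono ?_ this
  rintro _ ⟨u, hu, rfl⟩
  refine ⟨deltaPt_mem _ (hU.subset hu), ?_⟩
  rw [Set.mem_preimage, deltaPt_mul _ _ (hU.subset hu), mul_inv_cancel, deltaPt_one]
  exact hu

theorem tendsto_deltaPt (γ : Matrix.SpecialLinearGroup (Fin 2) ℤ) :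
    Tendsto (deltaPt γ) openDense openDense := fun _ ⟨_, hU, h⟩ =>
  ⟨_, hU.preimage_deltaPt γ, fun _ hx => h hx.2⟩

/-- Composition with `deltaPt γ` on classes of arbitrary functions. -/
def deltaGerm (γ : Matrix.SpecialLinearGroup (Fin 2) ℤ) :
    Germ openDense ℂ →+* Germ openDense ℂ where
  toFun f := f.compTendsto (deltaPt γ) (tendsto_deltaPt γ)
  map_one' := rfl
  map_zero' := rfl
  map_mul' f g := Germ.inductionOn₂ f g fun _ _ => rfl
  map_add' f g := Germ.inductionOn₂ f g fun _ _ => rfl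

/-- The shift `f(Q, p, s) ↦ f(Q, p ^ a s ^ b, p ^ c s ^ d)` of `𝐑`, for `γ = (a, b; c, d)`. -/
def deltaHom (γ : Matrix.SpecialLinearGroup (Fin 2) ℤ) : FunRing →+* FunRing :=
  ((deltaGerm γ).comp holGerms.subtype).codRestrict holGerms (by
    rintro ⟨_, f, ⟨U, hU, hf⟩, rfl⟩
    exact ⟨f ∘ deltaPt γ, ⟨_, hU.preimage_deltaPt γ,
      hf.comp ((differentiableOn_deltaPt γ).mono Set.inter_subset_left) fun _ hx => hx.2⟩, rfl⟩)

/-- `3 × 3` matrices over `𝐑`. -/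
abbrev Mat3 : Type := Matrix (Fin 3) (Fin 3) FunRing

/-- Additive operators on `𝐑³`. Their multiplication is composition. -/
abbrev Op : Type := AddMonoid.End (Fin 3 → FunRing)

/-- A matrix as an operator on `𝐑³`. -/
def matOp (M : Mat3) : Op := (Matrix.mulVecLin M).toAddMonoidHom

/-- The coordinatewise shift of `𝐑³`. -/
def deltaOp (γ : Matrix.SpecialLinearGroup (Fin 2) ℤ) : Op :=
  (deltaHom γ).toAddMonoidHom.compLeft (Fin 3)

/-- The matrix `D_A`. -/
def DA : Mat3 :=
  (!![1, 0, 0; 0, -iK * Q, 0; 0, 0, -1] : Matrix (Fin 3) (Fin 3) K).map (algebraMap K FunRing)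

/-- `pexp (-(Q⁸ - Q⁻⁸) p s⁻¹ (s² + 2ps + p) / ((1 - s²)(1 - p²/s²)))`. -/
def e₁ : FunRing :=
  pexp (-q8 * mono 0 1 (-1) * (mono 0 0 2 + 2 * mono 0 1 1 + mono 0 1 0)) ![(0, 2), (2, -2)]

/-- `pexp (-(Q⁸ - Q⁻⁸) p s⁻¹ (s + 2ps + p) / ((1 - s²)(1 - p²/s²)))`. -/
def e₂ : FunRing :=
  pexp (-q8 * mono 0 1 (-1) * (mono 0 0 1 + 2 * mono 0 1 1 + mono 0 1 0)) ![(0, 2), (2, -2)]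

/-- `pexp (-(Q⁸ - Q⁻⁸) p (s + 2p + 1) / ((1 - s²)(1 - p²/s²)))`. -/
def e₃ : FunRing :=
  pexp (-q8 * mono 0 1 0 * (mono 0 0 1 + 2 * mono 0 1 0 + 1)) ![(0, 2), (2, -2)]

/-- The matrix `D_B`. -/
def DB : Mat3 :=
  !![e₁, algebraMap K FunRing (2 * Q / (1 - Q ^ 4)) * e₂,
      algebraMap K FunRing (2 * Q ^ 4 / (1 - Q ^ 4) ^ 2) * e₁;
    algebraMap K FunRing (-(1 - Q ^ 4) / Q ^ 3) * e₃, 0,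
      algebraMap K FunRing (2 * Q / (1 - Q ^ 4)) * e₃;
    algebraMap K FunRing ((1 - Q ^ 4) ^ 2 / (2 * Q ^ 4)) * e₁,
      algebraMap K FunRing (-(1 - Q ^ 4) / Q ^ 3) * e₂, e₁]

/-- The operator `D̂_A`: the matrix `D_A` after the shift `(p, s) ↦ (ps, s)`. -/
def DHatA : Op := matOp DA * deltaOp ⟨!![1, 1; 0, 1], by simp [Matrix.det_fin_two]⟩

/-- The operator `D̂_B`: the matrix `D_B` after the shift `(p, s) ↦ (p, s / p)`. -/
def DHatB : Op := matOp DB * deltaOp ⟨!![1, 0; -1, 1], by simp [Matrix.det_fin_two]⟩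

/-- The operator `Ŝ = D̂_A D̂_B D̂_A`. -/
def SHat : Op := DHatA * DHatB * DHatA

/-! ## The algebra `𝒜` -/

/-- The two letters; they label the generators of the free group and the two families of
generators of `𝒜`. -/
inductive Letter
  | A
  | B
  deriving DecidableEq

/-- The transposition of the two letters. -/
def Letter.swap : Letter → Letter
  | .A => .B
  | .B => .A

/-- The free group on two generators. -/
abbrev Free₂ : Type := FreeGroup Letter

/-- The generator `a` of the free group. -/
def a : Free₂ := FreeGroup.of .A

/-- The generator `b` of the free group. -/
def b : Free₂ := FreeGroup.of .B

/-- The automorphism of the free group that exchanges `a` and `b`. -/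
def σ : Free₂ →* Free₂ := FreeGroup.map Letter.swap

/-- The free `𝐤`-algebra on the generators `𝒪_X^{(g)}`, with `X ∈ {A, B}` and `g ∈ Free₂`. -/
abbrev FreeAlg : Type := FreeAlgebra K (Letter × Free₂)

/-- The generator `𝒪_X^{(g)}` of the free algebra. -/
def gen (X : Letter) (g : Free₂) : FreeAlg := FreeAlgebra.ι K (X, g)

/-- `Q² - Q⁻²`. -/
def qq : K := Q ^ 2 - Q⁻¹ ^ 2

/-- The defining relators of `𝒜`. -/
inductive Relator : FreeAlg → Prop
  | r0A (g : Free₂) : Relator (gen .A (a * g) - gen .A g)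
  | r0B (g : Free₂) : Relator (gen .B (b * g) - gen .B g)
  | r1 (X : Letter) (g : Free₂) : Relator (gen X g * gen X g - gen X 1 * gen X 1)
  | r2 (g₁ g₂ g₃ : Free₂) : Relator (gen .B g₁ * gen .A g₂ * gen .B g₃)
  | r3 (g₁ g₂ g₃ : Free₂) : Relator (gen .A g₁ * gen .B g₂ * gen .A g₃)
  | r4 (X : Letter) (g : Free₂) : Relator (gen X 1 * gen X 1 * gen X g + qq ^ 2 • gen X g)
  | r5 (X : Letter) (g : Free₂) : Relator (gen X g * gen X 1 * gen X 1 + qq ^ 2 • gen X g)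
  | r6 (g : Free₂) : Relator
      (gen .A 1 * gen .A 1 * gen .B g + qq ^ 2 • gen .B g + gen .B g * gen .A 1 * gen .A 1)
  | r7 (g : Free₂) : Relator
      (gen .B 1 * gen .B 1 * gen .A g + qq ^ 2 • gen .A g + gen .A g * gen .B 1 * gen .B 1)
  | r8 (g₁ g₂ : Free₂) : Relator
      (gen .A g₂ * gen .A (g₁ * a * b * a * g₂) * gen .B (a * g₂)
        + gen .B (a * g₂) * gen .A (g₁ * a * b * a * g₂) * gen .A g₂
        - gen .B g₂ * gen .B (σ g₁ * g₂) * gen .B g₂)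
  | r9 (g₁ g₂ : Free₂) : Relator
      (gen .B g₂ * gen .B (g₁ * b * a * b * g₂) * gen .A (b * g₂)
        + gen .A (b * g₂) * gen .B (g₁ * b * a * b * g₂) * gen .B g₂
        - gen .A g₂ * gen .A (σ g₁ * g₂) * gen .A g₂)
  | r10 (g₁ g₂ : Free₂) : Relator
      (gen .A g₂ * gen .A (g₁ * a⁻¹ * b⁻¹ * a⁻¹ * g₂) * gen .B (a⁻¹ * g₂)
        + gen .B (a⁻¹ * g₂) * gen .A (g₁ * a⁻¹ * b⁻¹ * a⁻¹ * g₂) * gen .A g₂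
        - gen .B g₂ * gen .B (σ g₁ * g₂) * gen .B g₂)
  | r11 (g₁ g₂ : Free₂) : Relator
      (gen .B g₂ * gen .B (g₁ * b⁻¹ * a⁻¹ * b⁻¹ * g₂) * gen .A (b⁻¹ * g₂)
        + gen .A (b⁻¹ * g₂) * gen .B (g₁ * b⁻¹ * a⁻¹ * b⁻¹ * g₂) * gen .B g₂
        - gen .A g₂ * gen .A (σ g₁ * g₂) * gen .A g₂)

/-- The algebra `𝒜`: the quotient of the free algebra by the two-sided ideal generated by the
relators. -/
abbrev Alg : Type := RingQuot fun x y : FreeAlg => Relator x ∧ y = 0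

/-- The generator `𝒪_X^{(g)}` of `𝒜`. -/
def O (X : Letter) (g : Free₂) : Alg := RingQuot.mkAlgHom K _ (gen X g)

/-- `θ` acts on the generators of `𝒜` as the automorphism `𝐚`. -/
structure IsTwist (θ : Alg ≃ₐ[K] Alg) : Prop where
  map_A : ∀ g, θ (O .A g) = -(qq ^ 2)⁻¹ • (O .A 1 * O .A (g * a⁻¹) * O .A 1)
  map_B : ∀ g, θ (O .B g) =
    qq⁻¹ • (Q • (O .A 1 * O .B (g * a⁻¹)) - Q⁻¹ • (O .B (g * a⁻¹) * O .A 1))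

/-- `θ` acts on the generators of `𝒜` as the automorphism `𝐬`. -/
structure IsSwap (θ : Alg ≃ₐ[K] Alg) : Prop where
  map_A : ∀ g, θ (O .A g) = O .B (σ g)
  map_B : ∀ g, θ (O .B g) = O .A (σ g)

/-! ## The matrices representing the generators -/

/-- The matrix `O_A^{(1)}`. -/
def OA1 : Mat3 :=
  (!![-iK * qq, 0, 0; 0, 0, 0; 0, 0, iK * qq] : Matrix (Fin 3) (Fin 3) K).map
    (algebraMap K FunRing)

/-- `pexp ((Q⁸ - Q⁻⁸) p s (1 - p) / ((1 - s²)(1 - p²)))`. -/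
def ePlus : FunRing := pexp (q8 * mono 0 1 1 * (1 - mono 0 1 0)) ![(0, 2), (2, 0)]

/-- `pexp (-(Q⁸ - Q⁻⁸) p s (1 - p) / ((1 - s²)(1 - p²)))`. -/
def eMinus : FunRing := pexp (-q8 * mono 0 1 1 * (1 - mono 0 1 0)) ![(0, 2), (2, 0)]

/-- The matrix `O_B^{(1)}`. -/
def OB1 : Mat3 :=
  !![0, ePlus, 0;
    algebraMap K FunRing (-qq ^ 2 / 2) * eMinus, 0, eMinus;
    0, algebraMap K FunRing (-qq ^ 2 / 2) * ePlus, 0]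

/-- The homomorphism `Free₂ → SL(2, ℤ)` with `a ↦ (1, -1; 0, 1)` and `b ↦ (1, 0; 1, 1)`. -/
def φ : Free₂ →* Matrix.SpecialLinearGroup (Fin 2) ℤ :=
  FreeGroup.lift fun
    | .A => ⟨!![1, -1; 0, 1], by simp [Matrix.det_fin_two]⟩
    | .B => ⟨!![1, 0; 1, 1], by simp [Matrix.det_fin_two]⟩

/-- `pexp (c (Q⁸ - Q⁻⁸) / ((1 + p ^ a₁ s ^ b₁)(1 + p ^ a₂ s ^ b₂)(1 + p ^ a₃ s ^ b₃)))`, where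
`v j = (aⱼ, bⱼ)`, through `1 / (1 + x) = (1 - x) / (1 - x²)`. -/
def pexpPlus (c : ℤ) (v : Fin 3 → ℤ × ℤ) : FunRing :=
  pexp (c • q8 * ∏ j, (1 - mono 0 (v j).1 (v j).2)) (fun j => 2 • v j)

/-- The auxiliary parameter `c₊^{(h,g)}`. -/
def cPlus (h g : Free₂) : FunRing :=
  pexpPlus 1 ![(φ g 1 0, -φ g 1 1), (φ (h * g) 0 0, -φ (h * g) 0 1),
    (-φ (h * g) 1 0, φ (h * g) 1 1)]

/-- The auxiliary parameter `c₋^{(h,g)}`. -/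
def cMinus (h g : Free₂) : FunRing :=
  pexpPlus (-1) ![(φ g 1 0, -φ g 1 1), (-φ (h * g) 0 0, φ (h * g) 0 1),
    (-φ (h * g) 1 0, φ (h * g) 1 1)]

/-- The right-hand side `c M + (c - c⁻¹) (Q² - Q⁻²)⁻² O_B^{(1)} O_B^{(1)} M` of the recursion. -/
def recStep (c : FunRing) (M : Mat3) : Mat3 :=
  c • M + ((c - Ring.inverse c) * algebraMap K FunRing (qq ^ 2)⁻¹) • (OB1 * OB1 * M)

/-- The reduced word of `g` is empty or starts with `b` or `b⁻¹`; equivalently, it has the form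
`b^{±1} a^{k₁} b^{±1} a^{k₂} ⋯ b^{±1} a^{kₙ}`. -/
def StartsWithB (g : Free₂) : Prop := ∀ l ∈ g.toWord.head?, l.1 = Letter.B

/-- `OA` and `OB` are the families of matrices `O_A^{(g)}` and `O_B^{(g)}`: `OA` solves the
recursion with initial value `O_A^{(1)}`, and `OB g = Ŝ⁻¹ O_A^{(σ(g))} Ŝ`, in accordance with the
explicit matrix `O_B^{(1)}`. -/
structure IsGeneratorMatrices (OA OB : Free₂ → Mat3) : Prop where
  A_one : OA 1 = OA1
  A_rec : ∀ (k : ℤ) (g : Free₂), StartsWithB g →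
    OA (b * a ^ k * g) = recStep (cPlus (b * a ^ k) g) (OA g)
  A_rec_inv : ∀ (k : ℤ) (g : Free₂), StartsWithB g →
    OA (b⁻¹ * a ^ k * g) = recStep (cMinus (b⁻¹ * a ^ k) g) (OA g)
  B_eq : ∀ g, matOp (OB g) = Ring.inverse SHat * matOp (OA (σ g)) * SHat
  B_one : OB 1 = OB1

end

end EllipticDAHA

open EllipticDAHA

set_option linter.unusedSimpArgs false
set_option linter.unnecessarySeqFocus false

open Filter Topology
open scoped Polynomial
-- All the matrices have a rigid shape. There are four constant rank-one matrices over 𝐤, namely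
-- `mP`, `mM`, `bP`, `bM`, such that O_A^{(g)} = c·mP + c⁻¹·mM and O_B^{(g)} = l·bP + l⁻¹·bM for
-- units c = `cocA g` and l = `cocB g` of 𝐑. The projection -(O_B^{(1)})²/h² kills `mP` and fixes
-- `mM`, so the recursion just multiplies the parameter c (`recStep_matA`). The multiplication table
-- of the four matrices settles the relations of 𝒜 up to identities of units: products of three
-- matrices of the same kind combine their parameters as x y⁻¹ z, and the sums of mixed products in
-- the degree-three relations again have a single parameter.
--
-- The units form a cocycle. `cocA` is the cocycle of the free group with values in 𝐑ˣ, for the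
-- action of SL(2, ℤ) by shifts, that is 1 at a and c₊^{(b,1)} at b; it exists because the group is
-- free. Its transform `cocD` under σ and the shift w by aba is again a cocycle, since a and b
-- satisfy the braid relation in SL(2, ℤ) and w conjugates one into the other. The degree-three
-- relations follow from `cocA (a * b * a)` = `cocD a`, which rests on the invariance of c₊^{(b,1)}
-- under the shift by ab; and λ is chosen so that `cocB` = λ / `cocD` is equivariant under a⁻¹.
--
-- All identities between the explicit units come from the fact that the plethystic exponential is a
-- homomorphism from fractions in p, s to 𝐑ˣ that depends only on the fraction
-- (`pexpUnit_eq_of_mul_eq`) and commutes with shifts (`deltaUnit_pexpUnit`); they become identities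
-- of rational functions. The analytic input is that the iterated Pochhammer symbols are holomorphic
-- and nonzero on open dense sets and satisfy (z; p₀, p) = (z; p)(z p₀; p₀, p).
--
-- The automorphisms are obtained by working with families in an arbitrary algebra that satisfy the
-- relations (`IsRep`): 𝐚 and 𝐬 transform such families into such families, and the relations of
-- PSL(2, ℤ) hold at the level of families. Equivariance is then checked on generators, by moving
-- shifts past matrices. Uniqueness holds because the recursion reaches every group element and Ŝ is
-- invertible.
namespace EllipticDAHA
noncomputable section

/-! ### Holomorphy of uniform limits and of normally convergent products. -/

section UniformLimit

variable {E : Type*} [NormedAddCommGroup E] [NormedSpace ℂ E]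

/-- A uniform limit of holomorphic functions on a ball of a complex normed space is
differentiable at the centre. -/
theorem differentiableAt_of_tendstoUniformlyOn_ball {α : Type*} {l : Filter α} [l.NeBot]
    {F : α → E → ℂ} {f : E → ℂ} {x₀ : E} {r : ℝ} (hr : 0 < r)
    (hF : ∀ n, DifferentiableOn ℂ (F n) (Metric.ball x₀ (r + r)))
    (h : TendstoUniformlyOn F f l (Metric.ball x₀ (r + r))) : DifferentiableAt ℂ f x₀ := by
  have hsub : ∀ y ∈ Metric.ball x₀ r, Metric.ball y r ⊆ Metric.ball x₀ (r + r) := fun y hy =>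
    Metric.ball_subset_ball' (by rw [Metric.mem_ball] at hy; linarith)
  have hdiff : ∀ n, ∀ y ∈ Metric.ball x₀ r, DifferentiableAt ℂ (F n) y := fun n y hy =>
    (hF n).differentiableAt
      (Metric.isOpen_ball.mem_nhds (hsub y hy (Metric.mem_ball_self hr)))
  have hC : UniformCauchySeqOn (fun n => fderiv ℂ (F n)) l (Metric.ball x₀ r) := by
    intro u hu
    obtain ⟨ε, hε, hεu⟩ := Metric.mem_uniformity_dist.1 hu
    -- With this bound on the values, a difference of two members of the family varies by at most ε
    -- r / 2 on a ball of radius r, so the Cauchy estimate bounds its derivative by ε / 2 < ε. The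
    -- doubled radius r + r in the hypotheses leaves room for such a ball around every point of the
    -- smaller ball.
    have hδ : 0 < ε * r / 4 := by positivity
    filter_upwards [h.uniformCauchySeqOn _ (Metric.dist_mem_uniformity hδ)] with m hm y hy
    refine hεu ?_
    have hmaps : Set.MapsTo (F m.1 - F m.2) (Metric.ball y r)
        (Metric.closedBall ((F m.1 - F m.2) y) (ε * r / 2)) := by
      intro z hz
      have h1 : dist (F m.1 z) (F m.2 z) < ε * r / 4 := hm z (hsub y hy hz)
      have h2 : dist (F m.1 y) (F m.2 y) < ε * r / 4 :=
        hm y (hsub y hy (Metric.mem_ball_self hr))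
      rw [dist_eq_norm] at h1 h2
      rw [Metric.mem_closedBall, dist_eq_norm]
      refine (norm_sub_le _ _).trans ?_
      simp only [Pi.sub_apply]
      linarith
    have := Complex.norm_fderiv_le_div_of_mapsTo_ball
      (((hF m.1).mono (hsub y hy)).sub ((hF m.2).mono (hsub y hy))) hmaps hr
    rw [fderiv_sub (hdiff _ y hy) (hdiff _ y hy)] at this
    rw [dist_eq_norm]
    refine this.trans_lt ?_
    field_simp
    linarith
  -- The derivatives are Cauchy in the complete dual space. Membership in the ball is placed under
  -- the existential so that a total function of limits can be chosen.
  have hlim : ∀ y : E, ∃ g, y ∈ Metric.ball x₀ r →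
      Tendsto (fun n => fderiv ℂ (F n) y) l (𝓝 g) := by
    intro y
    by_cases hy : y ∈ Metric.ball x₀ r
    · obtain ⟨g, hg⟩ := CompleteSpace.complete (hC.cauchy_map hy)
      exact ⟨g, fun _ => hg⟩
    · exact ⟨0, fun h => absurd h hy⟩
  choose g hg using hlim
  exact (hasFDerivAt_of_tendstoUniformlyOn Metric.isOpen_ball
    (hC.tendstoUniformlyOn_of_tendsto hg) (fun n y hy => (hdiff n y hy).hasFDerivAt)
    (fun y hy => h.tendsto_at (hsub y hy (Metric.mem_ball_self hr)))
    (Metric.mem_ball_self hr)).differentiableAt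

/-- An infinite product of holomorphic functions is holomorphic when it converges normally. -/
theorem differentiableAt_tprod_one_add [ProperSpace E] {ι : Type*} {f : ι → E → ℂ} {u : ι → ℝ}
    {x₀ : E} (hu : Summable u)
    (h : ∀ᶠ x in 𝓝 x₀, ∀ i, DifferentiableAt ℂ (f i) x ∧ ‖f i x‖ ≤ u i) :
    DifferentiableAt ℂ (fun x => ∏' i, (1 + f i x)) x₀ := by
  obtain ⟨R, hR, hball⟩ := Metric.nhds_basis_closedBall.eventually_iff.1 h
  have hunif := Summable.hasProdUniformlyOn_one_add (isCompact_closedBall x₀ R) hu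
    (Filter.Eventually.of_forall fun i x hx => (hball hx i).2)
    (fun i x hx => (hball hx i).1.continuousAt.continuousWithinAt)
  rw [hasProdUniformlyOn_iff_tendstoUniformlyOn] at hunif
  refine differentiableAt_of_tendstoUniformlyOn_ball (half_pos hR) (fun s => ?_)
    (hunif.mono ((add_halves R).symm ▸ Metric.ball_subset_closedBall))
  rw [add_halves]
  intro x hx
  refine DifferentiableAt.differentiableWithinAt ?_
  induction s using Finset.cons_induction with
  | empty => simp
  | cons i s hi ih =>
    simp only [Finset.prod_cons]
    exact ((hball (Metric.ball_subset_closedBall hx) i).1.const_add 1).mul ih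

end UniformLimit

/-! ## Iterated Pochhammer symbols over arbitrary finite index types -/

section Pochhammer

variable {ι κ : Type} [Fintype ι] [Fintype κ]

/-- The product `(z; p₁, …, pₙ)`, the bases being indexed by an arbitrary finite type. -/
def poch (z : ℂ) (y : ι → ℂ) : ℂ := ∏' i : ι → ℕ, (1 - z * ∏ j, y j ^ i j)

/-- The symbol `(z; p₁, …, pₙ)` for `|pⱼ| ≠ 0, 1`, the bases being indexed by an arbitrary
finite type. -/
def extPoch (z : ℂ) (y : ι → ℂ) : ℂ :=
  poch (z * ∏ j, if ‖y j‖ < 1 then 1 else (y j)⁻¹)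
      (fun j => if ‖y j‖ < 1 then y j else (y j)⁻¹) ^
    (∏ j, if ‖y j‖ < 1 then (1 : ℤ) else -1)

/-- A multiple geometric series is a product of geometric series; induction on the index type splits
off one variable at a time. -/
theorem summable_prod_pow : ∀ (ι : Type) [Fintype ι] (r : ι → ℝ), (∀ j, 0 ≤ r j) →
    (∀ j, r j < 1) → Summable fun i : ι → ℕ => ∏ j, r j ^ i j := by
  intro ι _
  refine Finite.induction_empty_option (P := fun ι => ∀ [Fintype ι] (r : ι → ℝ),
    (∀ j, 0 ≤ r j) → (∀ j, r j < 1) → Summable fun i : ι → ℕ => ∏ j, r j ^ i j)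
    ?_ ?_ ?_ ι
  · intro α β e ih _ r h0 h1
    have : Fintype α := Fintype.ofEquiv β e.symm
    have := ih (r ∘ e) (fun j => h0 _) (fun j => h1 _)
    rw [← (Equiv.arrowCongr e.symm (Equiv.refl ℕ)).summable_iff] at this
    refine this.congr fun i => ?_
    simp only [Function.comp_apply, Equiv.arrowCongr_apply, Equiv.coe_refl, Equiv.symm_symm,
      id_eq]
    exact Fintype.prod_equiv e _ _ fun _ => rfl
  · intro _ r _ _
    exact Summable.of_finite
  · intro α hα ih _ r h0 h1
    rw [← (Equiv.piOptionEquivProd (β := fun _ => ℕ)).symm.summable_iff]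
    have h := Summable.mul_of_nonneg (summable_geometric_of_lt_one (h0 none) (h1 none))
      (ih (fun j => r (some j)) (fun j => h0 _) (fun j => h1 _))
      (fun n => pow_nonneg (h0 none) n)
      (fun i => Finset.prod_nonneg fun j _ => pow_nonneg (h0 _) _)
    refine h.congr fun i => ?_
    have hF : ‹Fintype (Option α)› = instFintypeOption := Subsingleton.elim _ _
    subst hF
    simp [Fintype.prod_option, Equiv.piOptionEquivProd]

theorem summable_norm_poch (z : ℂ) {y : ι → ℂ} (hy : ∀ j, ‖y j‖ < 1) :
    Summable fun i : ι → ℕ => ‖-(z * ∏ j, y j ^ i j)‖ := by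
  simp only [norm_neg, norm_mul, norm_prod, norm_pow]
  exact (summable_prod_pow ι (fun j => ‖y j‖) (fun _ => norm_nonneg _) hy).mul_left _

theorem multipliable_poch (z : ℂ) {y : ι → ℂ} (hy : ∀ j, ‖y j‖ < 1) :
    Multipliable fun i : ι → ℕ => 1 - z * ∏ j, y j ^ i j := by
  simpa only [sub_eq_add_neg] using multipliable_one_add_of_summable (summable_norm_poch z hy)

theorem poch_ne_zero {z : ℂ} {y : ι → ℂ} (hy : ∀ j, ‖y j‖ < 1)
    (h : ∀ i : ι → ℕ, 1 - z * ∏ j, y j ^ i j ≠ 0) : poch z y ≠ 0 := by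
  simp only [poch, sub_eq_add_neg] at h ⊢
  exact tprod_one_add_ne_zero_of_summable h (summable_norm_poch z hy)

theorem poch_equiv (e : ι ≃ κ) (z : ℂ) (y : κ → ℂ) : poch z (y ∘ e) = poch z y := by
  unfold poch
  rw [← (Equiv.arrowCongr e.symm (Equiv.refl ℕ)).tprod_eq]
  refine tprod_congr fun i => ?_
  simp only [Function.comp_apply, Equiv.arrowCongr_apply, Equiv.coe_refl, Equiv.symm_symm,
    id_eq]
  rw [Equiv.prod_comp e fun j => y j ^ i j]

theorem extPoch_equiv (e : ι ≃ κ) (z : ℂ) (y : κ → ℂ) : extPoch z (y ∘ e) = extPoch z y := by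
  unfold extPoch
  rw [← poch_equiv e, ← Equiv.prod_comp e fun j => if ‖y j‖ < 1 then 1 else (y j)⁻¹,
    ← Equiv.prod_comp e fun j => if ‖y j‖ < 1 then (1 : ℤ) else -1]
  rfl

/-- A family of exponents indexed by `Option ι` either vanishes at `none`, or is a shift by one at
`none` of another family. -/
def optionPowEquiv : (ι → ℕ) ⊕ (Option ι → ℕ) ≃ (Option ι → ℕ) where
  toFun := Sum.elim (fun i j => j.elim 0 i) (fun i j => j.elim (i none + 1) fun k => i (some k))
  invFun i := if i none = 0 then Sum.inl fun j => i (some j)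
    else Sum.inr fun j => j.elim (i none - 1) fun k => i (some k)
  left_inv := by
    rintro (i | i)
    · simp
    · simp only [Sum.elim_inr, Option.elim_none, Nat.add_eq_zero_iff, one_ne_zero, and_false,
        if_false, Option.elim_some, add_tsub_cancel_right]
      congr 1; funext j; cases j <;> rfl
  right_inv := by
    intro i
    by_cases h : i none = 0
    · simp only [h, if_true, Sum.elim_inl]
      funext j; cases j <;> simp [h]
    · simp only [h, if_false, Sum.elim_inr]
      funext j; cases j
      · simp; omega
      · simp

/-- `(z; p₀, p) = (z; p) (z p₀; p₀, p)`, for bases of absolute value less than `1`. -/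
theorem poch_option (z : ℂ) {y : Option ι → ℂ} (hy : ∀ j, ‖y j‖ < 1) :
    poch z y = poch z (fun j => y (some j)) * poch (z * y none) y := by
  have h1 := (multipliable_poch z fun j => hy (some j)).hasProd
  have h2 := (multipliable_poch (z * y none) hy).hasProd
  -- The factors whose exponent at `none` is zero form the first product; the others, with that
  -- exponent lowered by one, form the second.
  refine ((Equiv.hasProd_iff optionPowEquiv).1 (HasProd.sum (a := poch z fun j => y (some j))
    (b := poch (z * y none) y) ?_ ?_)).tprod_eq
  · refine h1.congr_fun fun i => ?_
    simp [optionPowEquiv, Fintype.prod_option]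
  · refine h2.congr_fun fun i => ?_
    simp only [Function.comp_apply, optionPowEquiv, Equiv.coe_fn_mk, Sum.elim_inr,
      Fintype.prod_option, Option.elim_none, Option.elim_some]
    ring

/-- `(z; p₀, p) = (z; p) (z p₀; p₀, p)`, away from the zeros and poles. -/
theorem extPoch_option (z : ℂ) {y : Option ι → ℂ} (hy : ∀ j, ‖y j‖ ≠ 1) (hy0 : y none ≠ 0)
    (hne : extPoch (z * y none) y ≠ 0) :
    extPoch z y = extPoch z (fun j => y (some j)) * extPoch (z * y none) y := by
  have hy1 : ∀ j, ‖if ‖y j‖ < 1 then y j else (y j)⁻¹‖ < 1 := by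
    intro j
    split_ifs with h
    · exact h
    · rw [norm_inv]
      exact inv_lt_one_of_one_lt₀ (lt_of_le_of_ne (not_lt.1 h) (hy j).symm)
  unfold extPoch at hne ⊢
  simp only [Fintype.prod_option] at hne ⊢
  by_cases h : ‖y none‖ < 1
  · simp only [h, if_true, one_mul] at hne ⊢
    rw [poch_option _ hy1, mul_zpow]
    simp only [h, if_true]
    ring_nf
  · simp only [h, if_false] at hne ⊢
    rw [mul_assoc z, mul_inv_cancel_left₀ hy0] at hne ⊢
    set P := ∏ j, if ‖y (some j)‖ < 1 then (1 : ℂ) else (y (some j))⁻¹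
    set E := ∏ j, if ‖y (some j)‖ < 1 then (1 : ℤ) else -1
    -- For a base of modulus greater than one the same recursion, applied to the inverted base, is
    -- read backwards: the prefactor of the extended symbol turns z into z P y₀⁻¹ and z y₀ into z P.
    -- Solving for the other factor needs the nonvanishing hypothesis.
    have key := poch_option (z * P) hy1
    simp only [h, if_false] at key
    rw [key] at hne ⊢
    rw [neg_one_mul, zpow_neg] at hne ⊢
    rw [zpow_neg, mul_zpow]
    rw [mul_zpow] at hne
    have hz := inv_ne_zero hne
    rw [inv_inv] at hz
    have hz1 := left_ne_zero_of_mul hz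
    rw [mul_inv, mul_inv_cancel_left₀ hz1]
    ring_nf

variable {E : Type*} [NormedAddCommGroup E] [NormedSpace ℂ E]

theorem _root_.DifferentiableAt.fintype_prod {f : ι → E → ℂ} {x : E} 
    (h : ∀ j, DifferentiableAt ℂ (f j) x) : DifferentiableAt ℂ (fun x => ∏ j, f j x) x := by
  generalize (Finset.univ : Finset ι) = s
  induction s using Finset.cons_induction with
  | empty => simp
  | cons i s hi ih =>
    simp only [Finset.prod_cons]
    exact (h i).mul ih

/-- Choosing |yⱼ(x₀)| < rⱼ < 1, the terms are dominated near x₀ by (|z(x₀)| + 1) ∏ rⱼ^{iⱼ}, which is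
summable, so the product converges normally there. -/
theorem differentiableAt_poch [ProperSpace E] {z : E → ℂ} {y : ι → E → ℂ} {x₀ : E}
    (hz : ∀ᶠ x in 𝓝 x₀, DifferentiableAt ℂ z x)
    (hy : ∀ j, ∀ᶠ x in 𝓝 x₀, DifferentiableAt ℂ (y j) x) (h : ∀ j, ‖y j x₀‖ < 1) :
    DifferentiableAt ℂ (fun x => poch (z x) fun j => y j x) x₀ := by
  choose r hr hr1 using fun j => exists_between (h j)
  have hsum := (summable_prod_pow ι r (fun j => (norm_nonneg _).trans (hr j).le) hr1).mul_left
    (‖z x₀‖ + 1)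
  simp only [poch, sub_eq_add_neg]
  refine differentiableAt_tprod_one_add hsum ?_
  have hzb : ∀ᶠ x in 𝓝 x₀, ‖z x‖ < ‖z x₀‖ + 1 :=
    hz.self_of_nhds.continuousAt.norm.eventually_lt_const (lt_add_one _)
  have hyb : ∀ j, ∀ᶠ x in 𝓝 x₀, ‖y j x‖ < r j := fun j =>
    (hy j).self_of_nhds.continuousAt.norm.eventually_lt_const (hr j)
  filter_upwards [hz, eventually_all.2 hy, hzb, eventually_all.2 hyb] with x h1 h2 h3 h4 i
  refine ⟨(h1.mul (DifferentiableAt.fintype_prod fun j => (h2 j).pow _)).neg, ?_⟩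
  rw [norm_neg, norm_mul, norm_prod]
  refine mul_le_mul h3.le (Finset.prod_le_prod (fun _ _ => norm_nonneg _) fun j _ => ?_)
    (Finset.prod_nonneg fun _ _ => norm_nonneg _) (by positivity)
  rw [norm_pow]
  exact pow_le_pow_left₀ (norm_nonneg _) (h4 j).le _

end Pochhammer

/-! ## Generic points -/

theorem IsOpenDense.of_mem {U : Set Pt} (h : U ∈ openDense) (hU : IsOpen U) (hUt : U ⊆ torus) :
    IsOpenDense U := by
  obtain ⟨V, hV, hVU⟩ := h
  exact ⟨hU, hUt, hV.dense.trans (closure_mono hVU)⟩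

theorem IsOpenDense.mem_openDense {U : Set Pt} (hU : IsOpenDense U) : U ∈ openDense :=
  ⟨U, hU, subset_rfl⟩

theorem torus_mem_openDense : torus ∈ openDense := isOpenDense_torus.mem_openDense

theorem evalMono_ne_zero (m : ℤ × ℤ × ℤ) {x : Pt} (hx : x ∈ torus) : evalMono m x ≠ 0 :=
  mul_ne_zero (mul_ne_zero (zpow_ne_zero _ hx.1) (zpow_ne_zero _ hx.2.1)) (zpow_ne_zero _ hx.2.2)

theorem evalMono_add (m m' : ℤ × ℤ × ℤ) {x : Pt} (hx : x ∈ torus) :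
    evalMono (m + m') x = evalMono m x * evalMono m' x := by
  simp only [evalMono, Prod.fst_add, Prod.snd_add, zpow_add₀ hx.1, zpow_add₀ hx.2.1,
    zpow_add₀ hx.2.2]
  ring

theorem differentiableAt_evalMono (m : ℤ × ℤ × ℤ) {x : Pt} (hx : x ∈ torus) :
    DifferentiableAt ℂ (evalMono m) x :=
  ((differentiableAt_fst.zpow (Or.inl hx.1)).mul
    ((differentiableAt_fst.comp _ differentiableAt_snd).zpow (Or.inl hx.2.1))).mul
    ((differentiableAt_snd.comp _ differentiableAt_snd).zpow (Or.inl hx.2.2))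

/-- For density: along the real curve t ↦ (Q, p e^{ta}, s e^{tb}) the modulus of p^a s^b is
multiplied by e^{t(a² + b²)}, which is injective in t, so the value one is taken at most once on
each curve. -/
theorem norm_evalMono_mem_openDense {d : ℤ × ℤ} (hd : d ≠ 0) :
    {x : Pt | ‖evalMono (0, d) x‖ ≠ 1} ∈ openDense := by
  refine mem_openDense.2 ⟨torus ∩ {x : Pt | ‖evalMono (0, d) x‖ ≠ 1}, ⟨?_, Set.inter_subset_left,
    fun x hx => ?_⟩, Set.inter_subset_right⟩
  · have : ContinuousOn (fun x => ‖evalMono (0, d) x‖) torus := fun x hx =>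
      (differentiableAt_evalMono (0, d) hx).continuousAt.norm.continuousWithinAt
    exact this.isOpen_inter_preimage isOpen_torus isOpen_ne
  · obtain ⟨a, b⟩ := d
    let c : ℝ → Pt := fun t => (x.1, x.2.1 * Real.exp (t * a), x.2.2 * Real.exp (t * b))
    have hc : Continuous c := by fun_prop
    have hct : ∀ t, c t ∈ torus := fun t =>
      ⟨hx.1, mul_ne_zero hx.2.1 (by exact_mod_cast (Real.exp_pos _).ne'),
        mul_ne_zero hx.2.2 (by exact_mod_cast (Real.exp_pos _).ne')⟩
    have hk : (0 : ℝ) < a * a + b * b := by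
      have : a ≠ 0 ∨ b ≠ 0 := by
        by_contra! h
        exact hd (Prod.ext h.1 h.2)
      rcases this with h | h
      · have : (a : ℝ) ≠ 0 := by exact_mod_cast h
        have := mul_self_pos.2 this
        nlinarith [mul_self_nonneg (b : ℝ)]
      · have : (b : ℝ) ≠ 0 := by exact_mod_cast h
        have := mul_self_pos.2 this
        nlinarith [mul_self_nonneg (a : ℝ)]
    have hn : ∀ t, ‖evalMono (0, a, b) (c t)‖ =
        ‖evalMono (0, a, b) x‖ * Real.exp (t * (a * a + b * b)) := by
      intro t
      simp only [evalMono, c, zpow_zero, one_mul, norm_mul, norm_zpow, mul_zpow, Complex.norm_real,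
        Real.norm_eq_abs, Real.abs_exp, ← Real.rpow_intCast, ← Real.exp_mul]
      rw [show t * (a * a + b * b) = t * a * a + t * b * b by ring, Real.exp_add]
      ring
    have hfin : {t : ℝ | ‖evalMono (0, a, b) (c t)‖ = 1}.Subsingleton := by
      intro t ht u hu
      simp only [Set.mem_ofPred_eq, hn] at ht hu
      have hpos : ‖evalMono (0, a, b) x‖ ≠ 0 := norm_ne_zero_iff.2 (evalMono_ne_zero _ hx)
      have := Real.exp_injective (mul_left_cancel₀ hpos (ht.trans hu.symm))
      exact mul_right_cancel₀ hk.ne' this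
    have hdense : Dense {t : ℝ | ‖evalMono (0, a, b) (c t)‖ = 1}ᶜ :=
      hfin.finite.countable.dense_compl ℝ
    rw [mem_closure_iff]
    intro O hO hxO
    obtain ⟨t, htO, ht⟩ := hdense.inter_open_nonempty _ (hO.preimage hc) ⟨0, by simpa [c] using hxO⟩
    exact ⟨c t, htO, hct t, ht⟩

theorem finite_zpow_mul_eq_one {m : ℤ} (hm : m ≠ 0) (c : ℂ) : {z : ℂ | z ^ m * c = 1}.Finite := by
  have hn : 0 < m.natAbs := Int.natAbs_pos.2 hm
  refine ((Polynomial.nthRoots m.natAbs c⁻¹).toFinset.finite_toSet.union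
    (Polynomial.nthRoots m.natAbs c).toFinset.finite_toSet).subset fun z hz => ?_
  have h1 : z ^ m = c⁻¹ := eq_inv_of_mul_eq_one_left hz
  rcases Int.natAbs_eq m with h | h
  · left
    rw [h, zpow_natCast] at h1
    simpa [Polynomial.mem_nthRoots hn] using h1
  · right
    rw [h, zpow_neg, zpow_natCast] at h1
    simpa [Polynomial.mem_nthRoots hn] using h1

section PochFun

variable {ι κ : Type} [Fintype ι] [Fintype κ]

/-- The Pochhammer symbol of the monomials with the given exponents. -/
def pochFun (m : ℤ × ℤ × ℤ) (d : ι → ℤ × ℤ) (x : Pt) : ℂ :=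
  extPoch (evalMono m x) fun j => evalMono (0, d j) x

/-- The points of the torus at which no base has absolute value one. -/
def regular (d : ι → ℤ × ℤ) : Set Pt := {x | x ∈ torus ∧ ∀ j, ‖evalMono (0, d j) x‖ ≠ 1}

theorem isOpenDense_regular {d : ι → ℤ × ℤ} (hd : ∀ j, d j ≠ 0) : IsOpenDense (regular d) := by
  refine IsOpenDense.of_mem ?_ ?_ fun x hx => hx.1
  · have := (eventually_all.2 fun j => norm_evalMono_mem_openDense (hd j))
    filter_upwards [torus_mem_openDense, this] with x h1 h2 using ⟨h1, h2⟩
  · have : ContinuousOn (fun x j => ‖evalMono (0, d j) x‖) torus := continuousOn_pi.2 fun j x hx =>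
      (differentiableAt_evalMono (0, d j) hx).continuousAt.norm.continuousWithinAt
    have h2 : IsOpen {v : ι → ℝ | ∀ j, v j ≠ 1} := by
      simp only [Set.ofPred_forall]
      exact isOpen_iInter_of_finite fun j => isOpen_ne.preimage (continuous_apply j)
    exact this.isOpen_inter_preimage isOpen_torus h2

/-- The product of which the symbol is a power. -/
def pochBase (m : ℤ × ℤ × ℤ) (d : ι → ℤ × ℤ) (x : Pt) : ℂ :=
  poch (evalMono m x * ∏ j, if ‖evalMono (0, d j) x‖ < 1 then 1 else (evalMono (0, d j) x)⁻¹)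
    fun j => if ‖evalMono (0, d j) x‖ < 1 then evalMono (0, d j) x else (evalMono (0, d j) x)⁻¹

/-- The sign with which the product enters the symbol. -/
def pochSign (d : ι → ℤ × ℤ) (x : Pt) : ℤ := ∏ j, if ‖evalMono (0, d j) x‖ < 1 then 1 else -1

theorem pochFun_eq (m : ℤ × ℤ × ℤ) (d : ι → ℤ × ℤ) (x : Pt) :
    pochFun m d x = pochBase m d x ^ pochSign d x := rfl

theorem norm_base_lt_one {ι : Type} {d : ι → ℤ × ℤ} {x : Pt} (hx : x ∈ regular d) (j : ι) :
    ‖if ‖evalMono (0, d j) x‖ < 1 then evalMono (0, d j) x else (evalMono (0, d j) x)⁻¹‖ < 1 := by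
  split_ifs with h
  · exact h
  · rw [norm_inv]
    exact inv_lt_one_of_one_lt₀ (lt_of_le_of_ne (not_lt.1 h) (hx.2 j).symm)

/-- Makes the case distinction in the extended symbol locally constant on the regular set, so that
locally the symbol is a fixed power ±1 of a normally convergent product. -/
theorem eventually_norm_lt_one_iff {d : ι → ℤ × ℤ} {x₀ : Pt} (hx : x₀ ∈ regular d) :
    ∀ᶠ x in 𝓝 x₀, ∀ j, (‖evalMono (0, d j) x‖ < 1 ↔ ‖evalMono (0, d j) x₀‖ < 1) := by
  refine eventually_all.2 fun j => ?_
  have hc := (differentiableAt_evalMono (0, d j) hx.1).continuousAt.norm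
  rcases lt_or_gt_of_ne (hx.2 j) with h | h
  · filter_upwards [hc.eventually_lt_const h] with x hx using iff_of_true hx h
  · filter_upwards [hc.eventually_const_lt h] with x hx using iff_of_false hx.not_gt h.not_gt

theorem differentiableAt_pochBase (m : ℤ × ℤ × ℤ) {d : ι → ℤ × ℤ} {x₀ : Pt}
    (hx : x₀ ∈ regular d) : DifferentiableAt ℂ (pochBase m d) x₀ := by
  have hev : ∀ᶠ x in 𝓝 x₀, x ∈ torus := isOpen_torus.mem_nhds hx.1
  -- The same function with the case distinction frozen at x₀.
  have hT : DifferentiableAt ℂ (fun x => poch (evalMono m x * ∏ j,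
      if ‖evalMono (0, d j) x₀‖ < 1 then 1 else (evalMono (0, d j) x)⁻¹) fun j =>
      if ‖evalMono (0, d j) x₀‖ < 1 then evalMono (0, d j) x else (evalMono (0, d j) x)⁻¹) x₀ := by
    refine differentiableAt_poch ?_ (fun j => ?_) (norm_base_lt_one hx)
    · filter_upwards [hev] with x hx
      refine (differentiableAt_evalMono m hx).mul (DifferentiableAt.fintype_prod fun j => ?_)
      split_ifs
      · exact differentiableAt_const _
      · exact (differentiableAt_evalMono _ hx).inv (evalMono_ne_zero _ hx)
    · filter_upwards [hev] with x hx
      split_ifs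
      · exact differentiableAt_evalMono _ hx
      · exact (differentiableAt_evalMono _ hx).inv (evalMono_ne_zero _ hx)
  refine hT.congr_of_eventuallyEq ?_
  filter_upwards [eventually_norm_lt_one_iff hx] with x hx
  simp only [pochBase, hx]

/-- The bases do not involve Q, so for fixed p and s each factor has the form 1 - c Q^{m₁} with m₁ ≠
0 and vanishes for finitely many Q only. There are countably many factors, and the convergent
product vanishes only if some factor does; the bad values of Q form a countable set, whose
complement in ℂ is dense. -/
theorem pochBase_ne_zero_mem_openDense {m : ℤ × ℤ × ℤ} (hm : m.1 ≠ 0) {d : ι → ℤ × ℤ}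
    (hd : ∀ j, d j ≠ 0) : {x | pochBase m d x ≠ 0} ∈ openDense := by
  have hreg := isOpenDense_regular hd
  refine ⟨regular d ∩ {x | pochBase m d x ≠ 0}, ⟨?_, fun x hx => hx.1.1, fun x hx => ?_⟩,
    Set.inter_subset_right⟩
  · have : ContinuousOn (pochBase m d) (regular d) := fun x hx =>
      (differentiableAt_pochBase m hx).continuousAt.continuousWithinAt
    exact this.isOpen_inter_preimage hreg.isOpen isOpen_ne
  · rw [mem_closure_iff]
    intro O hO hxO
    obtain ⟨y, hyO, hy⟩ := mem_closure_iff.1 (hreg.dense hx) O hO hxO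
    let c : (ι → ℕ) → ℂ := fun i => evalMono (0, m.2) y *
      (∏ j, if ‖evalMono (0, d j) y‖ < 1 then 1 else (evalMono (0, d j) y)⁻¹) *
      ∏ j, (if ‖evalMono (0, d j) y‖ < 1 then evalMono (0, d j) y
        else (evalMono (0, d j) y)⁻¹) ^ i j
    have hcount : (⋃ i, {z : ℂ | z ^ m.1 * c i = 1}).Countable :=
      Set.countable_iUnion fun i => (finite_zpow_mul_eq_one hm (c i)).countable
    have hcont : Continuous fun z : ℂ => ((z, y.2) : Pt) := by fun_prop
    obtain ⟨z, hz, hz'⟩ := (hcount.dense_compl ℂ).inter_open_nonempty _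
      ((hO.inter hreg.isOpen).preimage hcont) ⟨y.1, hyO, hy⟩
    refine ⟨(z, y.2), hz.1, hz.2, poch_ne_zero (norm_base_lt_one hz.2) fun i hi => hz' ?_⟩
    rw [Set.mem_iUnion]
    refine ⟨i, ?_⟩
    rw [sub_eq_zero] at hi
    rw [Set.mem_ofPred_eq, hi]
    simp only [c, evalMono, zpow_zero, one_mul]
    ring

theorem isOpenDense_pochBase {m : ℤ × ℤ × ℤ} (hm : m.1 ≠ 0) {d : ι → ℤ × ℤ}
    (hd : ∀ j, d j ≠ 0) : IsOpenDense (regular d ∩ {x | pochBase m d x ≠ 0}) := by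
  have hreg := isOpenDense_regular hd
  refine IsOpenDense.of_mem (inter_mem ⟨_, hreg, subset_rfl⟩ (pochBase_ne_zero_mem_openDense hm hd))
    ?_ fun x hx => hx.1.1
  have : ContinuousOn (pochBase m d) (regular d) := fun x hx =>
    (differentiableAt_pochBase m hx).continuousAt.continuousWithinAt
  exact this.isOpen_inter_preimage hreg.isOpen isOpen_ne

theorem pochFun_ne_zero {m : ℤ × ℤ × ℤ} {d : ι → ℤ × ℤ} {x : Pt} (hx : pochBase m d x ≠ 0) :
    pochFun m d x ≠ 0 := zpow_ne_zero _ hx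

theorem pochFun_ne_zero_mem_openDense {m : ℤ × ℤ × ℤ} (hm : m.1 ≠ 0) {d : ι → ℤ × ℤ}
    (hd : ∀ j, d j ≠ 0) : ∀ᶠ x in openDense, pochFun m d x ≠ 0 :=
  mem_of_superset (pochBase_ne_zero_mem_openDense hm hd) fun _ => pochFun_ne_zero

theorem differentiableAt_pochFun (m : ℤ × ℤ × ℤ) {d : ι → ℤ × ℤ} {x₀ : Pt}
    (hx : x₀ ∈ regular d) (h0 : pochBase m d x₀ ≠ 0) : DifferentiableAt ℂ (pochFun m d) x₀ := by
  have : DifferentiableAt ℂ (fun x => pochBase m d x ^ pochSign d x₀) x₀ :=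
    (differentiableAt_pochBase m hx).zpow (Or.inl h0)
  refine this.congr_of_eventuallyEq ?_
  filter_upwards [eventually_norm_lt_one_iff hx] with x hx
  simp only [pochFun_eq, pochSign, hx]

theorem holOnOpenDense_pochFun {m : ℤ × ℤ × ℤ} (hm : m.1 ≠ 0) {d : ι → ℤ × ℤ}
    (hd : ∀ j, d j ≠ 0) : HolOnOpenDense (pochFun m d) :=
  ⟨_, isOpenDense_pochBase hm hd, fun _ hx =>
    (differentiableAt_pochFun m hx.1 hx.2).differentiableWithinAt⟩

theorem holOnOpenDense_pochFun_inv {m : ℤ × ℤ × ℤ} (hm : m.1 ≠ 0) {d : ι → ℤ × ℤ}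
    (hd : ∀ j, d j ≠ 0) : HolOnOpenDense (pochFun m d)⁻¹ :=
  ⟨_, isOpenDense_pochBase hm hd, fun _ hx =>
    ((differentiableAt_pochFun m hx.1 hx.2).inv (pochFun_ne_zero hx.2)).differentiableWithinAt⟩

theorem pochFun_equiv (e : ι ≃ κ) (m : ℤ × ℤ × ℤ) (d : κ → ℤ × ℤ) :
    pochFun m (d ∘ e) = pochFun m d :=
  funext fun x => extPoch_equiv e (evalMono m x) fun j => evalMono (0, d j) x

theorem pochFun_option {m : ℤ × ℤ × ℤ} (hm : m.1 ≠ 0) {d : Option ι → ℤ × ℤ}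
    (hd : ∀ j, d j ≠ 0) : ∀ᶠ x in openDense,
      pochFun m d x = pochFun m (fun j => d (some j)) x * pochFun (m + (0, d none)) d x := by
  filter_upwards [(isOpenDense_regular hd).mem_openDense,
    pochFun_ne_zero_mem_openDense (m := m + (0, d none)) (by simpa using hm) hd] with x hx h0
  have := extPoch_option (evalMono m x) hx.2 (evalMono_ne_zero _ hx.1)
  rw [← evalMono_add _ _ hx.1] at this
  exact this h0

end PochFun

/-! ## Functions and their classes -/

theorem toFunRing_of_hol {f : Pt → ℂ} (hf : HolOnOpenDense f) :
    toFunRing f = (⟨(f : Germ openDense ℂ), f, hf, rfl⟩ : holGerms) := dif_pos hf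

theorem HolOnOpenDense.mul {f g : Pt → ℂ} (hf : HolOnOpenDense f) (hg : HolOnOpenDense g) :
    HolOnOpenDense (f * g) := by
  obtain ⟨U, hU, hf⟩ := hf
  obtain ⟨V, hV, hg⟩ := hg
  exact ⟨U ∩ V, hU.inter hV, (hf.mono Set.inter_subset_left).mul (hg.mono Set.inter_subset_right)⟩

theorem HolOnOpenDense.one : HolOnOpenDense 1 :=
  ⟨torus, isOpenDense_torus, differentiableOn_const 1⟩

theorem HolOnOpenDense.comp_deltaPt {f : Pt → ℂ} (hf : HolOnOpenDense f)
    (γ : Matrix.SpecialLinearGroup (Fin 2) ℤ) : HolOnOpenDense (f ∘ deltaPt γ) := by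
  obtain ⟨U, hU, hf⟩ := hf
  exact ⟨_, hU.preimage_deltaPt γ,
      hf.comp ((differentiableOn_deltaPt γ).mono Set.inter_subset_left) fun _ hx => hx.2⟩

theorem toFunRing_mul {f g : Pt → ℂ} (hf : HolOnOpenDense f) (hg : HolOnOpenDense g) :
    toFunRing (f * g) = toFunRing f * toFunRing g := by
  rw [toFunRing_of_hol hf, toFunRing_of_hol hg, toFunRing_of_hol (hf.mul hg)]
  rfl

theorem toFunRing_one : toFunRing 1 = 1 := by
  rw [toFunRing_of_hol .one]
  rfl

theorem toFunRing_congr {f g : Pt → ℂ} (hf : HolOnOpenDense f) (hg : HolOnOpenDense g)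
    (h : f =ᶠ[openDense] g) : toFunRing f = toFunRing g := by
  rw [toFunRing_of_hol hf, toFunRing_of_hol hg]
  exact Subtype.ext (Germ.coe_eq.2 h)

theorem deltaHom_toFunRing (γ : Matrix.SpecialLinearGroup (Fin 2) ℤ) {f : Pt → ℂ}
    (hf : HolOnOpenDense f) : deltaHom γ (toFunRing f) = toFunRing (f ∘ deltaPt γ) := by
  rw [toFunRing_of_hol hf, toFunRing_of_hol (hf.comp_deltaPt γ)]
  rfl

/-- The function `f` and its inverse are holomorphic on open dense sets, and represent the unit `u`
and its inverse. -/
structure Represents (f : Pt → ℂ) (u : FunRingˣ) : Prop where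
  hol : HolOnOpenDense f
  hol_inv : HolOnOpenDense f⁻¹
  eq : toFunRing f = u
  eq_inv : toFunRing f⁻¹ = ↑u⁻¹

namespace Represents

variable {f g : Pt → ℂ} {u v : FunRingˣ}

theorem one : Represents 1 1 :=
  ⟨.one, by simpa using .one, by simpa using toFunRing_one, by simpa using toFunRing_one⟩

theorem mul (hf : Represents f u) (hg : Represents g v) : Represents (f * g) (u * v) where
  hol := hf.hol.mul hg.hol
  hol_inv := by rw [mul_inv]; exact hf.hol_inv.mul hg.hol_inv
  eq := by rw [toFunRing_mul hf.hol hg.hol, hf.eq, hg.eq, Units.val_mul]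
  eq_inv := by
    rw [mul_inv, toFunRing_mul hf.hol_inv hg.hol_inv, hf.eq_inv, hg.eq_inv, mul_inv, Units.val_mul]

theorem inv (hf : Represents f u) : Represents f⁻¹ u⁻¹ :=
  ⟨hf.hol_inv, by rw [inv_inv]; exact hf.hol, hf.eq_inv, by rw [inv_inv, inv_inv]; exact hf.eq⟩

theorem pow (hf : Represents f u) (n : ℕ) : Represents (f ^ n) (u ^ n) := by
  induction n with
  | zero => simpa using one
  | succ n ih => simpa only [pow_succ] using ih.mul hf

theorem zpow (hf : Represents f u) (k : ℤ) : Represents (f ^ k) (u ^ k) := by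
  cases k with
  | ofNat n => simpa using hf.pow n
  | negSucc n => simpa only [zpow_negSucc] using (hf.pow (n + 1)).inv

theorem prod {α : Type*} (s : Finset α) {F : α → Pt → ℂ} {U : α → FunRingˣ}
    (h : ∀ i ∈ s, Represents (F i) (U i)) : Represents (∏ i ∈ s, F i) (∏ i ∈ s, U i) := by
  induction s using Finset.cons_induction with
  | empty => simpa using one
  | cons i s hi ih =>
    simp only [Finset.prod_cons]
    exact (h i (Finset.mem_cons_self _ _)).mul (ih fun j hj => h j (Finset.mem_cons_of_mem hj))

end Represents

/-! ## The plethystic exponential as a homomorphism -/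

section PexpUnit

variable {ι κ : Type} [Fintype ι] [Fintype κ]

open Classical in
/-- The Pochhammer symbol of monomials as a unit of `𝐑`. -/
def pochUnit (m : ℤ × ℤ × ℤ) (d : ι → ℤ × ℤ) : FunRingˣ :=
  if h : m.1 ≠ 0 ∧ ∀ j, d j ≠ 0 then
    { val := toFunRing (pochFun m d)
      inv := toFunRing (pochFun m d)⁻¹
      val_inv := by
        have hf := holOnOpenDense_pochFun h.1 h.2
        have hg := holOnOpenDense_pochFun_inv h.1 h.2
        rw [← toFunRing_mul hf hg, ← toFunRing_one]
        refine toFunRing_congr (hf.mul hg) .one ?_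
        filter_upwards [pochFun_ne_zero_mem_openDense h.1 h.2] with x hx
        exact mul_inv_cancel₀ hx
      inv_val := by
        have hf := holOnOpenDense_pochFun h.1 h.2
        have hg := holOnOpenDense_pochFun_inv h.1 h.2
        rw [← toFunRing_mul hg hf, ← toFunRing_one]
        refine toFunRing_congr (hg.mul hf) .one ?_
        filter_upwards [pochFun_ne_zero_mem_openDense h.1 h.2] with x hx
        exact inv_mul_cancel₀ hx }
  -- The value 1 in the degenerate cases keeps the recursion and the change of index type valid
  -- without nondegeneracy assumptions on the remaining data.
  else 1

theorem represents_pochFun {m : ℤ × ℤ × ℤ} (hm : m.1 ≠ 0) {d : ι → ℤ × ℤ} (hd : ∀ j, d j ≠ 0) :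
    Represents (pochFun m d) (pochUnit m d) where
  hol := holOnOpenDense_pochFun hm hd
  hol_inv := holOnOpenDense_pochFun_inv hm hd
  eq := by rw [pochUnit, dif_pos ⟨hm, hd⟩]
  eq_inv := by rw [pochUnit, dif_pos ⟨hm, hd⟩]; rfl

theorem pochUnit_val {m : ℤ × ℤ × ℤ} (hm : m.1 ≠ 0) {d : ι → ℤ × ℤ} (hd : ∀ j, d j ≠ 0) :
    (pochUnit m d : FunRing) = toFunRing (pochFun m d) := (represents_pochFun hm hd).eq.symm

theorem pochUnit_of_fst_eq_zero {m : ℤ × ℤ × ℤ} (hm : m.1 = 0) (d : ι → ℤ × ℤ) :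
    pochUnit m d = 1 := dif_neg fun h => h.1 hm

theorem pochUnit_of_eq_zero (m : ℤ × ℤ × ℤ) {d : ι → ℤ × ℤ} {j : ι} (hd : d j = 0) :
    pochUnit m d = 1 := dif_neg fun h => h.2 j hd

theorem pochUnit_equiv (e : ι ≃ κ) (m : ℤ × ℤ × ℤ) (d : κ → ℤ × ℤ) :
    pochUnit m (d ∘ e) = pochUnit m d := by
  by_cases hm : m.1 = 0
  · rw [pochUnit_of_fst_eq_zero hm, pochUnit_of_fst_eq_zero hm]
  by_cases hd : ∀ j, d j ≠ 0
  · refine Units.ext ?_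
    rw [pochUnit_val hm hd, pochUnit_val (d := d ∘ e) hm fun j => hd (e j), pochFun_equiv]
  · push Not at hd
    obtain ⟨j, hj⟩ := hd
    rw [pochUnit_of_eq_zero m hj, pochUnit_of_eq_zero (j := e.symm j) m (by simpa using hj)]

theorem pochUnit_option (m : ℤ × ℤ × ℤ) {d : Option ι → ℤ × ℤ} (h0 : d none ≠ 0) :
    pochUnit m d = pochUnit m (fun j => d (some j)) * pochUnit (m + (0, d none)) d := by
  by_cases hm : m.1 = 0
  · rw [pochUnit_of_fst_eq_zero hm, pochUnit_of_fst_eq_zero hm, pochUnit_of_fst_eq_zero (by simpa),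
      one_mul]
  by_cases hd : ∀ j, d (some j) ≠ 0
  · have hd' : ∀ j, d j ≠ 0 := fun j => by cases j with
      | none => exact h0
      | some j => exact hd j
    have h1 := represents_pochFun hm hd
    have h2 := represents_pochFun (m := m + (0, d none)) (by simpa using hm) hd'
    refine Units.ext ?_
    rw [← (h1.mul h2).eq, pochUnit_val hm hd']
    exact toFunRing_congr (holOnOpenDense_pochFun hm hd') (h1.mul h2).hol (pochFun_option hm hd')
  · push Not at hd
    obtain ⟨j, hj⟩ := hd
    rw [pochUnit_of_eq_zero m hj, pochUnit_of_eq_zero (j := j) m hj,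
      pochUnit_of_eq_zero (j := some j) _ hj, one_mul]

/-- The plethystic exponential of `μ / ∏ j, (1 - p ^ aⱼ s ^ bⱼ)`, where `d j = (aⱼ, bⱼ)`, as a unit
of `𝐑`; terms of `μ` of degree zero in `Q` are disregarded. -/
def pexpUnit (μ : Laurent) (d : ι → ℤ × ℤ) : FunRingˣ :=
  μ.coeff.prod fun m k => pochUnit m d ^ k

theorem pexpUnit_add (μ ν : Laurent) (d : ι → ℤ × ℤ) :
    pexpUnit (μ + ν) d = pexpUnit μ d * pexpUnit ν d := by
  rw [pexpUnit, AddMonoidAlgebra.coeff_add]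
  exact Finsupp.prod_add_index' (fun _ => zpow_zero _) fun _ _ _ => zpow_add _ _ _

theorem pexpUnit_zero (d : ι → ℤ × ℤ) : pexpUnit 0 d = 1 := Finsupp.prod_zero_index

theorem pexpUnit_neg (μ : Laurent) (d : ι → ℤ × ℤ) : pexpUnit (-μ) d = (pexpUnit μ d)⁻¹ := by
  rw [eq_inv_iff_mul_eq_one, ← pexpUnit_add, neg_add_cancel, pexpUnit_zero]

theorem pexpUnit_single (m : ℤ × ℤ × ℤ) (k : ℤ) (d : ι → ℤ × ℤ) :
    pexpUnit (.single m k) d = pochUnit m d ^ k := by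
  rw [pexpUnit, AddMonoidAlgebra.coeff_single]
  exact Finsupp.prod_single_index (zpow_zero _)

theorem pexpUnit_equiv (e : ι ≃ κ) (μ : Laurent) (d : κ → ℤ × ℤ) :
    pexpUnit μ (d ∘ e) = pexpUnit μ d := by
  simp only [pexpUnit, pochUnit_equiv]

/-- The denominator `1 - p ^ a s ^ b`. -/
def den (v : ℤ × ℤ) : Laurent := 1 - mono 0 v.1 v.2

/-- A factor of the numerator cancels against the denominator. By additivity in the numerator it
suffices to treat a monomial, where this is the recursion (z; p₀, p) / (z p₀; p₀, p) = (z; p). -/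
theorem pexpUnit_option (μ : Laurent) {d : Option ι → ℤ × ℤ} (h0 : d none ≠ 0) :
    pexpUnit (μ * den (d none)) d = pexpUnit μ fun j => d (some j) := by
  induction μ using AddMonoidAlgebra.induction_linear with
  | zero => rw [zero_mul, pexpUnit_zero, pexpUnit_zero]
  | add μ ν hμ hν => rw [add_mul, pexpUnit_add, pexpUnit_add, hμ, hν]
  | single m k =>
    rw [den, mul_sub, mul_one, mono, AddMonoidAlgebra.single_mul_single, mul_one, sub_eq_add_neg,
      pexpUnit_add, pexpUnit_neg, pexpUnit_single, pexpUnit_single, pexpUnit_single,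
      pochUnit_option m h0, mul_zpow, mul_assoc]
    simp

/-- Expansion of a fraction by a whole family of denominators, one denominator at a time by
induction on the index type. -/
theorem pexpUnit_sumElim (μ : Laurent) (d : ι → ℤ × ℤ) {e : κ → ℤ × ℤ} (he : ∀ j, e j ≠ 0) :
    pexpUnit (μ * ∏ j, den (e j)) (Sum.elim e d) = pexpUnit μ d := by
  have key : ∀ (κ : Type) [Finite κ] [Fintype κ] (μ : Laurent) (e : κ → ℤ × ℤ),
      (∀ j, e j ≠ 0) → pexpUnit (μ * ∏ j, den (e j)) (Sum.elim e d) = pexpUnit μ d := by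
    intro κ _
    refine Finite.induction_empty_option (P := fun κ => ∀ [Fintype κ] (μ : Laurent)
      (e : κ → ℤ × ℤ), (∀ j, e j ≠ 0) →
      pexpUnit (μ * ∏ j, den (e j)) (Sum.elim e d) = pexpUnit μ d) ?_ ?_ ?_ κ
    · intro α β f ih _ μ e he
      have : Fintype α := Fintype.ofEquiv β f.symm
      rw [← ih μ (e ∘ f) fun j => he _, ← pexpUnit_equiv (Equiv.sumCongr f (Equiv.refl ι)),
        Fintype.prod_equiv f (fun j => den ((e ∘ f) j)) (fun j => den (e j)) fun _ => rfl]
      congr 1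
      funext j
      cases j <;> rfl
    · intro _ μ e _
      rw [Finset.univ_eq_empty, Finset.prod_empty, mul_one,
        ← pexpUnit_equiv (Equiv.emptySum PEmpty ι).symm]
      rfl
    · intro α _ ih hF μ e he
      have hF : hF = instFintypeOption := Subsingleton.elim _ _
      subst hF
      let f : Option (α ⊕ ι) ≃ Option α ⊕ ι :=
        { toFun := fun j => j.elim (Sum.inl none) (Sum.map some id)
          invFun := Sum.elim (fun j => j.map Sum.inl) fun j => some (Sum.inr j)
          left_inv := by rintro (_ | _ | _) <;> rfl
          right_inv := by rintro ((_ | _) | _) <;> rfl }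
      rw [← pexpUnit_equiv f, Fintype.prod_option, mul_comm (den (e none)), ← mul_assoc]
      refine (pexpUnit_option (d := Sum.elim e d ∘ f) _ (he none)).trans ?_
      rw [← ih μ (fun j => e (some j)) fun j => he _]
      congr 1
      funext j
      cases j <;> rfl
  exact key κ μ e he

/-- The plethystic exponential depends only on the fraction. -/
theorem pexpUnit_eq_of_mul_eq {μ ν : Laurent} {d : ι → ℤ × ℤ} {e : κ → ℤ × ℤ}
    (hd : ∀ j, d j ≠ 0) (he : ∀ j, e j ≠ 0)
    (h : μ * ∏ j, den (e j) = ν * ∏ j, den (d j)) : pexpUnit μ d = pexpUnit ν e := by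
  -- Both fractions are expanded to the union of the two families of denominators, where the
  -- numerators agree by `h`; what remains is the order of the denominators.
  rw [← pexpUnit_sumElim μ d he, ← pexpUnit_sumElim ν e hd, h,
    ← pexpUnit_equiv (Equiv.sumComm ι κ)]
  congr 1
  funext j
  cases j <;> rfl

/-- Addition of fractions over the common denominator: `h` is the cross-multiplied form of μ/d + ν/e
= ρ/c, an identity of Laurent polynomials. -/
theorem pexpUnit_mul_eq {α : Type} [Fintype α] {μ ν ρ : Laurent} {d : ι → ℤ × ℤ} {e : κ → ℤ × ℤ}
    {c : α → ℤ × ℤ} (hd : ∀ j, d j ≠ 0) (he : ∀ j, e j ≠ 0) (hc : ∀ j, c j ≠ 0)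
    (h : (μ * ∏ j, den (e j) + ν * ∏ j, den (d j)) * ∏ j, den (c j) =
      ρ * ((∏ j, den (d j)) * ∏ j, den (e j))) :
    pexpUnit μ d * pexpUnit ν e = pexpUnit ρ c := by
  have hde : ∀ j, Sum.elim d e j ≠ 0 := by rintro (j | j); exacts [hd j, he j]
  have hp : ∏ j, den (Sum.elim d e j) = (∏ j, den (d j)) * ∏ j, den (e j) := by
    simp [Fintype.prod_sum_type]
  rw [← pexpUnit_sumElim ν e hd, pexpUnit_eq_of_mul_eq (e := Sum.elim d e)
    (ν := μ * ∏ j, den (e j)) hd hde (by rw [hp]; ring), ← pexpUnit_add]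
  exact pexpUnit_eq_of_mul_eq hde hc (by rw [hp, h])

/-- Terms of degree zero in Q have to be excluded, as `pexpUnit` discards them while `pexp` does
not. -/
theorem pexp_eq_pexpUnit {n : ℕ} {μ : Laurent} {d : Fin n → ℤ × ℤ} 
    (hμ : ∀ m : ℤ × ℤ × ℤ, m.1 = 0 → μ.coeff m = 0) (hd : ∀ j, d j ≠ 0) :
    pexp μ d = pexpUnit μ d := by
  have := Represents.prod μ.coeff.support (F := fun m => pochFun m d ^ μ.coeff m)
    (U := fun m => pochUnit m d ^ μ.coeff m) fun m hm =>
      (represents_pochFun (fun h => Finsupp.mem_support_iff.1 hm (hμ m h)) hd).zpow _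
  rw [pexpUnit, Finsupp.prod, ← this.eq, pexp]
  congr 1
  funext x
  rw [Finset.prod_apply]
  rfl

/-! ### Shifts -/

/-- The action of `SL(2, ℤ)` on exponents. -/
def shiftExp (γ : Matrix.SpecialLinearGroup (Fin 2) ℤ) : ℤ × ℤ →+ ℤ × ℤ where
  toFun v := (v.1 * γ 0 0 + v.2 * γ 1 0, v.1 * γ 0 1 + v.2 * γ 1 1)
  map_zero' := by simp
  map_add' v w := by ext <;> simp <;> ring

theorem shiftExp_apply (γ : Matrix.SpecialLinearGroup (Fin 2) ℤ) (v : ℤ × ℤ) :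
    shiftExp γ v = (v.1 * γ 0 0 + v.2 * γ 1 0, v.1 * γ 0 1 + v.2 * γ 1 1) := rfl

theorem shiftExp_ne_zero (γ : Matrix.SpecialLinearGroup (Fin 2) ℤ) {v : ℤ × ℤ} (hv : v ≠ 0) :
    shiftExp γ v ≠ 0 := by
  intro h
  have hdet := γ.det_coe
  rw [Matrix.det_fin_two] at hdet
  simp only [shiftExp_apply, Prod.mk_eq_zero] at h
  refine hv (Prod.ext ?_ ?_)
  · simp only [Prod.fst_zero]
    linear_combination γ 1 1 * h.1 - γ 1 0 * h.2 - v.1 * hdet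
  · simp only [Prod.snd_zero]
    linear_combination γ 0 0 * h.2 - γ 0 1 * h.1 - v.2 * hdet

/-- The action of `SL(2, ℤ)` on exponents of monomials in `Q, p, s`. -/
def shiftMono (γ : Matrix.SpecialLinearGroup (Fin 2) ℤ) : ℤ × ℤ × ℤ →+ ℤ × ℤ × ℤ :=
  (AddMonoidHom.id ℤ).prodMap (shiftExp γ)

/-- The action of `SL(2, ℤ)` on Laurent polynomials. -/
def shiftLaurent (γ : Matrix.SpecialLinearGroup (Fin 2) ℤ) : Laurent →+* Laurent :=
  AddMonoidAlgebra.mapDomainRingHom ℤ (shiftMono γ)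

theorem shiftLaurent_single (γ : Matrix.SpecialLinearGroup (Fin 2) ℤ) (m : ℤ × ℤ × ℤ) (k : ℤ) :
    shiftLaurent γ (.single m k) = .single (m.1, shiftExp γ m.2) k :=
  AddMonoidAlgebra.mapDomain_single

theorem evalMono_deltaPt (γ : Matrix.SpecialLinearGroup (Fin 2) ℤ) (m : ℤ × ℤ × ℤ) {x : Pt}
    (hx : x ∈ torus) : evalMono m (deltaPt γ x) = evalMono (m.1, shiftExp γ m.2) x := by
  simp only [evalMono, deltaPt, shiftExp_apply, mul_zpow, ← zpow_mul, zpow_add₀ hx.2.1,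
    zpow_add₀ hx.2.2, mul_comm (γ _ _)]
  ring

/-- The shift of units of `𝐑`. -/
def deltaUnit (γ : Matrix.SpecialLinearGroup (Fin 2) ℤ) : FunRingˣ →* FunRingˣ :=
  Units.map (deltaHom γ : FunRing →* FunRing)

theorem deltaUnit_val (γ : Matrix.SpecialLinearGroup (Fin 2) ℤ) (u : FunRingˣ) :
    (deltaUnit γ u : FunRing) = deltaHom γ u := rfl

theorem deltaUnit_pochUnit (γ : Matrix.SpecialLinearGroup (Fin 2) ℤ) (m : ℤ × ℤ × ℤ)
    {d : ι → ℤ × ℤ} (hd : ∀ j, d j ≠ 0) :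
    deltaUnit γ (pochUnit m d) = pochUnit (m.1, shiftExp γ m.2) fun j => shiftExp γ (d j) := by
  by_cases hm : m.1 = 0
  · rw [pochUnit_of_fst_eq_zero hm, pochUnit_of_fst_eq_zero (by simpa), map_one]
  refine Units.ext ?_
  have hd' : ∀ j, shiftExp γ (d j) ≠ 0 := fun j => shiftExp_ne_zero γ (hd j)
  have hol := holOnOpenDense_pochFun hm hd
  rw [deltaUnit_val, pochUnit_val hm hd, pochUnit_val (by simpa) hd', deltaHom_toFunRing γ hol]
  refine toFunRing_congr (hol.comp_deltaPt γ) (holOnOpenDense_pochFun (by simpa) hd') ?_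
  filter_upwards [torus_mem_openDense] with x hx
  simp only [Function.comp_apply, pochFun, evalMono_deltaPt γ _ hx]

theorem deltaUnit_pexpUnit (γ : Matrix.SpecialLinearGroup (Fin 2) ℤ) (μ : Laurent)
    {d : ι → ℤ × ℤ} (hd : ∀ j, d j ≠ 0) :
    deltaUnit γ (pexpUnit μ d) = pexpUnit (shiftLaurent γ μ) fun j => shiftExp γ (d j) := by
  induction μ using AddMonoidAlgebra.induction_linear with
  | zero => simp only [map_zero, pexpUnit_zero, map_one]
  | add μ ν hμ hν => rw [map_add, pexpUnit_add, pexpUnit_add, map_mul, hμ, hν]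
  | single m k => rw [shiftLaurent_single, pexpUnit_single, pexpUnit_single, map_zpow,
      deltaUnit_pochUnit γ m hd]

end PexpUnit

/-! ## The plethystic exponentials of the statement -/

theorem mono_mul_mono (a b c a' b' c' : ℤ) :
    mono a b c * mono a' b' c' = mono (a + a') (b + b') (c + c') := by
  simp [mono, AddMonoidAlgebra.single_mul_single]

/-- Laurent polynomials that do not involve `Q`. -/
def noQ : Subring Laurent :=
  (AddMonoidAlgebra.mapDomainRingHom ℤ (AddMonoidHom.inr ℤ (ℤ × ℤ))).range

theorem mono_mem_noQ (b c : ℤ) : mono 0 b c ∈ noQ :=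
  ⟨.single (b, c) 1, AddMonoidAlgebra.mapDomain_single⟩

/-- The product lives in the Q-degrees 8 and -8 only, so numerators of this form are admissible for
`pexp`. -/
theorem coeff_q8_mul {μ : Laurent} (hμ : μ ∈ noQ) {m : ℤ × ℤ × ℤ} (hm : m.1 = 0) :
    (q8 * μ).coeff m = 0 := by
  obtain ⟨μ, rfl⟩ := hμ
  induction μ using AddMonoidAlgebra.induction_linear with
  | zero => simp
  | add μ ν hμ hν =>
    rw [map_add, mul_add, AddMonoidAlgebra.coeff_add, Finsupp.add_apply]
    exact (congrArg₂ (· + ·) hμ hν).trans (add_zero 0)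
  | single v k =>
    have h8 : ∀ j : ℤ, j ≠ 0 → (j, v) ≠ m := fun j hj h => hj ((congrArg Prod.fst h).trans hm)
    change (q8 * AddMonoidAlgebra.mapDomain _ _).coeff m = 0
    rw [AddMonoidAlgebra.mapDomain_single, q8, mono, mono, sub_mul,
      AddMonoidAlgebra.single_mul_single, AddMonoidAlgebra.single_mul_single,
      AddMonoidAlgebra.coeff_sub, Finsupp.sub_apply, AddMonoidAlgebra.coeff_single,
      AddMonoidAlgebra.coeff_single]
    simp only [Finsupp.single_apply, AddMonoidHom.inr_apply, Prod.mk_add_mk, add_zero,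
      Prod.mk_zero_zero]
    rw [zero_add, if_neg (h8 8 (by norm_num)), if_neg (h8 (-8) (by norm_num)),
      sub_zero]

theorem pexp_eq_of_eq_q8_mul {n : ℕ} {μ ν : Laurent} {d : Fin n → ℤ × ℤ} (h : μ = q8 * ν)
    (hν : ν ∈ noQ) (hd : ∀ j, d j ≠ 0) : pexp μ d = pexpUnit μ d :=
  pexp_eq_pexpUnit (fun m hm => by rw [h]; exact coeff_q8_mul hν hm) hd

theorem shiftLaurent_mono (γ : Matrix.SpecialLinearGroup (Fin 2) ℤ) (b c : ℤ) :
    shiftLaurent γ (mono 0 b c) = mono 0 (b * γ 0 0 + c * γ 1 0) (b * γ 0 1 + c * γ 1 1) :=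
  shiftLaurent_single _ _ _

theorem shiftLaurent_q8 (γ : Matrix.SpecialLinearGroup (Fin 2) ℤ) :
    shiftLaurent γ q8 = q8 := by
  simp only [q8, mono, map_sub, shiftLaurent_single, Prod.mk_zero_zero, map_zero]

/-- The unit `e₁`. -/
def e₁Unit : FunRingˣ :=
  pexpUnit (-q8 * mono 0 1 (-1) * (mono 0 0 2 + 2 * mono 0 1 1 + mono 0 1 0)) ![(0, 2), (2, -2)]

/-- The unit `e₂`. -/
def e₂Unit : FunRingˣ :=
  pexpUnit (-q8 * mono 0 1 (-1) * (mono 0 0 1 + 2 * mono 0 1 1 + mono 0 1 0)) ![(0, 2), (2, -2)]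

/-- The unit `e₃`. -/
def e₃Unit : FunRingˣ :=
  pexpUnit (-q8 * mono 0 1 0 * (mono 0 0 1 + 2 * mono 0 1 0 + 1)) ![(0, 2), (2, -2)]

/-- The unit `λ` in the matrix `O_B^{(1)}`. -/
def lamUnit : FunRingˣ := pexpUnit (q8 * mono 0 1 1 * (1 - mono 0 1 0)) ![(0, 2), (2, 0)]

theorem two_mem_noQ : (2 : Laurent) ∈ noQ := ofNat_mem noQ 2

theorem e₁_eq : e₁ = e₁Unit :=
  pexp_eq_of_eq_q8_mul (ν := -(mono 0 1 (-1) * (mono 0 0 2 + 2 * mono 0 1 1 + mono 0 1 0))) (by ring)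
    (neg_mem (mul_mem (mono_mem_noQ _ _) (add_mem (add_mem (mono_mem_noQ _ _)
      (mul_mem two_mem_noQ (mono_mem_noQ _ _))) (mono_mem_noQ _ _)))) (by decide)

theorem e₂_eq : e₂ = e₂Unit :=
  pexp_eq_of_eq_q8_mul (ν := -(mono 0 1 (-1) * (mono 0 0 1 + 2 * mono 0 1 1 + mono 0 1 0))) (by ring)
    (neg_mem (mul_mem (mono_mem_noQ _ _) (add_mem (add_mem (mono_mem_noQ _ _)
      (mul_mem two_mem_noQ (mono_mem_noQ _ _))) (mono_mem_noQ _ _)))) (by decide)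

theorem e₃_eq : e₃ = e₃Unit :=
  pexp_eq_of_eq_q8_mul (ν := -(mono 0 1 0 * (mono 0 0 1 + 2 * mono 0 1 0 + 1))) (by ring)
    (neg_mem (mul_mem (mono_mem_noQ _ _) (add_mem (add_mem (mono_mem_noQ _ _)
      (mul_mem two_mem_noQ (mono_mem_noQ _ _))) (one_mem _)))) (by decide)

theorem ePlus_eq : ePlus = lamUnit :=
  pexp_eq_of_eq_q8_mul (ν := mono 0 1 1 * (1 - mono 0 1 0)) (by ring)
    (mul_mem (mono_mem_noQ _ _) (sub_mem (one_mem _) (mono_mem_noQ _ _))) (by decide)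

theorem eMinus_eq : eMinus = ↑lamUnit⁻¹ := by
  rw [lamUnit, ← pexpUnit_neg, show -(q8 * mono 0 1 1 * (1 - mono 0 1 0)) =
    -q8 * mono 0 1 1 * (1 - mono 0 1 0) by ring]
  exact pexp_eq_of_eq_q8_mul (ν := -(mono 0 1 1 * (1 - mono 0 1 0))) (by ring)
    (neg_mem (mul_mem (mono_mem_noQ _ _) (sub_mem (one_mem _) (mono_mem_noQ _ _)))) (by decide)

/-- The plethystic exponential `pexpPlus` as a unit. -/
def plusUnit (c : ℤ) (v : Fin 3 → ℤ × ℤ) : FunRingˣ :=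
  pexpUnit (c • q8 * ∏ j, den (v j)) fun j => 2 • v j

theorem two_nsmul_ne_zero {v : ℤ × ℤ} (hv : v ≠ 0) : 2 • v ≠ 0 := by
  intro h
  simp only [Prod.ext_iff, Prod.smul_fst, Prod.smul_snd, Prod.fst_zero, Prod.snd_zero] at h
  exact hv (Prod.ext (by simpa using h.1) (by simpa using h.2))

theorem pexpPlus_eq (c : ℤ) {v : Fin 3 → ℤ × ℤ} (hv : ∀ j, v j ≠ 0) :
    pexpPlus c v = plusUnit c v :=
  pexp_eq_of_eq_q8_mul (ν := c • ∏ j, den (v j)) (by rw [mul_smul_comm, smul_mul_assoc]; rfl)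
    (zsmul_mem (prod_mem fun j _ => sub_mem (one_mem _) (mono_mem_noQ _ _)) c)
    fun j => two_nsmul_ne_zero (hv j)

theorem plusUnit_neg_one (v : Fin 3 → ℤ × ℤ) : plusUnit (-1) v = (plusUnit 1 v)⁻¹ := by
  rw [plusUnit, plusUnit, ← pexpUnit_neg, neg_one_smul, one_smul, neg_mul]

theorem shiftLaurent_den (γ : Matrix.SpecialLinearGroup (Fin 2) ℤ) (v : ℤ × ℤ) :
    shiftLaurent γ (den v) = den (shiftExp γ v) := by
  rw [den, map_sub, map_one, shiftLaurent_mono]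
  rfl

theorem deltaUnit_plusUnit (γ : Matrix.SpecialLinearGroup (Fin 2) ℤ) (c : ℤ)
    {v : Fin 3 → ℤ × ℤ} (hv : ∀ j, v j ≠ 0) :
    deltaUnit γ (plusUnit c v) = plusUnit c fun j => shiftExp γ (v j) := by
  rw [plusUnit, deltaUnit_pexpUnit γ _ fun j => two_nsmul_ne_zero (hv j), plusUnit, map_mul,
    map_zsmul, shiftLaurent_q8, map_prod]
  simp only [shiftLaurent_den, map_nsmul]

/-- The basic cocycle value `c_+^{(b,1)}`. -/
def cbUnit : FunRingˣ := plusUnit 1 ![(0, -1), (1, 0), (-1, 1)]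

/-! ### Identities of plethystic exponentials as identities of rational functions. -/

theorem p_mul_inv : mono 0 1 0 * mono 0 (-1) 0 = 1 := mono_mul_mono ..
theorem s_mul_inv : mono 0 0 1 * mono 0 0 (-1) = 1 := mono_mul_mono ..

theorem den_two_nsmul (v : ℤ × ℤ) : den (2 • v) = 1 - mono 0 v.1 v.2 ^ 2 := by
  rw [den, mono, mono, AddMonoidAlgebra.single_pow, one_pow, Prod.smul_fst, Prod.smul_snd]
  rfl

/-- Expresses the monomials that occur through p, p⁻¹, s, s⁻¹, after which each identity below is a
polynomial identity in four variables modulo p p⁻¹ = 1 and s s⁻¹ = 1. -/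
theorem mono_reduce :
    mono 0 1 (-1) = mono 0 1 0 * mono 0 0 (-1) ∧ mono 0 (-1) 1 = mono 0 (-1) 0 * mono 0 0 1 ∧
    mono 0 1 1 = mono 0 1 0 * mono 0 0 1 ∧
    mono 0 2 (-2) = mono 0 1 0 ^ 2 * mono 0 0 (-1) ^ 2 ∧
    mono 0 2 2 = mono 0 1 0 ^ 2 * mono 0 0 1 ^ 2 ∧
    mono 0 2 0 = mono 0 1 0 ^ 2 ∧ mono 0 (-2) 0 = mono 0 (-1) 0 ^ 2 ∧
    mono 0 0 2 = mono 0 0 1 ^ 2 ∧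
    mono 0 1 2 = mono 0 1 0 * mono 0 0 1 ^ 2 := by
  simp [mono, AddMonoidAlgebra.single_pow, AddMonoidAlgebra.single_mul_single]

/-- The three monomials x, y, z in the denominator (1 + x)(1 + y)(1 + z) of `cbUnit` have product 1.
Since 1/(1 + x⁻¹) = x/(1 + x), the fraction is unchanged when all three are inverted, and clearly
when they are permuted. This lemma and the next two are instances. -/
theorem plusUnit_neg_rot : plusUnit 1 ![(1, -1), (0, 1), (-1, 0)] = cbUnit := by
  refine pexpUnit_eq_of_mul_eq (by decide) (by decide) ?_
  have hp := p_mul_inv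
  have hs := s_mul_inv
  obtain ⟨h1, h2, h3, h4, h5, h6, h7, h8, h9⟩ := mono_reduce
  simp only [Fin.prod_univ_three, den_two_nsmul]
  simp only [den, Matrix.cons_val, h1, h2]
  generalize mono 0 1 0 = p at *
  generalize mono 0 (-1) 0 = p' at *
  generalize mono 0 0 1 = s at *
  generalize mono 0 0 (-1) = s' at *
  clear h1 h2 h3 h4 h5 h6 h7 h8 h9
  grind

theorem plusUnit_neg : plusUnit 1 ![(0, 1), (-1, 0), (1, -1)] = cbUnit := by
  refine pexpUnit_eq_of_mul_eq (by decide) (by decide) ?_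
  have hp := p_mul_inv
  have hs := s_mul_inv
  obtain ⟨h1, h2, h3, h4, h5, h6, h7, h8, h9⟩ := mono_reduce
  simp only [Fin.prod_univ_three, den_two_nsmul]
  simp only [den, Matrix.cons_val, h1, h2]
  generalize mono 0 1 0 = p at *
  generalize mono 0 (-1) 0 = p' at *
  generalize mono 0 0 1 = s at *
  generalize mono 0 0 (-1) = s' at *
  clear h1 h2 h3 h4 h5 h6 h7 h8 h9
  grind

theorem plusUnit_neg_swap : plusUnit 1 ![(1, -1), (-1, 0), (0, 1)] = cbUnit := by
  refine pexpUnit_eq_of_mul_eq (by decide) (by decide) ?_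
  have hp := p_mul_inv
  have hs := s_mul_inv
  obtain ⟨h1, h2, h3, h4, h5, h6, h7, h8, h9⟩ := mono_reduce
  simp only [Fin.prod_univ_three, den_two_nsmul]
  simp only [den, Matrix.cons_val, h1, h2]
  generalize mono 0 1 0 = p at *
  generalize mono 0 (-1) 0 = p' at *
  generalize mono 0 0 1 = s at *
  generalize mono 0 0 (-1) = s' at *
  clear h1 h2 h3 h4 h5 h6 h7 h8 h9
  grind

/-- Both exponents equal (Q⁸ - Q⁻⁸) p s / ((1 - s²)(p + s)). The right side is the shift of λ by
a⁻¹, so `cbUnit` is the ratio of that shift to λ. -/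
theorem lamUnit_mul_cbUnit :
    lamUnit * cbUnit = pexpUnit (q8 * mono 0 1 0 * (1 - mono 0 1 (-1))) ![(0, 2), (2, -2)] := by
  refine pexpUnit_mul_eq (by decide) (by decide) (by decide) ?_
  have hp := p_mul_inv
  have hs := s_mul_inv
  obtain ⟨h1, h2, h3, h4, h5, h6, h7, h8, h9⟩ := mono_reduce
  simp only [Fin.prod_univ_three, Fin.prod_univ_two, den_two_nsmul]
  simp only [den, Matrix.cons_val, h1, h2, h3, h4, h5, h6, h7, h8, h9, one_smul]
  generalize mono 0 1 0 = p at *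
  generalize mono 0 (-1) 0 = p' at *
  generalize mono 0 0 1 = s at *
  generalize mono 0 0 (-1) = s' at *
  clear h1 h2 h3 h4 h5 h6 h7 h8 h9
  grind

/-- The factors are the shift of λ by aba and the shift of e₁ by a; the result is the shift of e₂ by
a. Together with the next lemma this fixes the ratios of e₁, e₂, e₃, which is what conjugation by Ŝ
requires. -/
theorem shift_lamUnit_mul_shift_e₁Unit :
    pexpUnit (q8 * mono 0 (-1) 1 * (1 - mono 0 0 1)) ![(-2, 0), (0, 2)] *
      pexpUnit (-q8 * mono 0 1 0 * (mono 0 0 2 + 2 * mono 0 1 2 + mono 0 1 1)) ![(0, 2), (2, 0)] =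
    pexpUnit (-q8 * mono 0 1 0 * (mono 0 0 1 + 2 * mono 0 1 2 + mono 0 1 1)) ![(0, 2), (2, 0)] := by
  refine pexpUnit_mul_eq (by decide) (by decide) (by decide) ?_
  have hp := p_mul_inv
  have hs := s_mul_inv
  obtain ⟨h1, h2, h3, h4, h5, h6, h7, h8, h9⟩ := mono_reduce
  simp only [Fin.prod_univ_three, Fin.prod_univ_two, den_two_nsmul]
  simp only [den, Matrix.cons_val, h1, h2, h3, h4, h5, h6, h7, h8, h9, one_smul]
  generalize mono 0 1 0 = p at *
  generalize mono 0 (-1) 0 = p' at *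
  generalize mono 0 0 1 = s at *
  generalize mono 0 0 (-1) = s' at *
  clear h1 h2 h3 h4 h5 h6 h7 h8 h9
  grind

theorem lamUnit_mul_shift_e₃Unit :
    lamUnit *
      pexpUnit (-q8 * mono 0 1 1 * (mono 0 0 1 + 2 * mono 0 1 1 + 1)) ![(0, 2), (2, 0)] =
    pexpUnit (-q8 * mono 0 1 0 * (mono 0 0 2 + 2 * mono 0 1 2 + mono 0 1 1)) ![(0, 2), (2, 0)] := by
  refine pexpUnit_mul_eq (by decide) (by decide) (by decide) ?_
  have hp := p_mul_inv
  have hs := s_mul_inv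
  obtain ⟨h1, h2, h3, h4, h5, h6, h7, h8, h9⟩ := mono_reduce
  simp only [Fin.prod_univ_three, Fin.prod_univ_two, den_two_nsmul]
  simp only [den, Matrix.cons_val, h1, h2, h3, h4, h5, h6, h7, h8, h9, one_smul]
  generalize mono 0 1 0 = p at *
  generalize mono 0 (-1) 0 = p' at *
  generalize mono 0 0 1 = s at *
  generalize mono 0 0 (-1) = s' at *
  clear h1 h2 h3 h4 h5 h6 h7 h8 h9
  grind

/-! ### The action on the free group -/

/-- The matrix `(x, y; z, t)` of determinant one. -/
def slMk (x y z t : ℤ) (h : x * t - y * z = 1) : Matrix.SpecialLinearGroup (Fin 2) ℤ :=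
  ⟨!![x, y; z, t], by rw [Matrix.det_fin_two_of, h]⟩

section slMk

variable {x y z t : ℤ} (h : x * t - y * z = 1)

theorem slMk_00 : slMk x y z t h 0 0 = x := rfl
theorem slMk_01 : slMk x y z t h 0 1 = y := rfl
theorem slMk_10 : slMk x y z t h 1 0 = z := rfl
theorem slMk_11 : slMk x y z t h 1 1 = t := rfl

end slMk

theorem sl_mul_apply (γ γ' : Matrix.SpecialLinearGroup (Fin 2) ℤ) (i j : Fin 2) :
    (γ * γ') i j = γ i 0 * γ' 0 j + γ i 1 * γ' 1 j := by
  rw [Matrix.SpecialLinearGroup.coe_mul, Matrix.mul_apply, Fin.sum_univ_two]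

theorem sl_ext {γ γ' : Matrix.SpecialLinearGroup (Fin 2) ℤ} (h00 : γ 0 0 = γ' 0 0)
    (h01 : γ 0 1 = γ' 0 1) (h10 : γ 1 0 = γ' 1 0) (h11 : γ 1 1 = γ' 1 1) : γ = γ' := by
  ext i j
  fin_cases i <;> fin_cases j
  exacts [h00, h01, h10, h11]

theorem slMk_mul {x y z t x' y' z' t' : ℤ} (h : x * t - y * z = 1) (h' : x' * t' - y' * z' = 1) :
    slMk x y z t h * slMk x' y' z' t' h' =
      slMk (x * x' + y * z') (x * y' + y * t') (z * x' + t * z') (z * y' + t * t')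
        (by linear_combination (x' * t' - y' * z') * h + h') :=
  sl_ext (sl_mul_apply _ _ _ _) (sl_mul_apply _ _ _ _) (sl_mul_apply _ _ _ _)
    (sl_mul_apply _ _ _ _)

/-- Conjugation by `diag(1, -1)`. -/
def flipHom : Matrix.SpecialLinearGroup (Fin 2) ℤ →* Matrix.SpecialLinearGroup (Fin 2) ℤ where
  toFun γ := slMk (γ 0 0) (-γ 0 1) (-γ 1 0) (γ 1 1) (by
    have := γ.det_coe
    rw [Matrix.det_fin_two] at this
    linear_combination this)
  map_one' := sl_ext rfl rfl rfl rfl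
  map_mul' γ γ' := by
    rw [slMk_mul]
    refine sl_ext ?_ ?_ ?_ ?_
    · rw [slMk_00, slMk_00, sl_mul_apply]; ring
    · rw [slMk_01, slMk_01, sl_mul_apply]; ring
    · rw [slMk_10, slMk_10, sl_mul_apply]; ring
    · rw [slMk_11, slMk_11, sl_mul_apply]; ring

/-- The homomorphism `F → SL(2, ℤ)` that gives the shifts. -/
def ψ : Free₂ →* Matrix.SpecialLinearGroup (Fin 2) ℤ := flipHom.comp φ

theorem φ_a : φ a = slMk 1 (-1) 0 1 (by norm_num) := FreeGroup.lift_apply_of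

theorem φ_b : φ b = slMk 1 0 1 1 (by norm_num) := FreeGroup.lift_apply_of

theorem ψ_a : ψ a = slMk 1 1 0 1 (by norm_num) := by
  rw [ψ, MonoidHom.comp_apply, φ_a]
  exact sl_ext rfl rfl rfl rfl

theorem ψ_b : ψ b = slMk 1 0 (-1) 1 (by norm_num) := by
  rw [ψ, MonoidHom.comp_apply, φ_b]
  exact sl_ext rfl rfl rfl rfl

theorem ψ_a_inv : ψ a⁻¹ = slMk 1 (-1) 0 1 (by norm_num) := by
  rw [map_inv, inv_eq_iff_mul_eq_one, ψ_a, slMk_mul]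
  exact sl_ext rfl rfl rfl rfl

theorem ψ_ab : ψ (a * b) = slMk 0 1 (-1) 1 (by norm_num) := by
  rw [map_mul, ψ_a, ψ_b, slMk_mul]
  exact sl_ext rfl rfl rfl rfl

theorem ψ_aba : ψ (a * b * a) = slMk 0 1 (-1) 0 (by norm_num) := by
  rw [map_mul, ψ_ab, ψ_a, slMk_mul]
  exact sl_ext rfl rfl rfl rfl

theorem ψ_aba_sq : ψ (a * b * a) * ψ (a * b * a) = -1 := by
  rw [ψ_aba, slMk_mul]
  exact sl_ext rfl rfl rfl rfl

theorem ψ_bab : ψ (b * a * b) = ψ (a * b * a) := by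
  rw [ψ_aba, mul_assoc, map_mul, ψ_ab, ψ_b, slMk_mul]
  exact sl_ext rfl rfl rfl rfl

theorem cb_ne_zero : ∀ j : Fin 3, (![(0, -1), (1, 0), (-1, 1)] : Fin 3 → ℤ × ℤ) j ≠ 0 := by decide

theorem fin2_ext {α : Type} {v w : Fin 2 → α} (h0 : v 0 = w 0) (h1 : v 1 = w 1) : v = w := by
  funext j
  fin_cases j
  exacts [h0, h1]

theorem fin3_ext {α : Type} {v w : Fin 3 → α} (h0 : v 0 = w 0) (h1 : v 1 = w 1) (h2 : v 2 = w 2) :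
    v = w := by
  funext j
  fin_cases j
  exacts [h0, h1, h2]

/-- The matrix ψ(ab) permutes the three exponent vectors of `cbUnit` up to a common sign, and the
fraction is invariant under both. The degree-three relations depend on this symmetry. -/
theorem deltaUnit_ab_cbUnit : deltaUnit (ψ (a * b)) cbUnit = cbUnit := by
  nth_rw 2 [← plusUnit_neg_rot]
  rw [cbUnit, deltaUnit_plusUnit _ _ cb_ne_zero, ψ_ab]
  congr 1
  refine fin3_ext ?_ ?_ ?_ <;> simp [shiftExp_apply, slMk_00, slMk_01, slMk_10, slMk_11]

theorem deltaUnit_neg_one_cbUnit : deltaUnit (-1) cbUnit = cbUnit := by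
  nth_rw 2 [← plusUnit_neg]
  rw [cbUnit, deltaUnit_plusUnit _ _ cb_ne_zero]
  congr 1
  refine fin3_ext ?_ ?_ ?_ <;> simp [shiftExp_apply]

theorem deltaUnit_a_inv_lamUnit : deltaUnit (ψ a⁻¹) lamUnit = lamUnit * cbUnit := by
  rw [lamUnit_mul_cbUnit, lamUnit, deltaUnit_pexpUnit _ _ (by decide), ψ_a_inv]
  simp only [map_mul, map_sub, map_one, shiftLaurent_q8, shiftLaurent_mono,
    slMk_00, slMk_01, slMk_10, slMk_11]
  refine congrArg₂ _ ?_ (fin2_ext rfl rfl)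
  norm_num

theorem deltaUnit_a_e₁Unit : deltaUnit (ψ a) e₁Unit =
    pexpUnit (-q8 * mono 0 1 0 * (mono 0 0 2 + 2 * mono 0 1 2 + mono 0 1 1)) ![(0, 2), (2, 0)] := by
  rw [e₁Unit, deltaUnit_pexpUnit _ _ (by decide), ψ_a]
  simp only [map_mul, map_neg, map_add, map_ofNat, shiftLaurent_q8, shiftLaurent_mono,
    slMk_00, slMk_01, slMk_10, slMk_11]
  refine congrArg₂ _ ?_ (fin2_ext rfl rfl)
  norm_num

theorem deltaUnit_a_e₂Unit : deltaUnit (ψ a) e₂Unit =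
    pexpUnit (-q8 * mono 0 1 0 * (mono 0 0 1 + 2 * mono 0 1 2 + mono 0 1 1)) ![(0, 2), (2, 0)] := by
  rw [e₂Unit, deltaUnit_pexpUnit _ _ (by decide), ψ_a]
  simp only [map_mul, map_neg, map_add, map_ofNat, shiftLaurent_q8, shiftLaurent_mono,
    slMk_00, slMk_01, slMk_10, slMk_11]
  refine congrArg₂ _ ?_ (fin2_ext rfl rfl)
  norm_num

theorem deltaUnit_a_e₃Unit : deltaUnit (ψ a) e₃Unit =
    pexpUnit (-q8 * mono 0 1 1 * (mono 0 0 1 + 2 * mono 0 1 1 + 1)) ![(0, 2), (2, 0)] := by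
  rw [e₃Unit, deltaUnit_pexpUnit _ _ (by decide), ψ_a]
  simp only [map_mul, map_neg, map_add, map_one, map_ofNat, shiftLaurent_q8, shiftLaurent_mono,
    slMk_00, slMk_01, slMk_10, slMk_11]
  refine congrArg₂ _ ?_ (fin2_ext rfl rfl)
  norm_num

theorem deltaUnit_aba_lamUnit : deltaUnit (ψ (a * b * a)) lamUnit =
    pexpUnit (q8 * mono 0 (-1) 1 * (1 - mono 0 0 1)) ![(-2, 0), (0, 2)] := by
  rw [lamUnit, deltaUnit_pexpUnit _ _ (by decide), ψ_aba]
  simp only [map_mul, map_sub, map_one, shiftLaurent_q8, shiftLaurent_mono,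
    slMk_00, slMk_01, slMk_10, slMk_11]
  refine congrArg₂ _ ?_ (fin2_ext rfl rfl)
  norm_num

theorem deltaUnit_lamUnit_mul_e₁Unit :
    deltaUnit (ψ (a * b * a)) lamUnit * deltaUnit (ψ a) e₁Unit = deltaUnit (ψ a) e₂Unit := by
  rw [deltaUnit_aba_lamUnit, deltaUnit_a_e₁Unit, deltaUnit_a_e₂Unit]
  exact shift_lamUnit_mul_shift_e₁Unit

theorem lamUnit_mul_deltaUnit_e₃Unit :
    lamUnit * deltaUnit (ψ a) e₃Unit = deltaUnit (ψ a) e₁Unit := by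
  rw [deltaUnit_a_e₁Unit, deltaUnit_a_e₃Unit]
  exact lamUnit_mul_shift_e₃Unit

theorem ψ_apply (g : Free₂) : ψ g = slMk (φ g 0 0) (-φ g 0 1) (-φ g 1 0) (φ g 1 1) (by
    have := (φ g).det_coe
    rw [Matrix.det_fin_two] at this
    linear_combination this) := rfl

theorem φ_b_mul (g : Free₂) (j : Fin 2) :
    φ (b * g) 0 j = φ g 0 j ∧ φ (b * g) 1 j = φ g 0 j + φ g 1 j := by
  rw [map_mul, sl_mul_apply, sl_mul_apply, φ_b, slMk_00, slMk_01, slMk_10, slMk_11]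
  constructor <;> ring

/-- The first denominator of c_± involves only the bottom row of φ(g), which may therefore be taken
from φ(aᵏ g); all three denominators then come from one matrix. -/
theorem φ_a_zpow_mul (k : ℤ) (g : Free₂) (j : Fin 2) : φ (a ^ k * g) 1 j = φ g 1 j := by
  have h1 : ∀ g, φ (a * g) 1 j = φ g 1 j := fun g => by
    rw [map_mul, sl_mul_apply, φ_a, slMk_10, slMk_11]
    ring
  induction k with
  | zero => rw [zpow_zero, one_mul]
  | succ k ih => rw [add_comm, zpow_add, zpow_one, mul_assoc, h1, ih]
  | pred k ih =>
    have h2 : a * a ^ (-(k : ℤ) - 1) = a ^ (-(k : ℤ)) := by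
      rw [← zpow_one_add]
      congr 1
      ring
    rw [← h1, ← mul_assoc, h2, ih]

theorem shiftExp_cb_ne_zero (γ : Matrix.SpecialLinearGroup (Fin 2) ℤ) {v : Fin 3 → ℤ × ℤ}
    (hv : ∀ j, v j ≠ 0) (j : Fin 3) : shiftExp γ (v j) ≠ 0 := shiftExp_ne_zero γ (hv j)

/-- `c_+^{(b aᵏ, g)}` is a shift of `c_+^{(b, 1)}`. -/
theorem cPlus_eq (k : ℤ) (g : Free₂) :
    cPlus (b * a ^ k) g = deltaUnit (ψ (a ^ k * g)) cbUnit := by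
  rw [cbUnit, deltaUnit_plusUnit _ _ cb_ne_zero, cPlus,
    ← pexpPlus_eq _ (shiftExp_cb_ne_zero _ cb_ne_zero)]
  congr 1
  rw [mul_assoc, (φ_b_mul _ 0).1, (φ_b_mul _ 0).2, (φ_b_mul _ 1).1, (φ_b_mul _ 1).2,
    ← φ_a_zpow_mul k g 0, ← φ_a_zpow_mul k g 1, ψ_apply]
  refine fin3_ext ?_ ?_ ?_ <;>
    simp [shiftExp_apply, slMk_00, slMk_01, slMk_10, slMk_11] <;> ring

/-- A step by b⁻¹ undoes a step by b that starts at the new element b⁻¹ aᵏ g; hence the inverse, and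
the shift by the new element. -/
theorem cMinus_eq (k : ℤ) (g : Free₂) :
    cMinus (b⁻¹ * a ^ k) g = ↑(deltaUnit (ψ (b⁻¹ * a ^ k * g)) cbUnit)⁻¹ := by
  have hv : ∀ j : Fin 3, (![(1, -1), (-1, 0), (0, 1)] : Fin 3 → ℤ × ℤ) j ≠ 0 := by decide
  rw [← plusUnit_neg_swap, ← map_inv, ← plusUnit_neg_one, deltaUnit_plusUnit _ _ hv, cMinus,
    ← pexpPlus_eq _ (shiftExp_cb_ne_zero _ hv)]
  congr 1
  have h := φ_b_mul (b⁻¹ * a ^ k * g)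
  rw [mul_assoc, mul_inv_cancel_left] at h
  rw [← φ_a_zpow_mul k g 0, ← φ_a_zpow_mul k g 1, (h 0).2, (h 1).2, mul_assoc, ψ_apply]
  refine fin3_ext ?_ ?_ ?_ <;>
    simp [shiftExp_apply, slMk_00, slMk_01, slMk_10, slMk_11] <;> ring

/-! ## The cocycle -/

theorem deltaHom_deltaHom (γ γ' : Matrix.SpecialLinearGroup (Fin 2) ℤ) (r : FunRing) :
    deltaHom γ (deltaHom γ' r) = deltaHom (γ' * γ) r := by
  obtain ⟨_, f, hf, rfl⟩ := r
  refine Subtype.ext (Germ.coe_eq.2 ?_)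
  filter_upwards [torus_mem_openDense] with x hx
  exact congrArg f (deltaPt_mul γ' γ hx)

theorem deltaHom_one (r : FunRing) : deltaHom 1 r = r := by
  obtain ⟨_, f, hf, rfl⟩ := r
  exact Subtype.ext (Germ.coe_eq.2 (Eventually.of_forall fun x => congrArg f (deltaPt_one x)))

theorem deltaUnit_deltaUnit (γ γ' : Matrix.SpecialLinearGroup (Fin 2) ℤ) (u : FunRingˣ) :
    deltaUnit γ (deltaUnit γ' u) = deltaUnit (γ' * γ) u :=
  Units.ext (deltaHom_deltaHom γ γ' u)

theorem deltaUnit_one (u : FunRingˣ) : deltaUnit 1 u = u := Units.ext (deltaHom_one u)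

/-- The left action of `SL(2, ℤ)` on units by inverse shifts. -/
def shiftAut : Matrix.SpecialLinearGroup (Fin 2) ℤ →* MulAut FunRingˣ where
  toFun γ :=
    { toFun := deltaUnit γ⁻¹
      invFun := deltaUnit γ
      left_inv u := by rw [deltaUnit_deltaUnit, inv_mul_cancel, deltaUnit_one]
      right_inv u := by rw [deltaUnit_deltaUnit, mul_inv_cancel, deltaUnit_one]
      map_mul' := map_mul _ }
  map_one' := by
    ext u : 1
    exact (congrArg (deltaUnit · u) inv_one).trans (deltaUnit_one u)
  map_mul' γ γ' := by
    ext u : 1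
    refine Eq.trans ?_ (deltaUnit_deltaUnit γ⁻¹ γ'⁻¹ u).symm
    exact congrArg (deltaUnit · u) (mul_inv_rev γ γ')

theorem shiftAut_apply (γ : Matrix.SpecialLinearGroup (Fin 2) ℤ) (u : FunRingˣ) :
    shiftAut γ u = deltaUnit γ⁻¹ u := rfl

/-- The homomorphism from the free group to the semidirect product that encodes the cocycle. -/
def cocycleHom : Free₂ →* FunRingˣ ⋊[shiftAut] Matrix.SpecialLinearGroup (Fin 2) ℤ :=
  FreeGroup.lift fun
    | .A => ⟨1, ψ a⟩
    -- Chosen so that b⁻¹ has left component `cbUnit`: the cocycle is read off at inverses.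
    | .B => ⟨deltaUnit (ψ b)⁻¹ cbUnit⁻¹, ψ b⟩

theorem cocycleHom_a : cocycleHom a = ⟨1, ψ a⟩ := FreeGroup.lift_apply_of

theorem cocycleHom_b : cocycleHom b = ⟨deltaUnit (ψ b)⁻¹ cbUnit⁻¹, ψ b⟩ := FreeGroup.lift_apply_of

theorem cocycleHom_right (g : Free₂) : (cocycleHom g).right = ψ g := by
  have : SemidirectProduct.rightHom.comp cocycleHom = ψ := by
    refine FreeGroup.ext_hom _ _ fun l => ?_
    cases l
    · exact congrArg SemidirectProduct.right cocycleHom_a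
    · exact congrArg SemidirectProduct.right cocycleHom_b
  exact DFunLike.congr_fun this g

/-- The unit `c` for which `O_A^{(g)} = c (1 - P) O_A^{(1)} + c⁻¹ P O_A^{(1)}`. -/
def cocA (g : Free₂) : FunRingˣ := (cocycleHom g⁻¹).left

/-- Shifts compose contravariantly, so the cocycle law is a right-handed one; evaluating the
homomorphism at g⁻¹ converts the multiplication law of the semidirect product into it. -/
theorem cocA_mul (h g : Free₂) : cocA (h * g) = deltaUnit (ψ g) (cocA h) * cocA g := by
  rw [cocA, mul_inv_rev, map_mul, SemidirectProduct.mul_left, cocycleHom_right, shiftAut_apply,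
    map_inv ψ, inv_inv, mul_comm]
  rfl

theorem cocA_one : cocA 1 = 1 := by
  rw [cocA, inv_one, map_one]
  rfl

theorem cocA_inv (g : Free₂) : cocA g⁻¹ = (deltaUnit (ψ g⁻¹) (cocA g))⁻¹ := by
  rw [eq_inv_iff_mul_eq_one, mul_comm, ← cocA_mul, mul_inv_cancel, cocA_one]

theorem cocA_a : cocA a = 1 := by
  rw [cocA, map_inv, cocycleHom_a, SemidirectProduct.inv_left, inv_one, map_one]

theorem cocA_b : cocA b = cbUnit := by
  rw [cocA, map_inv, cocycleHom_b, SemidirectProduct.inv_left, map_inv (shiftAut _)]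
  change (deltaUnit (ψ b)⁻¹⁻¹ (deltaUnit (ψ b)⁻¹ cbUnit⁻¹))⁻¹ = cbUnit
  rw [inv_inv, deltaUnit_deltaUnit, inv_mul_cancel, deltaUnit_one, inv_inv]

theorem cocA_a_mul (g : Free₂) : cocA (a * g) = cocA g := by
  rw [cocA_mul, cocA_a, map_one, one_mul]

theorem cocA_a_zpow_mul (k : ℤ) (g : Free₂) : cocA (a ^ k * g) = cocA g := by
  induction k with
  | zero => rw [zpow_zero, one_mul]
  | succ k ih => rw [add_comm, zpow_add, zpow_one, mul_assoc, cocA_a_mul, ih]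
  | pred k ih =>
    have h2 : a * a ^ (-(k : ℤ) - 1) = a ^ (-(k : ℤ)) := by
      rw [← zpow_one_add]
      congr 1
      ring
    rw [← cocA_a_mul, ← mul_assoc, h2, ih]

theorem cocA_rec (k : ℤ) (g : Free₂) :
    cocA (b * a ^ k * g) = deltaUnit (ψ (a ^ k * g)) cbUnit * cocA g := by
  rw [mul_assoc, cocA_mul, cocA_b, cocA_a_zpow_mul]

theorem cocA_rec_inv (k : ℤ) (g : Free₂) :
    cocA (b⁻¹ * a ^ k * g) = (deltaUnit (ψ (b⁻¹ * a ^ k * g)) cbUnit)⁻¹ * cocA g := by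
  rw [eq_inv_mul_iff_mul_eq, ← cocA_b, ← cocA_mul, mul_assoc, mul_inv_cancel_left,
    cocA_a_zpow_mul]

/-- The matrix -1 is central and fixes the values at the generators, so by the cocycle law it fixes
all values. -/
theorem deltaUnit_neg_one_cocA (g : Free₂) : deltaUnit (-1) (cocA g) = cocA g := by
  have hc : ∀ γ : Matrix.SpecialLinearGroup (Fin 2) ℤ, ∀ u : FunRingˣ,
      deltaUnit (-1) (deltaUnit γ u) = deltaUnit γ (deltaUnit (-1) u) := fun γ u => by
    rw [deltaUnit_deltaUnit, deltaUnit_deltaUnit, mul_neg, neg_mul, mul_one, one_mul]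
  have hinv : ∀ g, deltaUnit (-1) (cocA g) = cocA g → deltaUnit (-1) (cocA g⁻¹) = cocA g⁻¹ :=
    fun g h => by rw [cocA_inv, map_inv, hc, h]
  have hof : ∀ l : Letter, deltaUnit (-1) (cocA (FreeGroup.of l)) = cocA (FreeGroup.of l) := by
    intro l
    cases l
    · exact (congrArg _ cocA_a).trans ((map_one _).trans cocA_a.symm)
    · exact (congrArg _ cocA_b).trans (deltaUnit_neg_one_cbUnit.trans cocA_b.symm)
  induction g using FreeGroup.induction_on with
  | C1 => rw [cocA_one, map_one]
  | of l => exact hof l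
  | inv_of l _ => exact hinv _ (hof l)
  | mul x y hx hy => rw [cocA_mul, map_mul, hc, hx, hy]

/-! ### The second cocycle -/

/-- The image of `aba` in `SL(2, ℤ)`. -/
def wSL : Matrix.SpecialLinearGroup (Fin 2) ℤ := ψ (a * b * a)

theorem wSL_inv : wSL⁻¹ = -wSL := by
  have : wSL * -wSL = 1 := by rw [mul_neg, wSL, ψ_aba_sq, neg_neg]
  exact inv_eq_of_mul_eq_one_right this

theorem σ_a : σ a = b := FreeGroup.map.of
theorem σ_b : σ b = a := FreeGroup.map.of

theorem σ_σ (g : Free₂) : σ (σ g) = g := by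
  have : σ.comp σ = MonoidHom.id Free₂ := FreeGroup.ext_hom _ _ fun l => by
    cases l
    · exact (congrArg σ σ_a).trans σ_b
    · exact (congrArg σ σ_b).trans σ_a
  exact DFunLike.congr_fun this g

/-- From the braid relation ψ(aba) = ψ(bab) one gets w ψ(b) = ψ(a) w and w ψ(a) = ψ(b) w, so
conjugation by w exchanges the images of the generators. -/
theorem ψ_σ (g : Free₂) : ψ (σ g) = wSL⁻¹ * ψ g * wSL := by
  have : ψ.comp σ = (MulAut.conj wSL⁻¹).toMonoidHom.comp ψ := by
    refine FreeGroup.ext_hom _ _ fun l => ?_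
    cases l
    · change ψ (σ a) = wSL⁻¹ * ψ a * wSL⁻¹⁻¹
      rw [σ_a, inv_inv, eq_comm, mul_assoc, inv_mul_eq_iff_eq_mul, wSL, ← map_mul ψ _ b,
        show a * b * a * b = a * (b * a * b) by group, map_mul ψ a (b * a * b), ψ_bab]
    · change ψ (σ b) = wSL⁻¹ * ψ b * wSL⁻¹⁻¹
      rw [σ_b, inv_inv, eq_comm, mul_assoc, inv_mul_eq_iff_eq_mul, wSL, ← map_mul ψ b,
        show b * (a * b * a) = b * a * b * a by group, map_mul, ψ_bab]
  have := DFunLike.congr_fun this g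
  rwa [MonoidHom.comp_apply, MonoidHom.comp_apply, MulEquiv.coe_toMonoidHom, MulAut.conj_apply,
    inv_inv] at this

theorem ψ_σ_mul_wSL (g : Free₂) : ψ (σ g) * wSL = wSL * ψ g := by
  rw [ψ_σ, mul_assoc, show wSL * wSL = -1 from ψ_aba_sq, wSL_inv, mul_neg, neg_mul, neg_mul,
    neg_neg, mul_one]

/-- The shift of `cocA` by `aba`, with the roles of the generators exchanged. -/
def cocD (g : Free₂) : FunRingˣ := deltaUnit wSL (cocA (σ g))

/-- Because ψ(σ g) w = w ψ(g), the transform of `cocA` is a cocycle for the same action. It is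
trivial at b and equals the shift of `cbUnit` by w at a. -/
theorem cocD_mul (x g : Free₂) :
    cocD (x * g) = deltaUnit (ψ g) (deltaUnit wSL (cocA (σ x))) * cocD g := by
  rw [cocD, map_mul, cocA_mul, map_mul, deltaUnit_deltaUnit, ψ_σ_mul_wSL, deltaUnit_deltaUnit]
  rfl

/-- As w² = -1 acts trivially on `cocA`, the shift by w exchanges the two cocycles up to σ. -/
theorem deltaUnit_wSL_cocD (g : Free₂) : deltaUnit wSL (cocD g) = cocA (σ g) := by
  rw [cocD, deltaUnit_deltaUnit, show wSL * wSL = -1 from ψ_aba_sq, deltaUnit_neg_one_cocA]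

theorem cocD_b_mul (g : Free₂) : cocD (b * g) = cocD g := by
  rw [cocD, map_mul, σ_b, cocA_a_mul]
  rfl

theorem cocA_aba : cocA (a * b * a) = deltaUnit (ψ a) cbUnit := by
  rw [cocA_mul, cocA_a_mul, cocA_a, mul_one, cocA_b]

theorem deltaUnit_wSL_cbUnit : deltaUnit wSL cbUnit = deltaUnit (ψ a) cbUnit := by
  rw [wSL, map_mul, ← deltaUnit_deltaUnit, deltaUnit_ab_cbUnit]

theorem cocA_aba_inv : cocA (a⁻¹ * b⁻¹ * a⁻¹) = cbUnit⁻¹ := by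
  rw [show a⁻¹ * b⁻¹ * a⁻¹ = (a * b * a)⁻¹ by group, cocA_inv, cocA_aba, deltaUnit_deltaUnit,
    ← map_mul, show a * (a * b * a)⁻¹ = (a * b)⁻¹ by group]
  nth_rw 1 [← deltaUnit_ab_cbUnit]
  rw [deltaUnit_deltaUnit, ← map_mul, mul_inv_cancel, map_one, deltaUnit_one]

theorem deltaUnit_wSL_cocA_b_inv : deltaUnit wSL (cocA b⁻¹) = cbUnit⁻¹ := by
  rw [cocA_inv, cocA_b, map_inv, deltaUnit_deltaUnit, wSL, ← ψ_bab, ← map_mul,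
    show b⁻¹ * (b * a * b) = a * b by group, deltaUnit_ab_cbUnit]

/-- The identity behind the relations of degree three, for `ε = 1`. -/
theorem cocA_mul_cocD_sq (g₁ g : Free₂) :
    cocA (g₁ * (a * b * a) * g) * (cocD g * cocD g) = cocA g * cocD (a * g) * cocD (σ g₁ * g) := by
  -- Both sides expand into `cocA g`, the square of `cocD g`, and the shifts by g of the factor of
  -- g₁ and of the factor of aba; the latter agree because `cocA (a * b * a)` and `cocD a` are both
  -- the shift of `cbUnit` by a.
  rw [cocD_mul a g, cocD_mul (σ g₁) g, σ_σ, σ_a, cocA_b, deltaUnit_wSL_cbUnit, mul_assoc g₁,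
    cocA_mul g₁, cocA_mul (a * b * a), cocA_aba, map_mul, ← deltaUnit_deltaUnit]
  change deltaUnit (ψ g) (deltaUnit wSL (cocA g₁)) * _ * _ = _
  ac_rfl

/-- The identity behind the relations of degree three, for `ε = -1`. -/
theorem cocA_mul_cocD_sq_inv (g₁ g : Free₂) :
    cocA (g₁ * (a⁻¹ * b⁻¹ * a⁻¹) * g) * (cocD g * cocD g) =
      cocA g * cocD (a⁻¹ * g) * cocD (σ g₁ * g) := by
  have hw : ψ (a⁻¹ * b⁻¹ * a⁻¹) = -1 * wSL := by
    rw [show a⁻¹ * b⁻¹ * a⁻¹ = (a * b * a)⁻¹ by group, map_inv, neg_mul, one_mul]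
    exact wSL_inv
  rw [cocD_mul a⁻¹ g, cocD_mul (σ g₁) g, σ_σ, map_inv σ, σ_a, deltaUnit_wSL_cocA_b_inv,
    mul_assoc g₁, cocA_mul g₁, cocA_mul (a⁻¹ * b⁻¹ * a⁻¹), cocA_aba_inv, map_mul, hw,
    ← deltaUnit_deltaUnit, ← deltaUnit_deltaUnit, deltaUnit_neg_one_cocA]
  ac_rfl

/-- The unit `l` for which `O_B^{(g)}` arises from `O_B^{(1)}` on replacing `λ` by `l`. -/
def cocB (g : Free₂) : FunRingˣ := lamUnit * (cocD g)⁻¹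

theorem cocB_one : cocB 1 = lamUnit := by
  rw [cocB, cocD, map_one, cocA_one, map_one, inv_one, mul_one]

theorem cocB_b_mul (g : Free₂) : cocB (b * g) = cocB g := by rw [cocB, cocD_b_mul, cocB]

theorem cocA_mul_a_inv (g : Free₂) : cocA (g * a⁻¹) = deltaUnit (ψ a⁻¹) (cocA g) := by
  rw [cocA_mul, cocA_inv, cocA_a, map_one, inv_one, mul_one]

/-- The shift by a⁻¹ multiplies λ by `cbUnit`, which compensates the value `cbUnit⁻¹` of `cocD` at
a⁻¹. This is the property of λ that makes conjugation by D̂_A act correctly. -/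
theorem cocB_mul_a_inv (g : Free₂) : cocB (g * a⁻¹) = deltaUnit (ψ a⁻¹) (cocB g) := by
  rw [cocB, cocB, map_mul, deltaUnit_a_inv_lamUnit, cocD_mul, map_inv, ← cocD]
  have : cocD a⁻¹ = cbUnit⁻¹ := by rw [cocD, map_inv, σ_a, deltaUnit_wSL_cocA_b_inv]
  rw [this, map_inv (deltaUnit _), mul_inv, inv_inv]
  ac_rfl

theorem deltaUnit_wSL_cocB (g : Free₂) :
    deltaUnit wSL (cocB g) * cocA (σ g) * deltaUnit (ψ a) e₁Unit = deltaUnit (ψ a) e₂Unit := by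
  rw [cocB, map_mul, map_inv, deltaUnit_wSL_cocD, inv_mul_cancel_right]
  exact deltaUnit_lamUnit_mul_e₁Unit

theorem cocB_mul_e₃Unit (g : Free₂) :
    cocB g * cocD g * deltaUnit (ψ a) e₃Unit = deltaUnit (ψ a) e₁Unit := by
  rw [cocB, inv_mul_cancel_right]
  exact lamUnit_mul_deltaUnit_e₃Unit

theorem deltaUnit_wSL_cocA (g : Free₂) : deltaUnit wSL (cocA g) = cocD (σ g) := by
  rw [cocD, σ_σ]

theorem mul_inv_mul_mul_eq {G : Type*} [CommGroup G] {l x x₁ x₂ y y₁ : G}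
    (h : y₁ * (x * x) = y * x₁ * x₂) :
    l * x₁⁻¹ * y₁ * (l * x₂⁻¹) = l * x⁻¹ * (l * x⁻¹) * y := by
  rw [← eq_mul_inv_iff_mul_eq] at h
  calc l * x₁⁻¹ * y₁ * (l * x₂⁻¹) = (x₁ * x₁⁻¹) * (x₂ * x₂⁻¹) * (l * l * y * (x * x)⁻¹) := by
        rw [h]; ac_rfl
    _ = _ := by rw [mul_inv_cancel, mul_inv_cancel, one_mul, one_mul, mul_inv]; ac_rfl

theorem mul_mul_inv_mul_eq {G : Type*} [CommGroup G] {l x x₁ x₂ y y₁ : G}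
    (h : y₁ * (x * x) = y * x₁ * x₂) : x₁ * (l * y₁⁻¹) * x₂ = x * x * (l * y⁻¹) := by
  have h' : x₁ * x₂ = y⁻¹ * (y₁ * (x * x)) := by rw [h, mul_assoc, inv_mul_cancel_left]
  calc x₁ * (l * y₁⁻¹) * x₂ = (x₁ * x₂) * (l * y₁⁻¹) := by ac_rfl
    _ = (y₁ * y₁⁻¹) * (x * x * (l * y⁻¹)) := by rw [h']; ac_rfl
    _ = _ := by rw [mul_inv_cancel, one_mul]

/-- The relation of degree three with leading letter `A`, for `ε = 1`. -/
theorem cocycle_rel_A (g₁ g : Free₂) :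
    cocB (a * g) * cocA (g₁ * (a * b * a) * g) * cocB (σ g₁ * g) = cocB g * cocB g * cocA g :=
  mul_inv_mul_mul_eq (cocA_mul_cocD_sq g₁ g)

/-- The relation of degree three with leading letter `A`, for `ε = -1`. -/
theorem cocycle_rel_A_inv (g₁ g : Free₂) :
    cocB (a⁻¹ * g) * cocA (g₁ * (a⁻¹ * b⁻¹ * a⁻¹) * g) * cocB (σ g₁ * g) =
      cocB g * cocB g * cocA g :=
  mul_inv_mul_mul_eq (cocA_mul_cocD_sq_inv g₁ g)

/-- The relation of degree three with leading letter `B`, for `ε = 1`. -/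
theorem cocycle_rel_B (g₁ g : Free₂) :
    cocA (b * g) * cocB (g₁ * (b * a * b) * g) * cocA (σ g₁ * g) = cocA g * cocA g * cocB g := by
  -- The identity for A at the exchanged arguments, shifted by w: this interchanges `cocA` and
  -- `cocD`, and a and b.
  have h := congrArg (deltaUnit wSL) (cocA_mul_cocD_sq (σ g₁) (σ g))
  simp only [map_mul (deltaUnit wSL), deltaUnit_wSL_cocD, deltaUnit_wSL_cocA, map_mul σ, σ_σ, σ_a,
    σ_b] at h
  exact mul_mul_inv_mul_eq h

/-- The relation of degree three with leading letter `B`, for `ε = -1`. -/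
theorem cocycle_rel_B_inv (g₁ g : Free₂) :
    cocA (b⁻¹ * g) * cocB (g₁ * (b⁻¹ * a⁻¹ * b⁻¹) * g) * cocA (σ g₁ * g) =
      cocA g * cocA g * cocB g := by
  have h := congrArg (deltaUnit wSL) (cocA_mul_cocD_sq_inv (σ g₁) (σ g))
  simp only [map_mul (deltaUnit wSL), deltaUnit_wSL_cocD, deltaUnit_wSL_cocA, map_mul σ, map_inv σ,
    σ_σ, σ_a, σ_b] at h
  exact mul_mul_inv_mul_eq h

/-! ## The matrices -/

theorem Q_ne_zero : Q ≠ 0 := RatFunc.X_ne_zero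

theorem iK_mul_iK : iK * iK = -1 := by
  rw [iK, ← map_mul, Complex.I_mul_I, map_neg, map_one]

theorem Q_pow_four_ne_one : 1 - Q ^ 4 ≠ 0 := by
  intro h
  have h1 : algebraMap ℂ[X] K (1 - Polynomial.X ^ 4) = algebraMap ℂ[X] K 0 := by
    rw [map_sub, map_one, map_pow, RatFunc.algebraMap_X, map_zero]
    exact h
  have h2 := congrArg (Polynomial.eval 0) (RatFunc.algebraMap_injective ℂ h1)
  simp at h2

theorem qq_eq : qq = -(1 - Q ^ 4) / Q ^ 2 := by
  have := Q_ne_zero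
  rw [qq]
  field_simp
  ring

theorem qq_ne_zero : qq ≠ 0 := by
  rw [qq_eq]
  exact div_ne_zero (neg_ne_zero.2 Q_pow_four_ne_one) (pow_ne_zero _ Q_ne_zero)

/-- `3 × 3` matrices over `𝐤`. -/
abbrev KMat : Type := Matrix (Fin 3) (Fin 3) K

/-- `(1 - P) O_A^{(1)}`, where `P = -(O_B^{(1)})² / h²`. -/
def mP : KMat := !![-iK * qq / 2, 0, iK / qq; 0, 0, 0; -iK * qq ^ 3 / 4, 0, iK * qq / 2]
/-- `P O_A^{(1)}`, where `P = -(O_B^{(1)})² / h²`. -/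
def mM : KMat := !![-iK * qq / 2, 0, -iK / qq; 0, 0, 0; iK * qq ^ 3 / 4, 0, iK * qq / 2]
/-- The part of `O_B^{(1)}` that is linear in `λ`. -/
def bP : KMat := !![0, 1, 0; 0, 0, 0; 0, -qq ^ 2 / 2, 0]
/-- The part of `O_B^{(1)}` that is linear in `λ⁻¹`. -/
def bM : KMat := !![0, 0, 0; -qq ^ 2 / 2, 0, 1; 0, 0, 0]
/-- The matrix `D_A` over `𝐤`. -/
def dA : KMat := !![1, 0, 0; 0, -iK * Q, 0; 0, 0, -1]
/-- The coefficient of `e₁` in `D_A D_B D_A`. -/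
def s₁ : KMat := !![1, 0, -2 / qq ^ 2; 0, 0, 0; -qq ^ 2 / 2, 0, 1]
/-- The coefficient of `e₂` in `D_A D_B D_A`. -/
def s₂ : KMat := !![0, 2 * iK / qq, 0; 0, 0, 0; 0, iK * qq, 0]
/-- The coefficient of `e₃` in `D_A D_B D_A`. -/
def s₃ : KMat := !![0, 0, 0; -iK * qq, 0, -2 * iK / qq; 0, 0, 0]

/-- All these matrices except `dA` have rank one, so a product vanishes exactly when the row vector
of the left factor kills the column vector of the right one. These zeros make almost all terms in
the products below disappear. -/
theorem kmat_mul_eq_zero : mP * mP = 0 ∧ mM * mM = 0 ∧ bP * bP = 0 ∧ bM * bM = 0 ∧ bP * mP = 0 ∧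
    bP * mM = 0 ∧ bM * mP = 0 ∧ mP * bM = 0 ∧ mM * bM = 0 ∧ mM * bP = 0 ∧
    mP * s₂ = 0 ∧ mM * s₁ = 0 ∧ mP * s₃ = 0 ∧ mM * s₃ = 0 ∧ s₁ * bM = 0 ∧
    s₂ * bP = 0 ∧ s₃ * bP = 0 ∧ s₃ * bM = 0 ∧ s₁ * mP = 0 ∧ s₃ * mM = 0 ∧
    s₂ * mP = 0 ∧ s₂ * mM = 0 ∧ bP * s₁ = 0 ∧ bP * s₂ = 0 ∧ bM * s₂ = 0 ∧
    bM * s₃ = 0 := by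
  have hq := qq_ne_zero
  have hi := iK_mul_iK
  refine ⟨?_, ?_, ?_, ?_, ?_, ?_, ?_, ?_, ?_, ?_, ?_, ?_, ?_, ?_, ?_, ?_, ?_, ?_, ?_, ?_, ?_, ?_,
    ?_, ?_, ?_, ?_⟩ <;>
  · ext i j; fin_cases i <;> fin_cases j <;>
      simp [mP, mM, bP, bM, dA, s₁, s₂, s₃, Matrix.mul_apply, Fin.sum_univ_three] <;>
      field_simp <;> ring_nf

theorem kmat_mul_mul : mP * (mM * mP) = -(qq ^ 2 • mP) ∧ mM * (mP * mM) = -(qq ^ 2 • mM) ∧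
    bP * (bM * bP) = -(qq ^ 2 • bP) ∧ bM * (bP * bM) = -(qq ^ 2 • bM) ∧
    mM * (mP * bP) = -(qq ^ 2 • bP) ∧ bM * (mM * mP) = -(qq ^ 2 • bM) ∧
    bP * (bM * mM) = -(qq ^ 2 • mM) ∧ mP * (bP * bM) = -(qq ^ 2 • mP) := by
  have hq := qq_ne_zero
  have hi := iK_mul_iK
  refine ⟨?_, ?_, ?_, ?_, ?_, ?_, ?_, ?_⟩ <;>
  · ext i j; fin_cases i <;> fin_cases j <;>
      simp [mP, mM, bP, bM, dA, s₁, s₂, s₃, Matrix.mul_apply, Fin.sum_univ_three] <;>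
      field_simp <;> ring_nf <;> grind

/-- The constant part of conjugation: `dA` exchanges the two halves of the A-matrices, and `s₁`,
`s₂`, `s₃` intertwine the halves of the A-matrices with those of the B-matrices. -/
theorem kmat_mul_comm : dA * mP = mM * dA ∧ dA * mM = mP * dA ∧
    dA * (mP * bP) = (qq / Q) • (bP * dA) ∧ dA * (bM * mM) = -(qq * Q) • (bM * dA) ∧
    mP * s₁ = s₂ * bM ∧ mM * s₂ = s₁ * bP ∧
    s₁ * mM = bP * s₃ ∧ s₃ * mP = bM * s₁ := by
  have hq := qq_ne_zero
  have hQ := Q_ne_zero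
  have hi := iK_mul_iK
  refine ⟨?_, ?_, ?_, ?_, ?_, ?_, ?_, ?_⟩ <;>
  · ext i j; fin_cases i <;> fin_cases j <;>
      simp [mP, mM, bP, bM, dA, s₁, s₂, s₃, Matrix.mul_apply, Fin.sum_univ_three] <;>
      field_simp <;> ring_nf <;> grind

/-! ### The matrices over `𝐑` -/

/-- The inclusion of matrices over `𝐤` into matrices over `𝐑`. -/
def emb : KMat →ₐ[K] Mat3 := (Algebra.ofId K FunRing).mapMatrix

theorem emb_smul (r : K) (M : KMat) : emb (r • M) = algebraMap K FunRing r • emb M := by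
  rw [map_smul, algebraMap_smul]

/-- `c (1 - P) O_A^{(1)} + c⁻¹ P O_A^{(1)}`. -/
def matA (c : FunRingˣ) : Mat3 := (c : FunRing) • emb mP + ((c⁻¹ : FunRingˣ) : FunRing) • emb mM

/-- The matrix of the shape of `O_B^{(1)}` with parameter `l` in place of `λ`. -/
def matB (l : FunRingˣ) : Mat3 := (l : FunRing) • emb bP + ((l⁻¹ : FunRingˣ) : FunRing) • emb bM

/-- The scalar `h²` in `𝐑`. -/
def hSq : FunRing := algebraMap K FunRing (qq ^ 2)

theorem emb_mul_eq_zero {M N : KMat} (h : M * N = 0) :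
    emb M * emb N = 0 ∧ ∀ x : Mat3, emb M * (emb N * x) = 0 := by
  have : emb M * emb N = 0 := by rw [← map_mul, h, map_zero]
  exact ⟨this, fun x => by rw [← mul_assoc, this, zero_mul]⟩

theorem emb_mul_mul {M N R S : KMat} (h : M * (N * R) = -(qq ^ 2 • S)) :
    emb M * (emb N * emb R) = -(hSq • emb S) := by
  rw [← map_mul, ← map_mul, h, map_neg, emb_smul, hSq]

theorem emb_zero_table :
    (emb mP * emb mP = 0 ∧ ∀ x : Mat3, emb mP * (emb mP * x) = 0) ∧
    (emb mM * emb mM = 0 ∧ ∀ x : Mat3, emb mM * (emb mM * x) = 0) ∧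
    (emb bP * emb bP = 0 ∧ ∀ x : Mat3, emb bP * (emb bP * x) = 0) ∧
    (emb bM * emb bM = 0 ∧ ∀ x : Mat3, emb bM * (emb bM * x) = 0) ∧
    (emb bP * emb mP = 0 ∧ ∀ x : Mat3, emb bP * (emb mP * x) = 0) ∧
    (emb bP * emb mM = 0 ∧ ∀ x : Mat3, emb bP * (emb mM * x) = 0) ∧
    (emb bM * emb mP = 0 ∧ ∀ x : Mat3, emb bM * (emb mP * x) = 0) ∧
    (emb mP * emb bM = 0 ∧ ∀ x : Mat3, emb mP * (emb bM * x) = 0) ∧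
    (emb mM * emb bM = 0 ∧ ∀ x : Mat3, emb mM * (emb bM * x) = 0) ∧
    (emb mM * emb bP = 0 ∧ ∀ x : Mat3, emb mM * (emb bP * x) = 0) := by
  obtain ⟨h₁, h₂, h₃, h₄, h₅, h₆, h₇, h₈, h₉, h₀, -⟩ := kmat_mul_eq_zero
  exact ⟨emb_mul_eq_zero h₁, emb_mul_eq_zero h₂, emb_mul_eq_zero h₃, emb_mul_eq_zero h₄,
    emb_mul_eq_zero h₅, emb_mul_eq_zero h₆, emb_mul_eq_zero h₇, emb_mul_eq_zero h₈,
    emb_mul_eq_zero h₉, emb_mul_eq_zero h₀⟩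

theorem emb_triple_table :
    emb mP * (emb mM * emb mP) = -(hSq • emb mP) ∧ emb mM * (emb mP * emb mM) = -(hSq • emb mM) ∧
    emb bP * (emb bM * emb bP) = -(hSq • emb bP) ∧ emb bM * (emb bP * emb bM) = -(hSq • emb bM) ∧
    emb mM * (emb mP * emb bP) = -(hSq • emb bP) ∧ emb bM * (emb mM * emb mP) = -(hSq • emb bM) ∧
    emb bP * (emb bM * emb mM) = -(hSq • emb mM) ∧ emb mP * (emb bP * emb bM) = -(hSq • emb mP) := by
  obtain ⟨h₁, h₂, h₃, h₄, h₅, h₆, h₇, h₈⟩ := kmat_mul_mul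
  exact ⟨emb_mul_mul h₁, emb_mul_mul h₂, emb_mul_mul h₃, emb_mul_mul h₄, emb_mul_mul h₅,
    emb_mul_mul h₆, emb_mul_mul h₇, emb_mul_mul h₈⟩

/-! ### Products of the matrices in terms of their parameters. -/

theorem matA_mul_matA (c d : FunRingˣ) : matA c * matA d =
    ((c * d⁻¹ : FunRingˣ) : FunRing) • (emb mP * emb mM)
      + ((c⁻¹ * d : FunRingˣ) : FunRing) • (emb mM * emb mP) := by
  simp only [matA, add_mul, mul_add, smul_mul_assoc, mul_smul_comm, emb_zero_table, smul_zero,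
    smul_smul, add_zero, zero_add, Units.val_mul]
  rw [mul_comm (d : FunRing)]
  try module

theorem matB_mul_matB (c d : FunRingˣ) : matB c * matB d =
    ((c * d⁻¹ : FunRingˣ) : FunRing) • (emb bP * emb bM)
      + ((c⁻¹ * d : FunRingˣ) : FunRing) • (emb bM * emb bP) := by
  simp only [matB, add_mul, mul_add, smul_mul_assoc, mul_smul_comm, emb_zero_table, smul_zero,
    smul_smul, add_zero, zero_add, Units.val_mul]
  rw [mul_comm (d : FunRing)]
  try module

theorem matA_sq (c : FunRingˣ) : matA c * matA c = matA 1 * matA 1 := by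
  simp only [matA_mul_matA, mul_inv_cancel, inv_mul_cancel]

theorem matB_sq (c l : FunRingˣ) : matB c * matB c = matB l * matB l := by
  simp only [matB_mul_matB, mul_inv_cancel, inv_mul_cancel]

theorem matB_matA_matB (x y z : FunRingˣ) : matB x * matA y * matB z = 0 := by
  simp only [matA, matB, add_mul, mul_add, smul_mul_assoc, mul_smul_comm, mul_assoc,
    emb_zero_table, mul_zero, zero_mul, smul_zero, add_zero]

theorem matA_matB_matA (x y z : FunRingˣ) : matA x * matB y * matA z = 0 := by
  simp only [matA, matB, add_mul, mul_add, smul_mul_assoc, mul_smul_comm, mul_assoc,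
    emb_zero_table, mul_zero, zero_mul, smul_zero, add_zero]

theorem matA_triple (x y z : FunRingˣ) :
    matA x * matA y * matA z = -(hSq • matA (x * y⁻¹ * z)) := by
  rw [matA_mul_matA]
  simp only [matA, add_mul, mul_add, smul_mul_assoc, mul_smul_comm, mul_assoc, emb_zero_table,
    emb_triple_table, mul_zero, zero_mul, smul_zero, add_zero, zero_add, Units.val_mul, mul_inv,
    inv_inv, smul_neg,
    smul_smul, smul_add]
  module

theorem matB_triple (x y z : FunRingˣ) :
    matB x * matB y * matB z = -(hSq • matB (x * y⁻¹ * z)) := by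
  rw [matB_mul_matB]
  simp only [matB, add_mul, mul_add, smul_mul_assoc, mul_smul_comm, mul_assoc, emb_zero_table,
    emb_triple_table, mul_zero, zero_mul, smul_zero, add_zero, zero_add, Units.val_mul, mul_inv,
    inv_inv, smul_neg,
    smul_smul, smul_add]
  module

/-- Each of the two summands contributes one half of a B-matrix, with mutually inverse coefficients.
Compared with `matB_triple`, this turns the degree-three relations into equations between units. -/
theorem matA_matA_matB_add (c d l : FunRingˣ) :
    matA c * matA d * matB l + matB l * matA d * matA c = -(hSq • matB (c⁻¹ * d * l)) := by
  rw [matA_mul_matA, mul_assoc (matB l), matA_mul_matA]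
  simp only [matB, add_mul, mul_add, smul_mul_assoc, mul_smul_comm, mul_assoc, emb_zero_table,
    emb_triple_table, mul_zero, zero_mul, smul_zero, add_zero, zero_add, Units.val_mul, mul_inv,
    inv_inv, smul_neg,
    smul_smul, smul_add]
  module

theorem matB_matB_matA_add (c d l : FunRingˣ) :
    matB c * matB d * matA l + matA l * matB d * matB c = -(hSq • matA (c⁻¹ * d * l)) := by
  rw [matB_mul_matB, mul_assoc (matA l), matB_mul_matB]
  simp only [matA, add_mul, mul_add, smul_mul_assoc, mul_smul_comm, mul_assoc, emb_zero_table,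
    emb_triple_table, mul_zero, zero_mul, smul_zero, add_zero, zero_add, Units.val_mul, mul_inv,
    inv_inv, smul_neg,
    smul_smul, smul_add]
  module

theorem OA1_eq : OA1 = matA 1 := by
  rw [matA, inv_one, Units.val_one, one_smul, one_smul, ← map_add]
  have hq := qq_ne_zero
  refine congrArg emb (Matrix.ext fun i j => ?_)
  fin_cases i <;> fin_cases j <;> simp [mP, mM] <;> ring

theorem OB1_eq : OB1 = matB lamUnit := by
  ext i j
  fin_cases i <;> fin_cases j <;>
    simp [OB1, matB, emb, bP, bM, ePlus_eq, eMinus_eq, Algebra.ofId_apply, mul_comm]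

/-- The projection -(O_B^{(1)})²/h² kills `mP` and fixes `mM`; the recursion thus multiplies the
first half by c and the second by c⁻¹. -/
theorem recStep_matA (c d : FunRingˣ) : recStep c (matA d) = matA (c * d) := by
  rw [recStep, OB1_eq, matB_mul_matB, Ring.inverse_unit]
  have h : hSq * algebraMap K FunRing (qq ^ 2)⁻¹ = 1 := by
    rw [hSq, ← map_mul, mul_inv_cancel₀ (pow_ne_zero _ qq_ne_zero), map_one]
  simp only [matA, add_mul, mul_add, smul_mul_assoc, mul_smul_comm, mul_assoc, emb_zero_table,
    emb_triple_table, mul_zero, zero_mul, smul_zero, add_zero, zero_add, Units.val_mul, mul_inv,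
    smul_neg,
    smul_smul, smul_add, mul_inv_cancel, inv_mul_cancel, Units.val_one, one_mul, sub_mul]
  match_scalars
  · ring
  · linear_combination (-(c : FunRing) + (c⁻¹ : FunRingˣ)) * (d⁻¹ : FunRingˣ) * h

/-! ## The operators -/

theorem deltaHom_algebraMap (γ : Matrix.SpecialLinearGroup (Fin 2) ℤ) (r : K) :
    deltaHom γ (algebraMap K FunRing r) = algebraMap K FunRing r := by
  have h : (deltaHom γ).comp ratHom = ratHom := by
    refine IsLocalization.ringHom_ext (nonZeroDivisors ℂ[X]) (RingHom.ext fun P => ?_)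
    have hP : ratHom (algebraMap ℂ[X] K P) = polyHom P := IsLocalization.lift_eq _ _
    change deltaHom γ (ratHom (algebraMap ℂ[X] K P)) = ratHom (algebraMap ℂ[X] K P)
    rw [hP]
    rfl
  exact RingHom.congr_fun h r

/-- The entrywise shift of matrices. -/
def deltaMat (γ : Matrix.SpecialLinearGroup (Fin 2) ℤ) : Mat3 →+* Mat3 := (deltaHom γ).mapMatrix

theorem deltaMat_smul (γ : Matrix.SpecialLinearGroup (Fin 2) ℤ) (c : FunRing) (M : Mat3) :
    deltaMat γ (c • M) = deltaHom γ c • deltaMat γ M :=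
  Matrix.ext fun i j => map_mul (deltaHom γ) c (M i j)

theorem deltaMat_emb (γ : Matrix.SpecialLinearGroup (Fin 2) ℤ) (M : KMat) :
    deltaMat γ (emb M) = emb M :=
  Matrix.ext fun i j => deltaHom_algebraMap γ (M i j)

theorem deltaMat_algebra_smul (γ : Matrix.SpecialLinearGroup (Fin 2) ℤ) (r : K) (M : Mat3) :
    deltaMat γ (r • M) = r • deltaMat γ M := by
  rw [← algebraMap_smul FunRing r M, deltaMat_smul, deltaHom_algebraMap, algebraMap_smul]

theorem deltaMat_matA (γ : Matrix.SpecialLinearGroup (Fin 2) ℤ) (c : FunRingˣ) :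
    deltaMat γ (matA c) = matA (deltaUnit γ c) := by
  rw [matA, map_add, deltaMat_smul, deltaMat_smul, deltaMat_emb, deltaMat_emb, matA, ← map_inv]
  rfl

theorem deltaMat_matB (γ : Matrix.SpecialLinearGroup (Fin 2) ℤ) (c : FunRingˣ) :
    deltaMat γ (matB c) = matB (deltaUnit γ c) := by
  rw [matB, map_add, deltaMat_smul, deltaMat_smul, deltaMat_emb, deltaMat_emb, matB, ← map_inv]
  rfl

theorem matOp_mul (M N : Mat3) : matOp (M * N) = matOp M * matOp N :=
  AddMonoidHom.ext fun v => (Matrix.mulVec_mulVec v M N).symm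

theorem matOp_one : matOp 1 = 1 := AddMonoidHom.ext fun v => Matrix.one_mulVec v

theorem matOp_injective : Function.Injective matOp := fun _ _ h =>
  Matrix.mulVec_injective (funext fun v => DFunLike.congr_fun h v)

theorem isUnit_matOp {M : Mat3} (h : IsUnit M) : IsUnit (matOp M) :=
  h.map ({ toFun := matOp, map_one' := matOp_one, map_mul' := matOp_mul } : Mat3 →* Op)

theorem deltaOp_mul_matOp (γ : Matrix.SpecialLinearGroup (Fin 2) ℤ) (M : Mat3) :
    deltaOp γ * matOp M = matOp (deltaMat γ M) * deltaOp γ :=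
  AddMonoidHom.ext fun v => funext fun i => RingHom.map_mulVec (deltaHom γ) M v i

theorem deltaOp_mul_deltaOp (γ γ' : Matrix.SpecialLinearGroup (Fin 2) ℤ) :
    deltaOp γ * deltaOp γ' = deltaOp (γ' * γ) :=
  AddMonoidHom.ext fun v => funext fun i => deltaHom_deltaHom γ γ' (v i)

theorem matOp_mul_deltaOp_mul (M N : Mat3) (γ γ' : Matrix.SpecialLinearGroup (Fin 2) ℤ) :
    matOp M * deltaOp γ * (matOp N * deltaOp γ') =
      matOp (M * deltaMat γ N) * deltaOp (γ' * γ) := by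
  rw [mul_assoc, ← mul_assoc (deltaOp γ), deltaOp_mul_matOp, mul_assoc, deltaOp_mul_deltaOp,
    ← mul_assoc, matOp_mul]

theorem deltaOp_one : deltaOp 1 = 1 :=
  AddMonoidHom.ext fun v => funext fun i => deltaHom_one (v i)

theorem isUnit_deltaOp (γ : Matrix.SpecialLinearGroup (Fin 2) ℤ) : IsUnit (deltaOp γ) :=
  ⟨⟨deltaOp γ, deltaOp γ⁻¹, by rw [deltaOp_mul_deltaOp, inv_mul_cancel, deltaOp_one],
    by rw [deltaOp_mul_deltaOp, mul_inv_cancel, deltaOp_one]⟩, rfl⟩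

theorem DHatA_eq : DHatA = matOp (emb dA) * deltaOp (ψ a) := by
  rw [ψ_a]
  rfl

theorem DHatB_eq : DHatB = matOp DB * deltaOp (ψ b) := by
  rw [ψ_b]
  rfl

theorem isUnit_of_isUnit_det {M : Mat3} (h : IsUnit M.det) : IsUnit M :=
  (Matrix.isUnit_iff_isUnit_det M).2 h

theorem iK_ne_zero : iK ≠ 0 := fun h => by
  have := iK_mul_iK
  rw [h, mul_zero, zero_eq_neg] at this
  exact one_ne_zero this

theorem isUnit_DHatA : IsUnit DHatA := by
  rw [DHatA_eq]
  refine (isUnit_matOp (IsUnit.map emb ?_)).mul (isUnit_deltaOp _)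
  rw [Matrix.isUnit_iff_isUnit_det, dA, Matrix.det_fin_three]
  simp [iK_ne_zero, Q_ne_zero]

theorem det_DB : DB.det = algebraMap K FunRing (8 / Q ^ 2) * (e₁ * e₂ * e₃) := by
  have h : -2 * ((2 * Q / (1 - Q ^ 4)) * (-(1 - Q ^ 4) / Q ^ 3))
      + (2 * Q / (1 - Q ^ 4)) ^ 2 * ((1 - Q ^ 4) ^ 2 / (2 * Q ^ 4))
      + (2 * Q ^ 4 / (1 - Q ^ 4) ^ 2) * (-(1 - Q ^ 4) / Q ^ 3) ^ 2 = 8 / Q ^ 2 := by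
    have h1 := Q_pow_four_ne_one
    have h2 := Q_ne_zero
    field_simp
    ring
  rw [← h, Matrix.det_fin_three, DB]
  simp only [map_add, map_mul, map_pow, map_neg, map_ofNat, Matrix.of_apply, Matrix.cons_val',
    Matrix.cons_val]
  ring

theorem isUnit_DHatB : IsUnit DHatB := by
  rw [DHatB_eq]
  refine (isUnit_matOp (isUnit_of_isUnit_det ?_)).mul (isUnit_deltaOp _)
  rw [det_DB, e₁_eq, e₂_eq, e₃_eq]
  have h : (8 : K) / Q ^ 2 ≠ 0 := div_ne_zero (by norm_num) (pow_ne_zero _ Q_ne_zero)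
  exact (h.isUnit.map _).mul ((e₁Unit.isUnit.mul e₂Unit.isUnit).mul e₃Unit.isUnit)

theorem isUnit_SHat : IsUnit SHat := (isUnit_DHatA.mul isUnit_DHatB).mul isUnit_DHatA

/-- The matrix part of `Ŝ`. -/
def matS : Mat3 := (deltaUnit (ψ a) e₁Unit : FunRing) • emb s₁ +
  (deltaUnit (ψ a) e₂Unit : FunRing) • emb s₂ + (deltaUnit (ψ a) e₃Unit : FunRing) • emb s₃

theorem SHat_eq : SHat = matOp matS * deltaOp wSL := by
  have h1 := Q_pow_four_ne_one
  have h2 := Q_ne_zero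
  have hi := iK_mul_iK
  -- D_B is split by the exponentials e₁, e₂, e₃ into constant matrices, which the shift by a leaves
  -- alone.
  have hD : ∃ d₁ d₂ d₃ : KMat, DB = e₁ • emb d₁ + e₂ • emb d₂ + e₃ • emb d₃ ∧
      dA * d₁ * dA = s₁ ∧ dA * d₂ * dA = s₂ ∧ dA * d₃ * dA = s₃ := by
    refine ⟨!![1, 0, 2 * Q ^ 4 / (1 - Q ^ 4) ^ 2; 0, 0, 0; (1 - Q ^ 4) ^ 2 / (2 * Q ^ 4), 0, 1],
      !![0, 2 * Q / (1 - Q ^ 4), 0; 0, 0, 0; 0, -(1 - Q ^ 4) / Q ^ 3, 0],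
      !![0, 0, 0; -(1 - Q ^ 4) / Q ^ 3, 0, 2 * Q / (1 - Q ^ 4); 0, 0, 0], ?_, ?_, ?_, ?_⟩
    · ext i j
      fin_cases i <;> fin_cases j <;> simp [DB, emb, Algebra.ofId_apply] <;> ring
    all_goals
      ext i j
      fin_cases i <;> fin_cases j <;>
        simp [dA, s₁, s₂, s₃, Matrix.mul_apply, Fin.sum_univ_three, qq_eq] <;> field_simp <;>
        ring_nf <;> grind
  obtain ⟨d₁, d₂, d₃, hDB, hs₁, hs₂, hs₃⟩ := hD
  have hS : emb dA * deltaMat (ψ a) DB * emb dA = matS := by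
    rw [hDB, matS, ← hs₁, ← hs₂, ← hs₃, e₁_eq, e₂_eq, e₃_eq]
    simp only [map_add, deltaMat_smul, deltaMat_emb, mul_add, add_mul, mul_smul_comm,
      smul_mul_assoc, map_mul, deltaUnit_val]
  rw [SHat, DHatA_eq, DHatB_eq, matOp_mul_deltaOp_mul, matOp_mul_deltaOp_mul, deltaMat_emb, hS,
    ← map_mul, ← map_mul, wSL, mul_assoc a]

/-! ### Conjugation by the operators -/

theorem dA_mul_matA (c : FunRingˣ) : emb dA * matA c⁻¹ = matA c * emb dA := by
  obtain ⟨h₁, h₂, -⟩ := kmat_mul_comm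
  simp only [matA, mul_add, add_mul, mul_smul_comm, smul_mul_assoc, ← map_mul, h₁, h₂, inv_inv]
  exact add_comm _ _

theorem matA_one_mul_matB (l : FunRingˣ) : matA 1 * matB l = (l : FunRing) • emb (mP * bP) := by
  simp only [matA, matB, mul_add, add_mul, mul_smul_comm, smul_mul_assoc, emb_zero_table,
    smul_zero, add_zero, inv_one, Units.val_one, one_smul, map_mul]

theorem matB_mul_matA_one (l : FunRingˣ) :
    matB l * matA 1 = ((l⁻¹ : FunRingˣ) : FunRing) • emb (bM * mM) := by
  simp only [matA, matB, mul_add, add_mul, mul_smul_comm, smul_mul_assoc, emb_zero_table,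
    smul_zero, add_zero, zero_add, inv_one, Units.val_one, one_smul, map_mul]

/-- Left multiplication by O_A^{(1)} retains only the half of `matB l` with coefficient l, right
multiplication only the half with l⁻¹. Moving `dA` past them produces the factors h/Q and -hQ, which
the coefficients of the twisted commutator cancel. -/
theorem dA_mul_twist_matB (l : FunRingˣ) :
    emb dA * (qq⁻¹ • (Q • (matA 1 * matB l) - Q⁻¹ • (matB l * matA 1))) = matB l * emb dA := by
  obtain ⟨-, -, h₁, h₂, -⟩ := kmat_mul_comm
  have hq := qq_ne_zero
  have hQ := Q_ne_zero
  rw [matA_one_mul_matB, matB_mul_matA_one, matB, add_mul, smul_mul_assoc, smul_mul_assoc,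
    ← map_mul, ← map_mul, mul_smul_comm, mul_sub, mul_smul_comm, mul_smul_comm, mul_smul_comm,
    mul_smul_comm, ← map_mul, ← map_mul, h₁, h₂, map_smul, map_smul, smul_sub,
    smul_comm (l : FunRing), smul_comm ((l⁻¹ : FunRingˣ) : FunRing), smul_smul, smul_smul,
    smul_smul, smul_smul, sub_eq_add_neg, ← neg_smul]
  congr 1
  · rw [show qq⁻¹ * Q * (qq / Q) = 1 by field_simp, one_smul]
  · rw [show -(qq⁻¹ * Q⁻¹ * -(qq * Q)) = 1 by field_simp, one_smul]

/-- Only two terms survive on each side, and their coefficients agree by m e₁ = c⁻¹ e₂ and m⁻¹ e₂ =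
c e₁ (exponentials shifted by a), both restatements of `h`. -/
theorem matS_mul_matB {m c : FunRingˣ}
    (h : m * c * deltaUnit (ψ a) e₁Unit = deltaUnit (ψ a) e₂Unit) :
    matS * matB m = matA c * matS := by
  have k₁ := congrArg Units.val (show m * deltaUnit (ψ a) e₁Unit = c⁻¹ * deltaUnit (ψ a) e₂Unit by
    rw [← h, eq_inv_mul_iff_mul_eq, ← mul_assoc, mul_comm c])
  have k₂ := congrArg Units.val (show m⁻¹ * deltaUnit (ψ a) e₂Unit = c * deltaUnit (ψ a) e₁Unit by
    rw [← h, mul_assoc, inv_mul_cancel_left])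
  rw [Units.val_mul, Units.val_mul] at k₁ k₂
  obtain ⟨-, -, -, -, -, -, -, -, -, -, h₁, h₂, h₃, h₄, h₅, h₆, h₇, h₈, -⟩ := kmat_mul_eq_zero
  obtain ⟨-, -, -, -, h₉, h₀, -⟩ := kmat_mul_comm
  simp only [matS, matA, matB, mul_add, add_mul, mul_smul_comm, smul_mul_assoc, ← map_mul, h₁, h₂,
    h₃, h₄, h₅, h₆, h₇, h₈, h₉, h₀, map_zero, smul_zero, add_zero, zero_add, smul_smul]
  match_scalars
  · linear_combination k₁
  · linear_combination k₂

theorem matS_mul_matA {d l : FunRingˣ}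
    (h : l * d * deltaUnit (ψ a) e₃Unit = deltaUnit (ψ a) e₁Unit) :
    matS * matA d = matB l * matS := by
  have k₁ := congrArg Units.val (show d⁻¹ * deltaUnit (ψ a) e₁Unit = l * deltaUnit (ψ a) e₃Unit by
    rw [← h, mul_right_comm, mul_comm, mul_inv_cancel_right])
  have k₂ := congrArg Units.val (show d * deltaUnit (ψ a) e₃Unit = l⁻¹ * deltaUnit (ψ a) e₁Unit by
    rw [← h, mul_assoc, inv_mul_cancel_left])
  rw [Units.val_mul, Units.val_mul] at k₁ k₂
  obtain ⟨-, -, -, -, -, -, -, -, -, -, -, -, -, -, -, -, -, -, h₁, h₂, h₃, h₄, h₅, h₆, h₇, h₈⟩ :=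
    kmat_mul_eq_zero
  obtain ⟨-, -, -, -, -, -, h₉, h₀⟩ := kmat_mul_comm
  simp only [matS, matA, matB, mul_add, add_mul, mul_smul_comm, smul_mul_assoc, ← map_mul, h₁, h₂,
    h₃, h₄, h₅, h₆, h₇, h₈, h₉, h₀, map_zero, smul_zero, add_zero, zero_add, smul_smul]
  match_scalars
  · linear_combination k₂
  · linear_combination k₁

/-! ## The representation -/

theorem alg_induction {C : Alg → Prop} (algebraMap_mem : ∀ r, C (algebraMap K Alg r))
    (gen_mem : ∀ X g, C (O X g)) (mul_mem : ∀ x y, C x → C y → C (x * y))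
    (add_mem : ∀ x y, C x → C y → C (x + y)) (x : Alg) : C x := by
  obtain ⟨x, rfl⟩ := RingQuot.mkAlgHom_surjective K _ x
  induction x using FreeAlgebra.induction with
  | grade0 r =>
    rw [AlgHom.commutes]
    exact algebraMap_mem r
  | grade1 p => exact gen_mem p.1 p.2
  | mul x y hx hy =>
    rw [map_mul]
    exact mul_mem _ _ hx hy
  | add x y hx hy =>
    rw [map_add]
    exact add_mem _ _ hx hy

/-- A family of elements of an algebra that satisfies the defining relations of `𝒜`. -/
def IsRep {R : Type*} [Ring R] [Algebra K R] (f : Letter → Free₂ → R) : Prop :=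
  ∀ x, Relator x → FreeAlgebra.lift K (fun p : Letter × Free₂ => f p.1 p.2) x = 0

/-- The algebra homomorphism out of `𝒜` with given values on the generators. -/
def algLift {R : Type*} [Ring R] [Algebra K R] (f : Letter → Free₂ → R) (h : IsRep f) :
    Alg →ₐ[K] R :=
  RingQuot.liftAlgHom K ⟨FreeAlgebra.lift K fun p : Letter × Free₂ => f p.1 p.2, by
    rintro x y ⟨hx, rfl⟩
    rw [h x hx, map_zero]⟩

theorem algLift_O {R : Type*} [Ring R] [Algebra K R] (f : Letter → Free₂ → R) (h : IsRep f)
    (X : Letter) (g : Free₂) : algLift f h (O X g) = f X g := by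
  rw [O, algLift, RingQuot.liftAlgHom_mkAlgHom_apply, gen, FreeAlgebra.lift_ι_apply]

/-- The matrices `O_A^{(g)}` and `O_B^{(g)}`. -/
def genMat : Letter → Free₂ → Mat3
  | .A, g => matA (cocA g)
  | .B, g => matB (cocB g)

theorem qq_sq_smul (M : Mat3) : qq ^ 2 • M = hSq • M := (algebraMap_smul FunRing (qq ^ 2) M).symm

theorem inv_mul_mul_eq {G : Type*} [CommGroup G] {c d l x y : G} (h : l * d * y = x * x * c) :
    c⁻¹ * d * l = x * y⁻¹ * x := by
  rw [mul_assoc, inv_mul_eq_iff_eq_mul, mul_comm d l, eq_mul_inv_of_mul_eq h, mul_comm c,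
    mul_right_comm x y⁻¹,
    mul_right_comm (x * x)]

/-- Apart from the invariance under left multiplication of the index by a or b, only the last four
families of relators use the cocycles; the others hold for arbitrary parameters. -/
theorem isRep_genMat : IsRep genMat := by
  intro x hx
  cases hx with
  | r0A g => simp only [map_sub, gen, FreeAlgebra.lift_ι_apply, genMat, cocA_a_mul, sub_self]
  | r0B g => simp only [map_sub, gen, FreeAlgebra.lift_ι_apply, genMat, cocB_b_mul, sub_self]
  | r1 X g =>
    simp only [map_sub, map_mul, gen, FreeAlgebra.lift_ι_apply]
    cases X
    · rw [genMat, genMat, cocA_one, matA_sq, sub_self]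
    · rw [genMat, genMat, matB_sq, sub_self]
  | r2 g₁ g₂ g₃ => simp only [map_mul, gen, FreeAlgebra.lift_ι_apply, genMat, matB_matA_matB]
  | r3 g₁ g₂ g₃ => simp only [map_mul, gen, FreeAlgebra.lift_ι_apply, genMat, matA_matB_matA]
  | r4 X g =>
    simp only [map_add, map_smul, map_mul, gen, FreeAlgebra.lift_ι_apply, qq_sq_smul]
    cases X <;> simp only [genMat, matA_triple, matB_triple, mul_inv_cancel, one_mul] <;>
      exact neg_add_cancel _
  | r5 X g =>
    simp only [map_add, map_smul, map_mul, gen, FreeAlgebra.lift_ι_apply, qq_sq_smul]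
    cases X <;> simp only [genMat, matA_triple, matB_triple, inv_mul_cancel_right] <;>
      exact neg_add_cancel _
  | r6 g =>
    simp only [map_add, map_smul, map_mul, gen, FreeAlgebra.lift_ι_apply, qq_sq_smul, genMat]
    rw [add_right_comm, matA_matA_matB_add, inv_mul_cancel, one_mul, neg_add_cancel]
  | r7 g =>
    simp only [map_add, map_smul, map_mul, gen, FreeAlgebra.lift_ι_apply, qq_sq_smul, genMat]
    rw [add_right_comm, matB_matB_matA_add, inv_mul_cancel, one_mul, neg_add_cancel]
  | r8 g₁ g₂ =>
    simp only [map_add, map_sub, map_mul, gen, FreeAlgebra.lift_ι_apply, genMat]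
    rw [matA_matA_matB_add, matB_triple, sub_eq_zero, inv_mul_mul_eq]
    simpa only [mul_assoc] using cocycle_rel_A g₁ g₂
  | r9 g₁ g₂ =>
    simp only [map_add, map_sub, map_mul, gen, FreeAlgebra.lift_ι_apply, genMat]
    rw [matB_matB_matA_add, matA_triple, sub_eq_zero, inv_mul_mul_eq]
    simpa only [mul_assoc] using cocycle_rel_B g₁ g₂
  | r10 g₁ g₂ =>
    simp only [map_add, map_sub, map_mul, gen, FreeAlgebra.lift_ι_apply, genMat]
    rw [matA_matA_matB_add, matB_triple, sub_eq_zero, inv_mul_mul_eq]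
    simpa only [mul_assoc] using cocycle_rel_A_inv g₁ g₂
  | r11 g₁ g₂ =>
    simp only [map_add, map_sub, map_mul, gen, FreeAlgebra.lift_ι_apply, genMat]
    rw [matB_matB_matA_add, matA_triple, sub_eq_zero, inv_mul_mul_eq]
    simpa only [mul_assoc] using cocycle_rel_B_inv g₁ g₂

/-- The representation of `𝒜` by matrices over `𝐑`. -/
def rep : Alg →ₐ[K] Mat3 := algLift genMat isRep_genMat

theorem rep_A (g : Free₂) : rep (O .A g) = matA (cocA g) := algLift_O _ _ _ _
theorem rep_B (g : Free₂) : rep (O .B g) = matB (cocB g) := algLift_O _ _ _ _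

/-! ### Equivariance -/

theorem intertwines_of_generators {M : Mat3} {γ : Matrix.SpecialLinearGroup (Fin 2) ℤ}
    (θ : Alg ≃ₐ[K] Alg)
    (h : ∀ X g, M * deltaMat γ (rep (θ (O X g))) = rep (O X g) * M) (x : Alg) :
    M * deltaMat γ (rep (θ x)) = rep x * M := by
  induction x using alg_induction with
  | algebraMap_mem r =>
    rw [AlgEquiv.commutes, AlgHom.commutes, Algebra.algebraMap_eq_smul_one, deltaMat_algebra_smul,
      map_one, mul_smul_comm, mul_one, smul_mul_assoc, one_mul]
  | gen_mem X g => exact h X g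
  | mul_mem x y hx hy =>
    rw [map_mul, map_mul, map_mul, ← mul_assoc, hx, mul_assoc, hy, map_mul, mul_assoc]
  | add_mem x y hx hy => rw [map_add, map_add, map_add, mul_add, hx, hy, map_add, add_mul]

theorem matOp_eq_conj {M N N' : Mat3} {γ : Matrix.SpecialLinearGroup (Fin 2) ℤ} {D : Op}
    (hD : D = matOp M * deltaOp γ) (hu : IsUnit D) (h : M * deltaMat γ N' = N * M) :
    matOp N' = Ring.inverse D * matOp N * D := by
  have : D * matOp N' = matOp N * D := by
    rw [hD, mul_assoc, deltaOp_mul_matOp, ← mul_assoc, ← matOp_mul, h, matOp_mul, mul_assoc]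
  rw [mul_assoc, ← this, Ring.inverse_mul_cancel_left _ _ hu]

theorem rep_twist {θ : Alg ≃ₐ[K] Alg} (hθ : IsTwist θ) (x : Alg) :
    matOp (rep (θ x)) = Ring.inverse DHatA * matOp (rep x) * DHatA := by
  refine matOp_eq_conj DHatA_eq isUnit_DHatA (intertwines_of_generators θ (fun X g => ?_) x)
  have hc : ∀ u : FunRingˣ, deltaUnit (ψ a) (deltaUnit (ψ a⁻¹) u) = u := fun u => by
    rw [deltaUnit_deltaUnit, ← map_mul, inv_mul_cancel, map_one, deltaUnit_one]
  cases X
  -- Sandwiching between two copies of O_A^{(1)} inverts the parameter; `dA` undoes this by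
  -- exchanging `mP` and `mM`.
  · have h : rep (θ (O .A g)) = matA (cocA (g * a⁻¹))⁻¹ := by
      rw [hθ.map_A, map_smul, map_mul, map_mul, rep_A, rep_A, cocA_one, matA_triple, one_mul,
        mul_one, ← qq_sq_smul, smul_neg, neg_smul, neg_neg, smul_smul,
        inv_mul_cancel₀ (pow_ne_zero _ qq_ne_zero), one_smul]
    rw [h, deltaMat_matA, map_inv, cocA_mul_a_inv, hc, rep_A, dA_mul_matA]
  · rw [hθ.map_B, rep_B, ← dA_mul_twist_matB]
    simp only [map_smul, map_sub, map_mul, deltaMat_algebra_smul, rep_A, rep_B, cocA_one,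
      deltaMat_matA, deltaMat_matB, map_one, cocB_mul_a_inv, hc]

theorem deltaMat_wSL_genMat_B (g : Free₂) :
    matS * deltaMat wSL (matB (cocB (σ g))) = matA (cocA g) * matS := by
  have h := deltaUnit_wSL_cocB (σ g)
  rw [σ_σ] at h
  rw [deltaMat_matB, matS_mul_matB h]

theorem rep_swap {θ : Alg ≃ₐ[K] Alg} (hθ : IsSwap θ) (x : Alg) :
    matOp (rep (θ x)) = Ring.inverse SHat * matOp (rep x) * SHat := by
  refine matOp_eq_conj SHat_eq isUnit_SHat (intertwines_of_generators θ (fun X g => ?_) x)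
  cases X
  · rw [hθ.map_A, rep_B, rep_A, deltaMat_wSL_genMat_B]
  · rw [hθ.map_B, rep_B, rep_A, deltaMat_matA, deltaUnit_wSL_cocA, σ_σ,
      matS_mul_matA (cocB_mul_e₃Unit g)]

/-! ### Existence and uniqueness of the matrices -/

theorem isGeneratorMatrices_genMat : IsGeneratorMatrices (genMat .A) (genMat .B) where
  A_one := by rw [genMat, cocA_one, OA1_eq]
  A_rec k g _ := by rw [genMat, genMat, cPlus_eq, recStep_matA, cocA_rec]
  A_rec_inv k g _ := by rw [genMat, genMat, cMinus_eq, recStep_matA, cocA_rec_inv]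
  B_eq g := by
    have h := deltaMat_wSL_genMat_B (σ g)
    rw [σ_σ] at h
    exact matOp_eq_conj SHat_eq isUnit_SHat h
  B_one := by rw [genMat, cocB_one, OB1_eq]

theorem startsWithB_one : StartsWithB 1 := fun l hl => by simp at hl

/-- Induction on the reduced word: a leading letter a^{±1} is absorbed into the power aᵏ, a leading
b^{±1} is one step of the recursion. -/
theorem exists_startsWithB {P : Free₂ → Prop} (one : P 1)
    (step : ∀ (k : ℤ) (e : Bool) (g : Free₂), StartsWithB g → P g →
      P (cond e b b⁻¹ * a ^ k * g)) (g : Free₂) :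
    ∃ (k : ℤ) (g' : Free₂), StartsWithB g' ∧ P g' ∧ g = a ^ k * g' := by
  suffices h : ∀ L : List (Letter × Bool), FreeGroup.IsReduced L →
      ∃ (k : ℤ) (g' : Free₂), StartsWithB g' ∧ P g' ∧ FreeGroup.mk L = a ^ k * g' by
    have := h g.toWord FreeGroup.isReduced_toWord
    rwa [FreeGroup.mk_toWord] at this
  intro L
  induction L with
  | nil => exact fun _ => ⟨0, 1, startsWithB_one, one, rfl⟩
  | cons x L ih =>
    intro hL
    obtain ⟨k, g', hg', hP, hk⟩ := ih hL.tail
    have hx : FreeGroup.mk (x :: L) = FreeGroup.mk [x] * FreeGroup.mk L := rfl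
    obtain ⟨l, e⟩ := x
    cases l
    · refine ⟨cond e 1 (-1) + k, g', hg', hP, ?_⟩
      rw [hx, hk, zpow_add, mul_assoc]
      cases e <;> rfl
    · refine ⟨0, FreeGroup.mk ((.B, e) :: L), fun l hl => ?_, ?_, (one_mul _).symm⟩
      · rw [FreeGroup.toWord_mk, hL.reduce_eq] at hl
        simp at hl
        rw [← hl]
      · have h := step k e g' hg' hP
        rw [hx, hk, ← mul_assoc]
        cases e <;> exact h

theorem IsGeneratorMatrices.eq_genMat {OA OB : Free₂ → Mat3} (h : IsGeneratorMatrices OA OB) :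
    OA = genMat .A ∧ OB = genMat .B := by
  have h₀ := isGeneratorMatrices_genMat
  have hA : OA = genMat .A := by
    -- The recursion also covers products b aᵏ g' in which b cancels, so it determines the values at
    -- all elements b g, and hence also at words starting with a^{±1}, which it does not reach as
    -- reduced words.
    have hb : ∀ g, OA (b * g) = genMat .A (b * g) := fun g => by
      obtain ⟨k, g', hg', hP, rfl⟩ := exists_startsWithB (P := fun g => OA g = genMat .A g)
        (h.A_one.trans h₀.A_one.symm) (fun k e g hg hP => by
          cases e
          · exact (h.A_rec_inv k g hg).trans (hP ▸ (h₀.A_rec_inv k g hg).symm)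
          · exact (h.A_rec k g hg).trans (hP ▸ (h₀.A_rec k g hg).symm)) g
      rw [← mul_assoc, h.A_rec k g' hg', h₀.A_rec k g' hg', hP]
    funext g
    rw [← mul_inv_cancel_left b g, hb]
  refine ⟨hA, funext fun g => matOp_injective ?_⟩
  rw [h.B_eq, h₀.B_eq, hA]

/-! ## Relations between the generators -/

theorem isRep_O : IsRep O := fun x hx => by
  have h : FreeAlgebra.lift K (fun p : Letter × Free₂ => O p.1 p.2) =
      RingQuot.mkAlgHom K fun x y : FreeAlg => Relator x ∧ y = 0 :=
    FreeAlgebra.hom_ext (funext fun p => FreeAlgebra.lift_ι_apply _ _)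
  rw [h, RingQuot.mkAlgHom_rel K (s := fun x y : FreeAlg => Relator x ∧ y = 0) ⟨hx, rfl⟩, map_zero]

namespace IsRep

variable {R : Type*} [Ring R] [Algebra K R] {f : Letter → Free₂ → R}

theorem A_a_mul (hf : IsRep f) (g : Free₂) : f .A (a * g) = f .A g := by
  simpa only [map_sub, gen, FreeAlgebra.lift_ι_apply, sub_eq_zero] using hf _ (.r0A g)

theorem B_b_mul (hf : IsRep f) (g : Free₂) : f .B (b * g) = f .B g := by
  simpa only [map_sub, gen, FreeAlgebra.lift_ι_apply, sub_eq_zero] using hf _ (.r0B g)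

theorem sq (hf : IsRep f) (X : Letter) (g : Free₂) : f X g * f X g = f X 1 * f X 1 := by
  simpa only [map_sub, map_mul, gen, FreeAlgebra.lift_ι_apply, sub_eq_zero] using hf _ (.r1 X g)

theorem sq_mul (hf : IsRep f) (X : Letter) (g k : Free₂) :
    f X g * (f X g * f X k) = -(qq ^ 2) • f X k := by
  have h := hf _ (.r4 X k)
  simp only [map_add, map_smul, map_mul, gen, FreeAlgebra.lift_ι_apply] at h
  rwa [← mul_assoc, hf.sq, neg_smul, eq_neg_iff_add_eq_zero]

theorem mul_sq (hf : IsRep f) (X : Letter) (g k : Free₂) :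
    f X k * (f X g * f X g) = -(qq ^ 2) • f X k := by
  have h := hf _ (.r5 X k)
  simp only [map_add, map_smul, map_mul, gen, FreeAlgebra.lift_ι_apply] at h
  rwa [hf.sq, ← mul_assoc, neg_smul, eq_neg_iff_add_eq_zero]

theorem A_B_A (hf : IsRep f) (g₁ g₂ g₃ : Free₂) : f .A g₁ * (f .B g₂ * f .A g₃) = 0 := by
  simpa only [map_mul, gen, FreeAlgebra.lift_ι_apply, mul_assoc] using hf _ (.r3 g₁ g₂ g₃)

/-- Oriented as a rewriting rule: squares of A-elements move to the left of B-elements, and by a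
rule below squares of B-elements move to the right of A-elements. With the vanishing rules this
reduces the words below far enough to compare coefficients. -/
theorem B_mul_A_sq (hf : IsRep f) (g k : Free₂) : f .B k * (f .A g * f .A g) =
    -(qq ^ 2) • f .B k - f .A g * (f .A g * f .B k) := by
  have h := hf _ (.r6 k)
  simp only [map_add, map_smul, map_mul, gen, FreeAlgebra.lift_ι_apply] at h
  rwa [← mul_assoc (f .A g), hf.sq, ← mul_assoc, eq_sub_iff_add_eq, neg_smul,
    eq_neg_iff_add_eq_zero, add_comm _ (f .A 1 * _ * _), add_right_comm]

theorem B_A_B (hf : IsRep f) (g₁ g₂ g₃ : Free₂) : f .B g₁ * (f .A g₂ * f .B g₃) = 0 := by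
  simpa only [map_mul, gen, FreeAlgebra.lift_ι_apply, mul_assoc] using hf _ (.r2 g₁ g₂ g₃)

theorem B_sq_mul_A (hf : IsRep f) (g k : Free₂) : f .B g * (f .B g * f .A k) =
    -(qq ^ 2) • f .A k - f .A k * (f .B g * f .B g) := by
  have h := hf _ (.r7 k)
  simp only [map_add, map_smul, map_mul, gen, FreeAlgebra.lift_ι_apply] at h
  rwa [← mul_assoc, hf.sq, ← mul_assoc (f .A k), eq_sub_iff_add_eq, neg_smul,
    eq_neg_iff_add_eq_zero, add_right_comm]

theorem braid_A (hf : IsRep f) (g₁ g₂ : Free₂) :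
    f .A g₂ * (f .A (g₁ * a * b * a * g₂) * f .B (a * g₂)) +
      f .B (a * g₂) * (f .A (g₁ * a * b * a * g₂) * f .A g₂) =
      f .B g₂ * (f .B (σ g₁ * g₂) * f .B g₂) := by
  have h := hf _ (.r8 g₁ g₂)
  simp only [map_sub, map_add, map_mul, gen, FreeAlgebra.lift_ι_apply, sub_eq_zero] at h
  simpa only [← mul_assoc (f _ _)] using h

theorem braid_B (hf : IsRep f) (g₁ g₂ : Free₂) :
    f .B g₂ * (f .B (g₁ * b * a * b * g₂) * f .A (b * g₂)) +
      f .A (b * g₂) * (f .B (g₁ * b * a * b * g₂) * f .B g₂) =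
      f .A g₂ * (f .A (σ g₁ * g₂) * f .A g₂) := by
  have h := hf _ (.r9 g₁ g₂)
  simp only [map_sub, map_add, map_mul, gen, FreeAlgebra.lift_ι_apply, sub_eq_zero] at h
  simpa only [← mul_assoc (f _ _)] using h

theorem braid_A_inv (hf : IsRep f) (g₁ g₂ : Free₂) :
    f .A g₂ * (f .A (g₁ * a⁻¹ * b⁻¹ * a⁻¹ * g₂) * f .B (a⁻¹ * g₂)) +
      f .B (a⁻¹ * g₂) * (f .A (g₁ * a⁻¹ * b⁻¹ * a⁻¹ * g₂) * f .A g₂) =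
      f .B g₂ * (f .B (σ g₁ * g₂) * f .B g₂) := by
  have h := hf _ (.r10 g₁ g₂)
  simp only [map_sub, map_add, map_mul, gen, FreeAlgebra.lift_ι_apply, sub_eq_zero] at h
  simpa only [← mul_assoc (f _ _)] using h

theorem braid_B_inv (hf : IsRep f) (g₁ g₂ : Free₂) :
    f .B g₂ * (f .B (g₁ * b⁻¹ * a⁻¹ * b⁻¹ * g₂) * f .A (b⁻¹ * g₂)) +
      f .A (b⁻¹ * g₂) * (f .B (g₁ * b⁻¹ * a⁻¹ * b⁻¹ * g₂) * f .B g₂) =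
      f .A g₂ * (f .A (σ g₁ * g₂) * f .A g₂) := by
  have h := hf _ (.r11 g₁ g₂)
  simp only [map_sub, map_add, map_mul, gen, FreeAlgebra.lift_ι_apply, sub_eq_zero] at h
  simpa only [← mul_assoc (f _ _)] using h

/-! ### Rewriting rules with a tail -/

/-- Words are associated to the right, so each rule is also needed with a remaining factor z. -/
theorem sq_mul_tail (hf : IsRep f) (X : Letter) (g k : Free₂) (z : R) :
    f X g * (f X g * (f X k * z)) = -(qq ^ 2) • (f X k * z) := by
  rw [← smul_mul_assoc, ← hf.sq_mul X g k, mul_assoc, mul_assoc]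

theorem mul_sq_tail (hf : IsRep f) (X : Letter) (g k : Free₂) (z : R) :
    f X k * (f X g * (f X g * z)) = -(qq ^ 2) • (f X k * z) := by
  rw [← smul_mul_assoc, ← hf.mul_sq X g k, mul_assoc, mul_assoc]

theorem A_B_A_tail (hf : IsRep f) (g₁ g₂ g₃ : Free₂) (z : R) :
    f .A g₁ * (f .B g₂ * (f .A g₃ * z)) = 0 := by
  rw [← mul_assoc (f .B g₂), ← mul_assoc, hf.A_B_A, zero_mul]

theorem B_mul_A_sq_tail (hf : IsRep f) (g k : Free₂) (z : R) :
    f .B k * (f .A g * (f .A g * z)) =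
      -(qq ^ 2) • (f .B k * z) - f .A g * (f .A g * (f .B k * z)) := by
  have h := congrArg (· * z) (hf.B_mul_A_sq g k)
  simpa only [mul_assoc, sub_mul, smul_mul_assoc] using h

theorem B_A_B_tail (hf : IsRep f) (g₁ g₂ g₃ : Free₂) (z : R) :
    f .B g₁ * (f .A g₂ * (f .B g₃ * z)) = 0 := by
  rw [← mul_assoc (f .A g₂), ← mul_assoc, hf.B_A_B, zero_mul]

theorem B_sq_mul_A_tail (hf : IsRep f) (g k : Free₂) (z : R) :
    f .B g * (f .B g * (f .A k * z)) =
      -(qq ^ 2) • (f .A k * z) - f .A k * (f .B g * (f .B g * z)) := by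
  have h := congrArg (· * z) (hf.B_sq_mul_A g k)
  simpa only [mul_assoc, sub_mul, smul_mul_assoc] using h

end IsRep

/-! ### The two symmetries -/

/-- The family `𝐬(𝒪)`. -/
def swapRep {R : Type*} (f : Letter → Free₂ → R) (X : Letter) (g : Free₂) : R := f X.swap (σ g)

theorem isRep_swapRep {R : Type*} [Ring R] [Algebra K R] {f : Letter → Free₂ → R} (hf : IsRep f) :
    IsRep (swapRep f) := by
  intro x hx
  -- The list of relators is stable under the exchange of letters, so each relator is evaluated as
  -- its mirror image.
  have key : ∀ y, Relator y →
      FreeAlgebra.lift K (fun p : Letter × Free₂ => swapRep f p.1 p.2) x =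
        FreeAlgebra.lift K (fun p : Letter × Free₂ => f p.1 p.2) y →
      FreeAlgebra.lift K (fun p : Letter × Free₂ => swapRep f p.1 p.2) x = 0 :=
    fun y hy h => h.trans (hf y hy)
  cases hx with
  | r0A g => exact key _ (.r0B (σ g)) (by
    simp only [map_sub, map_add, map_mul, map_smul, map_inv, map_one, gen, FreeAlgebra.lift_ι_apply,
      σ_a, σ_b, swapRep, Letter.swap])
  | r0B g => exact key _ (.r0A (σ g)) (by
    simp only [map_sub, map_add, map_mul, map_smul, map_inv, map_one, gen, FreeAlgebra.lift_ι_apply,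
      σ_a, σ_b, swapRep, Letter.swap])
  | r1 X g => exact key _ (.r1 X.swap (σ g)) (by
    simp only [map_sub, map_add, map_mul, map_smul, map_inv, map_one, gen, FreeAlgebra.lift_ι_apply,
      σ_a, σ_b, swapRep, Letter.swap])
  | r2 g₁ g₂ g₃ => exact key _ (.r3 (σ g₁) (σ g₂) (σ g₃)) (by
    simp only [map_sub, map_add, map_mul, map_smul, map_inv, map_one, gen, FreeAlgebra.lift_ι_apply,
      σ_a, σ_b, swapRep, Letter.swap])
  | r3 g₁ g₂ g₃ => exact key _ (.r2 (σ g₁) (σ g₂) (σ g₃)) (by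
    simp only [map_sub, map_add, map_mul, map_smul, map_inv, map_one, gen, FreeAlgebra.lift_ι_apply,
      σ_a, σ_b, swapRep, Letter.swap])
  | r4 X g => exact key _ (.r4 X.swap (σ g)) (by
    simp only [map_sub, map_add, map_mul, map_smul, map_inv, map_one, gen, FreeAlgebra.lift_ι_apply,
      σ_a, σ_b, swapRep, Letter.swap])
  | r5 X g => exact key _ (.r5 X.swap (σ g)) (by
    simp only [map_sub, map_add, map_mul, map_smul, map_inv, map_one, gen, FreeAlgebra.lift_ι_apply,
      σ_a, σ_b, swapRep, Letter.swap])
  | r6 g => exact key _ (.r7 (σ g)) (by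
    simp only [map_sub, map_add, map_mul, map_smul, map_inv, map_one, gen, FreeAlgebra.lift_ι_apply,
      σ_a, σ_b, swapRep, Letter.swap])
  | r7 g => exact key _ (.r6 (σ g)) (by
    simp only [map_sub, map_add, map_mul, map_smul, map_inv, map_one, gen, FreeAlgebra.lift_ι_apply,
      σ_a, σ_b, swapRep, Letter.swap])
  | r8 g₁ g₂ => exact key _ (.r9 (σ g₁) (σ g₂)) (by
    simp only [map_sub, map_add, map_mul, map_smul, map_inv, map_one, gen, FreeAlgebra.lift_ι_apply,
      σ_a, σ_b, swapRep, Letter.swap])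
  | r9 g₁ g₂ => exact key _ (.r8 (σ g₁) (σ g₂)) (by
    simp only [map_sub, map_add, map_mul, map_smul, map_inv, map_one, gen, FreeAlgebra.lift_ι_apply,
      σ_a, σ_b, swapRep, Letter.swap])
  | r10 g₁ g₂ => exact key _ (.r11 (σ g₁) (σ g₂)) (by
    simp only [map_sub, map_add, map_mul, map_smul, map_inv, map_one, gen, FreeAlgebra.lift_ι_apply,
      σ_a, σ_b, swapRep, Letter.swap])
  | r11 g₁ g₂ => exact key _ (.r10 (σ g₁) (σ g₂)) (by
    simp only [map_sub, map_add, map_mul, map_smul, map_inv, map_one, gen, FreeAlgebra.lift_ι_apply,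
      σ_a, σ_b, swapRep, Letter.swap])

/-- The family `𝐚(𝒪)`. -/
def twistRep {R : Type*} [Ring R] [Algebra K R] (f : Letter → Free₂ → R) : Letter → Free₂ → R
  | .A, g => -(qq ^ 2)⁻¹ • (f .A 1 * f .A (g * a⁻¹) * f .A 1)
  | .B, g => qq⁻¹ • (Q • (f .A 1 * f .B (g * a⁻¹)) - Q⁻¹ • (f .B (g * a⁻¹) * f .A 1))

/-! ### Stability of the relations under the twist. -/

section

attribute [local instance] Semiring.toNatAlgebra Ring.toIntAlgebra

namespace IsRep

variable {R : Type*} [Ring R] [Algebra K R] {f : Letter → Free₂ → R}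

theorem A_a_inv (hf : IsRep f) : f .A a⁻¹ = f .A 1 := by
  rw [← hf.A_a_mul, mul_inv_cancel]

theorem twistRep_A_one (hf : IsRep f) : twistRep f .A 1 = f .A 1 := by
  have hq := qq_ne_zero
  rw [twistRep, one_mul, hf.A_a_inv, mul_assoc, hf.sq_mul, smul_smul]
  rw [show -(qq ^ 2)⁻¹ * -qq ^ 2 = 1 by field_simp, one_smul]

theorem twistRep_sq (hf : IsRep f) (X : Letter) (g : Free₂) :
    twistRep f X g * twistRep f X g = twistRep f X 1 * twistRep f X 1 := by
  have hq := qq_ne_zero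
  have hQ := Q_ne_zero
  cases X
  · rw [hf.twistRep_A_one]
    simp only [twistRep, mul_assoc, smul_mul_assoc, mul_smul_comm, hf.sq_mul_tail, hf.mul_sq_tail,
      hf.sq_mul, smul_smul]
    match_scalars
    field_simp
  · have h : ∀ g, f .B g * f .B g = f .B 1 * f .B 1 := hf.sq .B
    have h' : ∀ g (z : R), f .B g * (f .B g * z) = f .B 1 * (f .B 1 * z) := fun g z => by
      rw [← mul_assoc, h, mul_assoc]
    simp only [twistRep, hf.A_B_A, hf.A_B_A_tail, hf.B_mul_A_sq, hf.B_mul_A_sq_tail, mul_assoc,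
      smul_mul_assoc, mul_smul_comm, mul_sub, sub_mul, smul_sub, smul_zero, mul_zero, sub_zero,
      zero_sub, h (g * a⁻¹), h (1 * a⁻¹), h' (g * a⁻¹), h' (1 * a⁻¹)]

theorem twistRep_sq_mul_A (hf : IsRep f) (g : Free₂) :
    twistRep f .A 1 * twistRep f .A 1 * twistRep f .A g + qq ^ 2 • twistRep f .A g = 0 := by
  have hq := qq_ne_zero
  rw [hf.twistRep_A_one]
  simp only [twistRep, hf.A_B_A, hf.A_B_A_tail, hf.B_A_B,
    hf.B_A_B_tail, hf.B_mul_A_sq, hf.B_mul_A_sq_tail, hf.B_sq_mul_A, hf.B_sq_mul_A_tail, hf.sq_mul,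
    hf.sq_mul_tail, hf.mul_sq, hf.mul_sq_tail, mul_assoc, smul_mul_assoc, mul_smul_comm, mul_sub,
    sub_mul, smul_sub, mul_add, add_mul, smul_add, smul_smul, smul_zero, smul_neg, mul_zero,
    mul_neg,
    zero_mul, neg_mul, sub_zero, zero_sub, neg_zero, add_zero, zero_add]
  match_scalars
  field_simp
  ring

theorem twistRep_mul_sq_A (hf : IsRep f) (g : Free₂) :
    twistRep f .A g * twistRep f .A 1 * twistRep f .A 1 + qq ^ 2 • twistRep f .A g = 0 := by
  have hq := qq_ne_zero
  rw [hf.twistRep_A_one]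
  simp only [twistRep, hf.A_B_A, hf.A_B_A_tail, hf.B_A_B,
    hf.B_A_B_tail, hf.B_mul_A_sq, hf.B_mul_A_sq_tail, hf.B_sq_mul_A, hf.B_sq_mul_A_tail, hf.sq_mul,
    hf.sq_mul_tail, hf.mul_sq, hf.mul_sq_tail, mul_assoc, smul_mul_assoc, mul_smul_comm, mul_sub,
    sub_mul, smul_sub, mul_add, add_mul, smul_add, smul_smul, smul_zero, smul_neg, mul_zero,
    mul_neg,
    zero_mul, neg_mul, sub_zero, zero_sub, neg_zero, add_zero, zero_add]
  match_scalars
  field_simp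
  ring

theorem twistRep_sq_mul_B (hf : IsRep f) (g : Free₂) :
    twistRep f .B 1 * twistRep f .B 1 * twistRep f .B g + qq ^ 2 • twistRep f .B g = 0 := by
  have hq := qq_ne_zero
  have hQ := Q_ne_zero
  simp only [twistRep, hf.A_B_A, hf.A_B_A_tail,
    hf.B_A_B, hf.B_A_B_tail, hf.B_mul_A_sq, hf.B_mul_A_sq_tail, hf.B_sq_mul_A, hf.B_sq_mul_A_tail,
    hf.sq_mul, hf.sq_mul_tail, hf.mul_sq, hf.mul_sq_tail, mul_assoc, smul_mul_assoc, mul_smul_comm,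
    mul_sub, sub_mul, smul_sub, mul_add, add_mul, smul_add, smul_smul, smul_zero, smul_neg,
    mul_zero,
    mul_neg, zero_mul, neg_mul, sub_zero, zero_sub, neg_zero]
  match_scalars <;> field_simp <;> ring

theorem twistRep_mul_sq_B (hf : IsRep f) (g : Free₂) :
    twistRep f .B g * twistRep f .B 1 * twistRep f .B 1 + qq ^ 2 • twistRep f .B g = 0 := by
  have hq := qq_ne_zero
  have hQ := Q_ne_zero
  simp only [twistRep, hf.A_B_A, hf.A_B_A_tail,
    hf.B_A_B, hf.B_A_B_tail, hf.B_mul_A_sq, hf.B_mul_A_sq_tail, hf.B_sq_mul_A, hf.B_sq_mul_A_tail,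
    hf.sq_mul, hf.sq_mul_tail, hf.mul_sq, hf.mul_sq_tail, mul_assoc, smul_mul_assoc, mul_smul_comm,
    mul_sub, sub_mul, smul_sub, mul_add, add_mul, smul_add, smul_smul, smul_zero, smul_neg,
    mul_zero,
    mul_neg, zero_mul, neg_mul, sub_zero, zero_sub, neg_zero]
  match_scalars <;> field_simp <;> ring

theorem twistRep_B_A_B (hf : IsRep f) (g₁ g₂ g₃ : Free₂) :
    twistRep f .B g₁ * twistRep f .A g₂ * twistRep f .B g₃ = 0 := by
  simp only [twistRep, hf.A_B_A, hf.A_B_A_tail,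
    hf.B_A_B, hf.B_A_B_tail, hf.B_mul_A_sq, hf.B_mul_A_sq_tail, hf.B_sq_mul_A, hf.B_sq_mul_A_tail,
    hf.sq_mul, hf.sq_mul_tail, hf.mul_sq, hf.mul_sq_tail, mul_assoc, smul_mul_assoc, mul_smul_comm,
    mul_sub, sub_mul, smul_sub, mul_add, add_mul, smul_add, smul_smul, smul_zero, smul_neg,
    mul_zero,
    mul_neg, zero_mul, neg_mul, sub_zero, zero_sub, neg_zero]

theorem twistRep_A_B_A (hf : IsRep f) (g₁ g₂ g₃ : Free₂) :
    twistRep f .A g₁ * twistRep f .B g₂ * twistRep f .A g₃ = 0 := by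
  simp only [twistRep, hf.A_B_A, hf.A_B_A_tail,
    hf.B_A_B, hf.B_A_B_tail, hf.B_mul_A_sq, hf.B_mul_A_sq_tail, hf.B_sq_mul_A, hf.B_sq_mul_A_tail,
    hf.sq_mul, hf.sq_mul_tail, hf.mul_sq, hf.mul_sq_tail, mul_assoc, smul_mul_assoc, mul_smul_comm,
    mul_sub, sub_mul, smul_sub, mul_add, add_mul, smul_add, smul_smul, smul_zero, smul_neg,
    mul_zero,
    mul_neg, zero_mul, neg_mul, sub_zero, zero_sub, neg_zero]

theorem twistRep_A_sq_B (hf : IsRep f) (g : Free₂) :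
    twistRep f .A 1 * twistRep f .A 1 * twistRep f .B g + qq ^ 2 • twistRep f .B g +
      twistRep f .B g * twistRep f .A 1 * twistRep f .A 1 = 0 := by
  have hq := qq_ne_zero
  have hQ := Q_ne_zero
  rw [hf.twistRep_A_one]
  simp only [twistRep, hf.A_B_A, hf.A_B_A_tail,
    hf.B_A_B, hf.B_A_B_tail, hf.B_mul_A_sq, hf.B_mul_A_sq_tail, hf.B_sq_mul_A, hf.B_sq_mul_A_tail,
    hf.sq_mul, hf.sq_mul_tail, hf.mul_sq, hf.mul_sq_tail, mul_assoc, smul_mul_assoc, mul_smul_comm,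
    mul_sub, sub_mul, smul_sub, mul_add, add_mul, smul_add, smul_smul, smul_zero, smul_neg,
    mul_zero,
    mul_neg, zero_mul, neg_mul, sub_zero, zero_sub, neg_zero]
  match_scalars <;> field_simp <;> ring

theorem twistRep_B_sq_A (hf : IsRep f) (g : Free₂) :
    twistRep f .B 1 * twistRep f .B 1 * twistRep f .A g + qq ^ 2 • twistRep f .A g +
      twistRep f .A g * twistRep f .B 1 * twistRep f .B 1 = 0 := by
  have hq := qq_ne_zero
  have hQ := Q_ne_zero
  simp only [twistRep, hf.A_B_A, hf.A_B_A_tail,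
    hf.B_A_B, hf.B_A_B_tail, hf.B_mul_A_sq, hf.B_mul_A_sq_tail, hf.B_sq_mul_A, hf.B_sq_mul_A_tail,
    hf.sq_mul, hf.sq_mul_tail, hf.mul_sq, hf.mul_sq_tail, mul_assoc, smul_mul_assoc, mul_smul_comm,
    mul_sub, sub_mul, smul_sub, mul_add, add_mul, smul_add, smul_smul, smul_zero, smul_neg,
    mul_zero,
    mul_neg, zero_mul, neg_mul, sub_zero, zero_sub, neg_zero]
  match_scalars <;> field_simp <;> ring

end IsRep

end

section

attribute [local instance] Semiring.toNatAlgebra Ring.toIntAlgebra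

namespace IsRep

variable {R : Type*} [Ring R] [Algebra K R] {f : Letter → Free₂ → R}

/-- The hypothesis is the relation with all indices translated on the right by a⁻¹. Multiplied by
O_A^{(1)} on one side, it loses a summand because A·B·A vanishes; the resulting `k₁` and `k₂`
eliminate the triple B-words. -/
theorem twistRep_braid_A (hf : IsRep f) {g u v w : Free₂}
    (h : f .A (g * a⁻¹) * (f .A (u * a⁻¹) * f .B (v * a⁻¹)) +
      f .B (v * a⁻¹) * (f .A (u * a⁻¹) * f .A (g * a⁻¹)) =
      f .B (g * a⁻¹) * (f .B (w * a⁻¹) * f .B (g * a⁻¹))) :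
    twistRep f .A g * twistRep f .A u * twistRep f .B v +
      twistRep f .B v * twistRep f .A u * twistRep f .A g -
      twistRep f .B g * twistRep f .B w * twistRep f .B g = 0 := by
  have hq := qq_ne_zero
  have hQ := Q_ne_zero
  have k₁ : f .A 1 * (f .B (g * a⁻¹) * (f .B (w * a⁻¹) * f .B (g * a⁻¹))) =
      f .A 1 * (f .A (g * a⁻¹) * (f .A (u * a⁻¹) * f .B (v * a⁻¹))) := by
    rw [← h, mul_add, hf.A_B_A_tail, add_zero]
  have k₂ : f .B (g * a⁻¹) * (f .B (w * a⁻¹) * (f .B (g * a⁻¹) * f .A 1)) =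
      f .B (v * a⁻¹) * (f .A (u * a⁻¹) * (f .A (g * a⁻¹) * f .A 1)) := by
    have := congrArg (· * f .A 1) h
    simpa only [add_mul, mul_assoc, hf.A_B_A, mul_zero, zero_add] using this.symm
  simp only [twistRep, k₁, k₂, hf.A_B_A, hf.A_B_A_tail, hf.B_A_B,
    hf.B_A_B_tail, hf.B_mul_A_sq, hf.B_mul_A_sq_tail, hf.B_sq_mul_A, hf.B_sq_mul_A_tail, hf.sq_mul,
    hf.sq_mul_tail, hf.mul_sq, hf.mul_sq_tail, mul_assoc, smul_mul_assoc, mul_smul_comm, mul_sub,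
    sub_mul, smul_sub, mul_add, add_mul, smul_add, smul_smul, smul_zero, smul_neg, mul_zero,
    mul_neg,
    zero_mul, neg_mul, sub_zero, zero_sub, neg_zero, add_zero, zero_add]
  match_scalars <;> field_simp <;> ring

/-- Moving the square of A past the first B would produce a subword A·B·A, which vanishes; so the
square acts as the scalar -h². -/
theorem A_sq_mul_B_B_A (hf : IsRep f) (g k k' l : Free₂) (z : R) :
    f .A g * (f .A g * (f .B k * (f .B k' * (f .A l * z)))) =
      -(qq ^ 2) • (f .B k * (f .B k' * (f .A l * z))) := by
  rw [eq_comm, ← sub_eq_zero, ← hf.B_mul_A_sq_tail, hf.A_B_A_tail, mul_zero, mul_zero]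

theorem twistRep_braid_B (hf : IsRep f) {g u v w : Free₂}
    (h : f .B (g * a⁻¹) * (f .B (u * a⁻¹) * f .A (v * a⁻¹)) +
      f .A (v * a⁻¹) * (f .B (u * a⁻¹) * f .B (g * a⁻¹)) =
      f .A (g * a⁻¹) * (f .A (w * a⁻¹) * f .A (g * a⁻¹))) :
    twistRep f .B g * twistRep f .B u * twistRep f .A v +
      twistRep f .A v * twistRep f .B u * twistRep f .B g -
      twistRep f .A g * twistRep f .A w * twistRep f .A g = 0 := by
  have hq := qq_ne_zero
  have hQ := Q_ne_zero
  have k : f .A 1 * (f .A (g * a⁻¹) * (f .A (w * a⁻¹) * (f .A (g * a⁻¹) * f .A 1))) =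
      f .A 1 * (f .B (g * a⁻¹) * (f .B (u * a⁻¹) * (f .A (v * a⁻¹) * f .A 1))) +
        f .A 1 * (f .A (v * a⁻¹) * (f .B (u * a⁻¹) * (f .B (g * a⁻¹) * f .A 1))) := by
    have := congrArg (fun x => f .A 1 * (x * f .A 1)) h
    simpa only [add_mul, mul_add, mul_assoc] using this.symm
  simp only [twistRep, k, hf.A_sq_mul_B_B_A, hf.A_B_A, hf.A_B_A_tail, hf.B_A_B,
    hf.B_A_B_tail, hf.B_mul_A_sq, hf.B_mul_A_sq_tail, hf.B_sq_mul_A, hf.B_sq_mul_A_tail, hf.sq_mul,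
    hf.sq_mul_tail, hf.mul_sq, hf.mul_sq_tail, mul_assoc, smul_mul_assoc, mul_smul_comm, mul_sub,
    sub_mul, smul_sub, mul_add, add_mul, smul_add, smul_smul, smul_zero, smul_neg, mul_zero,
    mul_neg,
    zero_mul, neg_mul, sub_zero, zero_sub, neg_zero, add_zero, zero_add]
  match_scalars <;> field_simp <;> ring

end IsRep

/-- Relations multiply indices on the left while the twist translates them on the right, so the
relation at g₂ comes from the one at g₂ a⁻¹. -/
theorem isRep_twistRep {R : Type*} [Ring R] [Algebra K R] {f : Letter → Free₂ → R}
    (hf : IsRep f) : IsRep (twistRep f) := by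
  intro x hx
  cases hx <;> simp only [map_sub, map_add, map_mul, map_smul, gen, FreeAlgebra.lift_ι_apply]
  case r0A g => rw [twistRep, twistRep, mul_assoc a, hf.A_a_mul, sub_self]
  case r0B g => rw [twistRep, twistRep, mul_assoc b, hf.B_b_mul, sub_self]
  case r1 X g => rw [hf.twistRep_sq, sub_self]
  case r2 g₁ g₂ g₃ => exact hf.twistRep_B_A_B g₁ g₂ g₃
  case r3 g₁ g₂ g₃ => exact hf.twistRep_A_B_A g₁ g₂ g₃
  case r4 X g =>
    cases X
    · exact hf.twistRep_sq_mul_A g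
    · exact hf.twistRep_sq_mul_B g
  case r5 X g =>
    cases X
    · exact hf.twistRep_mul_sq_A g
    · exact hf.twistRep_mul_sq_B g
  case r6 g => exact hf.twistRep_A_sq_B g
  case r7 g => exact hf.twistRep_B_sq_A g
  case r8 g₁ g₂ =>
    exact hf.twistRep_braid_A (by simpa only [mul_assoc] using hf.braid_A g₁ (g₂ * a⁻¹))
  case r9 g₁ g₂ =>
    exact hf.twistRep_braid_B (by simpa only [mul_assoc] using hf.braid_B g₁ (g₂ * a⁻¹))
  case r10 g₁ g₂ =>
    exact hf.twistRep_braid_A (by simpa only [mul_assoc] using hf.braid_A_inv g₁ (g₂ * a⁻¹))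
  case r11 g₁ g₂ =>
    exact hf.twistRep_braid_B (by simpa only [mul_assoc] using hf.braid_B_inv g₁ (g₂ * a⁻¹))

/-! ### The relations of the modular group -/

theorem swapRep_swapRep {R : Type*} (f : Letter → Free₂ → R) : swapRep (swapRep f) = f := by
  funext X g
  cases X <;> exact congrArg _ (σ_σ g)

namespace IsRep

variable {R : Type*} [Ring R] [Algebra K R] {f : Letter → Free₂ → R}

/-- The relation (𝐚𝐬)³ = 1 amounts to 𝐚𝐬𝐚 = 𝐬𝐚⁻¹𝐬, and these two lemmas compute the left side. Here
the triple B-word of the twisted family is replaced by means of its degree-three relation with ε =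
1; the next lemma uses the relation of the original family with ε = -1. -/
theorem twist_swap_twist_A (hf : IsRep f) (k : Free₂) :
    twistRep (swapRep (twistRep f)) .A k =
      qq⁻¹ • (Q • (f .A (k * b) * f .B 1) - Q⁻¹ • (f .B 1 * f .A (k * b))) := by
  have hq := qq_ne_zero
  have hQ := Q_ne_zero
  have h := (isRep_twistRep hf).braid_A (k * a⁻¹) 1
  simp only [mul_one, hf.twistRep_A_one] at h
  rw [twistRep]
  simp only [swapRep, Letter.swap, map_one]
  rw [mul_assoc, ← h]
  simp only [twistRep, mul_inv_cancel, inv_mul_cancel_left, mul_one, hf.A_B_A, hf.A_B_A_tail,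
    hf.B_A_B,
    hf.B_A_B_tail, hf.B_mul_A_sq, hf.B_mul_A_sq_tail, hf.B_sq_mul_A, hf.B_sq_mul_A_tail, hf.sq_mul,
    hf.sq_mul_tail, hf.mul_sq, hf.mul_sq_tail, mul_assoc, smul_mul_assoc, mul_smul_comm, mul_sub,
    sub_mul, smul_sub, mul_add, add_mul, smul_add, smul_smul, smul_zero, smul_neg, mul_zero,
    mul_neg,
    zero_mul, neg_mul, sub_zero, zero_sub, neg_zero, add_zero, zero_add]
  match_scalars <;> field_simp

theorem twist_swap_twist_B (hf : IsRep f) (k : Free₂) :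
    twistRep (swapRep (twistRep f)) .B k = -(qq ^ 2)⁻¹ • (f .B 1 * f .B (k * b) * f .B 1) := by
  have hq := qq_ne_zero
  have hQ := Q_ne_zero
  have h := hf.braid_A_inv (σ k * a) 1
  simp only [mul_one, mul_inv_cancel_right, map_mul, σ_σ, σ_a] at h
  rw [mul_assoc, ← h]
  rw [twistRep]
  simp only [swapRep, Letter.swap, map_one, map_mul, map_inv, σ_a, twistRep, one_mul, hf.A_B_A,
    hf.A_B_A_tail, hf.B_A_B,
    hf.B_A_B_tail, hf.B_mul_A_sq, hf.B_mul_A_sq_tail, hf.B_sq_mul_A, hf.B_sq_mul_A_tail, hf.sq_mul,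
    hf.sq_mul_tail, hf.mul_sq, hf.mul_sq_tail, mul_assoc, smul_mul_assoc, mul_smul_comm, mul_sub,
    sub_mul, smul_sub, mul_add, add_mul, smul_add, smul_smul, smul_zero, smul_neg, mul_zero,
    mul_neg,
    zero_mul, neg_mul, sub_zero, zero_sub, neg_zero, add_zero, zero_add]
  match_scalars <;> field_simp

theorem swap_twist_pow_three (hf : IsRep f) :
    swapRep (twistRep (swapRep (twistRep (swapRep (twistRep f))))) = f := by
  have hq := qq_ne_zero
  have hQ := Q_ne_zero
  have h₁ : twistRep (swapRep (twistRep f)) .B 1 = f .B 1 := by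
    have hb : f .B b = f .B 1 := by rw [← hf.B_b_mul 1, mul_one]
    rw [hf.twist_swap_twist_B, one_mul, hb, mul_assoc, hf.sq_mul, smul_smul,
      show -(qq ^ 2)⁻¹ * -qq ^ 2 = 1 by field_simp, one_smul]
  funext X k
  cases X
  · rw [swapRep, Letter.swap, twistRep]
    simp only [swapRep, Letter.swap, map_one, map_mul, map_inv, σ_a, σ_σ, h₁,
      hf.twist_swap_twist_A, inv_mul_cancel, mul_one, hf.A_B_A, hf.A_B_A_tail, hf.B_A_B,
    hf.B_A_B_tail, hf.B_mul_A_sq, hf.B_mul_A_sq_tail, hf.B_sq_mul_A, hf.B_sq_mul_A_tail, hf.sq_mul,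
    hf.sq_mul_tail, hf.mul_sq, hf.mul_sq_tail, mul_assoc, smul_mul_assoc, mul_smul_comm, mul_sub,
    sub_mul, smul_sub, mul_add, add_mul, smul_add, smul_smul, smul_zero, smul_neg, mul_zero,
    mul_neg,
    zero_mul, neg_mul, sub_zero, zero_sub, neg_zero, add_zero, zero_add]
    match_scalars <;> field_simp
    ring
  · rw [swapRep, Letter.swap, twistRep]
    simp only [swapRep, Letter.swap, map_one, map_mul, map_inv, σ_a, σ_σ, h₁,
      hf.twist_swap_twist_B, inv_mul_cancel, mul_one, hf.A_B_A, hf.A_B_A_tail, hf.B_A_B,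
    hf.B_A_B_tail, hf.B_mul_A_sq, hf.B_mul_A_sq_tail, hf.B_sq_mul_A, hf.B_sq_mul_A_tail, hf.sq_mul,
    hf.sq_mul_tail, hf.mul_sq, hf.mul_sq_tail, mul_assoc, smul_mul_assoc, mul_smul_comm, mul_sub,
    sub_mul, smul_sub, mul_add, add_mul, smul_add, smul_smul, smul_zero, smul_neg, mul_zero,
    mul_neg,
    zero_mul, neg_mul, sub_zero, zero_sub, neg_zero, add_zero, zero_add]
    match_scalars
    field_simp

end IsRep

end

/-! ### The automorphisms of `𝒜` -/

/-- The endomorphism `𝐬` of `𝒜`. -/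
def swapHom : Alg →ₐ[K] Alg := algLift (swapRep O) (isRep_swapRep isRep_O)

/-- The endomorphism `𝐚` of `𝒜`. -/
def twistHom : Alg →ₐ[K] Alg := algLift (twistRep O) (isRep_twistRep isRep_O)

theorem alg_hom_ext {θ θ' : Alg →ₐ[K] Alg} (h : ∀ X g, θ (O X g) = θ' (O X g)) : θ = θ' := by
  refine AlgHom.ext fun x => ?_
  induction x using alg_induction with
  | algebraMap_mem r => rw [AlgHom.commutes, AlgHom.commutes]
  | gen_mem X g => exact h X g
  | mul_mem x y hx hy => rw [map_mul, map_mul, hx, hy]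
  | add_mem x y hx hy => rw [map_add, map_add, hx, hy]

theorem hom_swapHom_O (θ : Alg →ₐ[K] Alg) (X : Letter) (g : Free₂) :
    θ (swapHom (O X g)) = swapRep (fun X g => θ (O X g)) X g :=
  congrArg θ (algLift_O _ _ X g)

/-- The twist of families is natural under algebra homomorphisms. The innermost endomorphism becomes
the outermost operation on families, so the order of composition is reversed. -/
theorem hom_twistHom_O (θ : Alg →ₐ[K] Alg) (X : Letter) (g : Free₂) :
    θ (twistHom (O X g)) = twistRep (fun X g => θ (O X g)) X g := by
  rw [twistHom, algLift_O]
  cases X <;> simp only [twistRep, map_smul, map_sub, map_mul]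

theorem swapHom_swapHom : swapHom.comp swapHom = AlgHom.id K Alg := alg_hom_ext fun X g => by
  rw [AlgHom.comp_apply, hom_swapHom_O]
  exact (algLift_O _ _ _ _).trans (congrFun (congrFun (swapRep_swapRep O) X) g)

theorem twistHom_swapHom_pow_three (x : Alg) :
    twistHom (swapHom (twistHom (swapHom (twistHom (swapHom x))))) = x := by
  have h : twistHom.comp (swapHom.comp (twistHom.comp (swapHom.comp (twistHom.comp swapHom)))) =
      AlgHom.id K Alg := alg_hom_ext fun X g => by
    have h₁ : (fun X g => twistHom (O X g)) = twistRep O :=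
      funext fun X => funext fun g => algLift_O _ _ X g
    have h₂ : (fun X g => twistHom (swapHom (O X g))) = swapRep (twistRep O) :=
      funext fun X => funext fun g => by rw [hom_swapHom_O twistHom, h₁]
    have h₃ : (fun X g => twistHom (swapHom (twistHom (O X g)))) =
        twistRep (swapRep (twistRep O)) := funext fun X => funext fun g => by
      rw [← h₂]
      exact hom_twistHom_O (twistHom.comp swapHom) X g
    have h₄ : (fun X g => twistHom (swapHom (twistHom (swapHom (O X g))))) =
        swapRep (twistRep (swapRep (twistRep O))) := funext fun X => funext fun g => by
      rw [← h₃]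
      exact hom_swapHom_O (twistHom.comp (swapHom.comp twistHom)) X g
    have h₅ : (fun X g => twistHom (swapHom (twistHom (swapHom (twistHom (O X g)))))) =
        twistRep (swapRep (twistRep (swapRep (twistRep O)))) := funext fun X => funext fun g => by
      rw [← h₄]
      exact hom_twistHom_O (twistHom.comp (swapHom.comp (twistHom.comp swapHom))) X g
    refine (hom_swapHom_O
      (twistHom.comp (swapHom.comp (twistHom.comp (swapHom.comp twistHom)))) X g).trans ?_
    exact congrFun (congrFun ((congrArg swapRep h₅).trans isRep_O.swap_twist_pow_three) X) g
  exact DFunLike.congr_fun h x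

/-- The automorphism `𝐬` of `𝒜`. -/
def swapEquiv : Alg ≃ₐ[K] Alg := AlgEquiv.ofAlgHom swapHom swapHom swapHom_swapHom swapHom_swapHom

theorem swapHom_apply_swapHom (x : Alg) : swapHom (swapHom x) = x :=
  DFunLike.congr_fun swapHom_swapHom x

/-- The automorphism `𝐚` of `𝒜`. -/
def twistEquiv : Alg ≃ₐ[K] Alg :=
  -- From (𝐚𝐬)³ = 1 the inverse of 𝐚 is 𝐬𝐚𝐬𝐚𝐬; that it is a left inverse as well uses 𝐬² = 1.
  AlgEquiv.ofAlgHom twistHom (swapHom.comp (twistHom.comp (swapHom.comp (twistHom.comp swapHom))))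
    (AlgHom.ext twistHom_swapHom_pow_three) (AlgHom.ext fun x => by
      have h := twistHom_swapHom_pow_three (swapHom x)
      rw [swapHom_apply_swapHom] at h
      exact (congrArg swapHom h).trans (swapHom_apply_swapHom x))

theorem isSwap_swapEquiv : IsSwap swapEquiv where
  map_A g := algLift_O _ _ .A g
  map_B g := algLift_O _ _ .B g

theorem isTwist_twistEquiv : IsTwist twistEquiv where
  map_A g := algLift_O _ _ .A g
  map_B g := algLift_O _ _ .B g

theorem twistEquiv_mul_swapEquiv_pow_three : (twistEquiv * swapEquiv) ^ 3 = 1 := by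
  rw [pow_succ, pow_two]
  exact AlgEquiv.ext twistHom_swapHom_pow_three

theorem swapEquiv_sq : swapEquiv ^ 2 = 1 := by
  rw [pow_two]
  exact AlgEquiv.ext swapHom_apply_swapHom

end
end EllipticDAHA

/-! ### Assembly of the theorem. -/

theorem mainTheorem1 :
    -- the difference operators are invertible
    IsUnit DHatA ∧ IsUnit DHatB ∧
    -- `𝐚` and `𝐬` are automorphisms of `𝒜` and satisfy the defining relations of `PSL(2, ℤ)`
    ∃ α ς : Alg ≃ₐ[K] Alg, IsTwist α ∧ IsSwap ς ∧ (α * ς) ^ 3 = 1 ∧ ς ^ 2 = 1 ∧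
    -- the matrices `O_A^{(g)}`, `O_B^{(g)}` exist and are unique
    ∃ OA OB : Free₂ → Mat3, IsGeneratorMatrices OA OB ∧
      (∀ OA' OB' : Free₂ → Mat3, IsGeneratorMatrices OA' OB' → OA' = OA ∧ OB' = OB) ∧
    -- they define a homomorphism of `𝐤`-algebras, which is equivariant
    ∃ Ψ : Alg →ₐ[K] Mat3,
      (∀ g, Ψ (O .A g) = OA g) ∧ (∀ g, Ψ (O .B g) = OB g) ∧
      (∀ x, matOp (Ψ (α x)) = Ring.inverse DHatA * matOp (Ψ x) * DHatA) ∧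
      (∀ x, matOp (Ψ (ς x)) = Ring.inverse SHat * matOp (Ψ x) * SHat) := by
  refine ⟨isUnit_DHatA, isUnit_DHatB, twistEquiv, swapEquiv, isTwist_twistEquiv, isSwap_swapEquiv,
    twistEquiv_mul_swapEquiv_pow_three, swapEquiv_sq, genMat .A, genMat .B,
    isGeneratorMatrices_genMat, fun _ _ h => h.eq_genMat, rep, rep_A, rep_B, ?_, ?_⟩
  · exact fun x => rep_twist isTwist_twistEquiv x
  · exact fun x => rep_swap isSwap_swapEquiv x
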